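/- **Setting.** Identify $\mathbb R^5$ with the traceless symmetric real $3\times3$ matrices by $$\mu(x)=\begin{pmatrix} \frac{x_1}{\sqrt3}-x_4 & x_2 & x_3\\ x_2 & \frac{x_1}{\sqrt3}+x_4 & x_5\\ x_3 & x_5 & -\frac{2x_1}{\sqrt3}\end{pmatrix},$$ and let $\iota:SO(3)\to SO(5)$ be the representation $\iota(h)x=\mu^{-1}(h\,\mu(x)\,h^{T})$. Let $M$ be a smooth $5$-manifold with an irreducible $SO(3)$-structure, i.e. a smooth reduction of its frame bundle to $\iota(SO(3))$; the frames $a=(a_1,\dots,a_5)$ of the reduction are called adapted. Adapted frames are orthonormal and positively oriented for a Riemannian metric $g$ and an orientation of $M$. Bivectors have the metric $g(x\wedge y,u\wedge v)=g(x,u)g(y,v)-g(x,v)g(y,u)$, and a bivector $\sigma$ is also regarded as the skew endomorphism with $g(\sigma(X),Y)=g(\sigma,X\wedge Y)$. Let $\Lambda^2_3TM$ be the rank $3$ subbundle of $\Lambda^2TM$ spanned, in an adapted frame, by $$\kappa_1=\sqrt3\,a_1\wedge a_5+a_2\wedge a_3+a_4\wedge a_5,\quad \kappa_2=\sqrt3\,a_1\wedge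 a_3+a_2\wedge a_5+a_3\wedge a_4,\quad \kappa_3=2a_2\wedge a_4+a_3\wedge a_5$$ (with $|\kappa_i|^2=5$); it is the eigenbundle, for the eigenvalue $7$, of $W\mapsto 4\sum_j\Upsilon_{W(a_j)}\circ\Upsilon_{a_j}$ on endomorphisms, where $g(\Upsilon_v x,y)=\Upsilon(v,x,y)$ and $\Upsilon$ is the symmetric trilinear form with $\Upsilon(x,x,x)=\frac{3\sqrt3}{2}\det\mu(x)$ in adapted frames. The twistor space is the $7$-manifold $\mathbb T=\{\sigma\in\Lambda^2_3TM:|\sigma|^2=5\}$, with projection $\pi:\mathbb T\to M$. For $\sigma\in\mathbb T$ over $p=\pi(\sigma)$ put $\xi_\sigma=\frac14*(\sigma\wedge\sigma)\in T_pM$ (a unit vector), and let $H^\sigma=\xi_\sigma^\perp$, oriented so that $T_pM=\mathbb R\xi_\sigma\oplus H^\sigma$ as oriented spaces. Let $\sigma_\pm$ be the self-dual and anti-self-dual parts of $\sigma\in\Lambda^2H^\sigma$. Let $\varphi^\sigma_\pm$ be the endomorphism of $T_pM$ with $\varphi^\sigma_\pm(\xi_\sigma)=0$ and $g(\varphi^\sigma_\pm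 X,Y)=\frac{2}{2\pm1}\,g(\sigma_\pm,X\wedge Y)$ for $X,Y\in H^\sigma$, $\varphi^\sigma_\pm(H^\sigma)\subset H^\sigma$. Let $\nabla$ be an $SO(3)$-connection on $M$ (a connection on $TM$ whose connection forms in adapted frames take values in the Lie algebra of $\iota(SO(3))$), with torsion $T(X,Y)=\nabla_XY-\nabla_YX-[X,Y]$. It induces a connection on $\Lambda^2_3TM$ and a splitting $T\mathbb T=\mathcal H\oplus\mathcal V$ into horizontal and vertical parts; $X^h_\sigma$ denotes the horizontal lift of $X\in T_pM$, and $\mathcal V_\sigma$ is the orthogonal complement of $\sigma$ in $\Lambda^2_3T_pM$. For $t>0$ put $$h_t(X^h_\sigma+V,Y^h_\sigma+W)=g(X,Y)+t\,g(V,W),\qquad \chi_\sigma=(\xi_\sigma)^h_\sigma,\qquad \eta_t(A)=h_t(A,\chi),$$ and, for $n=1,2$, $$\Phi^{(n)}_\pm X^h_\sigma=(\varphi^\sigma_\pm X)^h_\sigma,\qquad \Phi^{(n)}_\pm V=(-1)^{n+1}\mathcal JV,\qquad \mathcal JV=-\sigma\times V\quad(V\in\mathcal V_\sigma),\qquad \Omega^{(n)}_{\pm,t}(A,B)=h_t(A,\Phi^{(n)}_\pm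 B),$$ where $\times$ is the cross product on $\Lambda^2_3T_pM$ with $\kappa_1\times\kappa_2=\kappa_3$ (and cyclically). The exterior derivative is normalized by $d\eta(A,B)=A(\eta(B))-B(\eta(A))-\eta([A,B])$. **Statement.** 1. If the torsion of $\nabla$ is totally skew-symmetric, i.e. $g(T(X,Y),Z)$ is skew-symmetric in $X,Y,Z$, then for all $\sigma\in\mathbb T$, $X,Y\in T_{\pi(\sigma)}M$, $V,W\in\mathcal V_\sigma$ and each choice of the sign, $$d\eta_t(X^h_\sigma+V,\,Y^h_\sigma+W)=-\tfrac12\big[g(T(X,\xi_\sigma),Y)-g(T(Y,\xi_\sigma),X)\big]\pm\big[g(\varphi^\sigma_\pm X,W(\xi_\sigma))-g(\varphi^\sigma_\pm Y,V(\xi_\sigma))\big].$$ 2. For every $SO(3)$-connection $\nabla$ and every $t>0$, $d\eta_t\ne0$ at every point of $\mathbb T$. 3. For every $SO(3)$-connection $\nabla$, every $t>0$, each sign and $n=1,2$, one has $d\eta_t\neq\Omega^{(n)}_{\pm,t}$ at every point of $\mathbb T$; in particular, if $M\ne\emptyset$, the almost contact metric structure $(\Phi^{(n)}_\pm,\chi,h_t)$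 is not contact. -/

import Mathlib

open Bundle Set
open scoped Manifold ContDiff Matrix

noncomputable section

namespace IrrSO3

/-! ## The irreducible representation of `SO(3)` on `ℝ⁵` -/

/-- The isomorphism `μ` of `ℝ⁵` onto the traceless symmetric `3 × 3` matrices. -/
def mu (x : Fin 5 → ℝ) : Matrix (Fin 3) (Fin 3) ℝ :=
  !![x 0 / √3 - x 3, x 1, x 2;
     x 1, x 0 / √3 + x 3, x 4;
     x 2, x 4, -2 * (x 0 / √3)]

/-- The inverse of `μ` on traceless symmetric matrices. -/
def muInv (S : Matrix (Fin 3) (Fin 3) ℝ) : Fin 5 → ℝ :=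
  ![-(√3 / 2) * S 2 2, S 0 1, S 0 2, (S 1 1 - S 0 0) / 2, S 1 2]

lemma muInv_mu (x : Fin 5 → ℝ) : muInv (mu x) = x := by
  have h : √3 ≠ 0 := by positivity
  ext i; fin_cases i <;> simp [mu, muInv]; field_simp

lemma mu_muInv (S : Matrix (Fin 3) (Fin 3) ℝ) (hs : Sᵀ = S) (ht : S.trace = 0) :
    mu (muInv S) = S := by
  have h : √3 ≠ 0 := by positivity
  have h1 : ∀ i j, S i j = S j i := fun i j => by rw [← Matrix.transpose_apply S j i, hs]
  rw [Matrix.trace_fin_three] at ht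
  ext i j
  have h2 : √3 / 2 * S 2 2 / √3 = S 2 2 / 2 := by field_simp
  fin_cases i <;> fin_cases j <;> simp [mu, muInv, neg_div, h2] <;>
    first | linarith | linarith [h1 1 0] | linarith [h1 2 0] | linarith [h1 2 1]

lemma mu_transpose (x : Fin 5 → ℝ) : (mu x)ᵀ = mu x := by
  ext i j; fin_cases i <;> fin_cases j <;> rfl

lemma mu_trace (x : Fin 5 → ℝ) : (mu x).trace = 0 := by
  rw [Matrix.trace_fin_three]; simp [mu]; ring

/-- The representation `ρ(h) x = μ⁻¹(h μ(x) h⁻¹)`; for `h ∈ SO(3)` one has `h⁻¹ = hᵀ`. -/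
def rho (h : Matrix (Fin 3) (Fin 3) ℝ) (x : Fin 5 → ℝ) : Fin 5 → ℝ :=
  muInv (h * mu x * hᵀ)

/-- The matrix of `ρ(h)` in the standard basis: the embedding `ι : SO(3) → SO(5)`. -/
def iota (h : Matrix (Fin 3) (Fin 3) ℝ) : Matrix (Fin 5) (Fin 5) ℝ :=
  Matrix.of fun i j => rho h (Pi.single j 1) i

/-- The differential of `ι` at the identity: `A ∈ so(3)` acts by `x ↦ μ⁻¹([A, μ(x)])`. -/
def iotaLie (A : Matrix (Fin 3) (Fin 3) ℝ) : Matrix (Fin 5) (Fin 5) ℝ :=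
  Matrix.of fun i j => muInv (A * mu (Pi.single j 1) - mu (Pi.single j 1) * A) i

/-- The cubic form `Υ(x, x, x)`. -/
def upsilonCubic (x : Fin 5 → ℝ) : ℝ :=
  1 / 2 * x 0 * (6 * x 1 ^ 2 + 6 * x 3 ^ 2 - 2 * x 0 ^ 2 - 3 * x 2 ^ 2 - 3 * x 4 ^ 2)
    + 3 * √3 / 2 * x 3 * (x 4 ^ 2 - x 2 ^ 2) + 3 * √3 * x 1 * x 2 * x 4

/-- The symmetric `3`-form `Υ(x, y, z)`, by polarization. -/
def upsilon (x y z : Fin 5 → ℝ) : ℝ :=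
  (upsilonCubic (x + y + z) - upsilonCubic (x + y) - upsilonCubic (y + z) - upsilonCubic (x + z)
    + upsilonCubic x + upsilonCubic y + upsilonCubic z) / 6

/-- The matrix of the endomorphism `Υ_v`, `g(Υ_v x, y) = Υ(v, x, y)`. -/
def upsilonEnd (v : Fin 5 → ℝ) : Matrix (Fin 5) (Fin 5) ℝ :=
  Matrix.of fun i j => upsilon v (Pi.single j 1) (Pi.single i 1)

/-- `Υ̂(W) = 4 ∑ⱼ Υ_{W eⱼ} ∘ Υ_{eⱼ}` on endomorphisms of `ℝ⁵`. -/
def upsilonHat (W : Matrix (Fin 5) (Fin 5) ℝ) : Matrix (Fin 5) (Fin 5) ℝ :=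
  (4 : ℝ) • ∑ j, upsilonEnd (fun i => W i j) * upsilonEnd (Pi.single j 1)

/-- The space `Λ²₃`, bivectors being viewed as endomorphisms, `g(σ x, y) = g(σ, x ∧ y)`. -/
def Lambda23 : Set (Matrix (Fin 5) (Fin 5) ℝ) := {F | upsilonHat F = (7 : ℝ) • F}

/-- The endomorphism of `ℝ⁵` given by the bivector `eᵢ ∧ eⱼ`: it maps `eᵢ` to `eⱼ` and `eⱼ`
to `-eᵢ`. -/
def bivec (i j : Fin 5) : Matrix (Fin 5) (Fin 5) ℝ :=
  Matrix.single j i 1 - Matrix.single i j 1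

/-- The bivectors `κ₁, κ₂, κ₃` of the standard basis. -/
def kappa : Fin 3 → Matrix (Fin 5) (Fin 5) ℝ :=
  ![√3 • bivec 0 4 + bivec 1 2 + bivec 3 4,
    √3 • bivec 0 2 + bivec 1 4 + bivec 2 3,
    (2 : ℝ) • bivec 1 3 + bivec 2 4]

/-- The metric on bivectors, `g(x ∧ y, u ∧ v) = g(x, u) g(y, v) - g(x, v) g(y, u)`. -/
def bivInner (F G : Matrix (Fin 5) (Fin 5) ℝ) : ℝ := 1 / 2 * ∑ i, ∑ j, F i j * G i j

/-! ### Invariance of these notions under `ι(SO(3))` -/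

lemma upsilonCubic_eq_det (x : Fin 5 → ℝ) : upsilonCubic x = 3 * √3 / 2 * (mu x).det := by
  have h : √3 ≠ 0 := by positivity
  have h2 : √3 ^ 2 = 3 := Real.sq_sqrt (by norm_num)
  have h3 : √3 ^ 3 = 3 * √3 := by rw [pow_succ, h2]
  rw [Matrix.det_fin_three]
  simp [mu, upsilonCubic]
  field_simp
  ring_nf
  simp only [h2, h3]
  ring

lemma sum_mul_eq_trace (x y : Fin 5 → ℝ) :
    ∑ i, x i * y i = 1 / 2 * (mu x * mu y).trace := by
  have h : √3 ≠ 0 := by positivity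
  have h2 : √3 ^ 2 = 3 := Real.sq_sqrt (by norm_num)
  rw [Matrix.trace_fin_three]
  simp [mu, Fin.sum_univ_five, Matrix.mul_apply, Fin.sum_univ_three]
  field_simp
  ring_nf
  simp only [h2]
  ring

lemma mu_add (x y : Fin 5 → ℝ) : mu (x + y) = mu x + mu y := by
  ext i j; fin_cases i <;> fin_cases j <;> simp [mu] <;> ring

lemma mu_smul (c : ℝ) (x : Fin 5 → ℝ) : mu (c • x) = c • mu x := by
  ext i j; fin_cases i <;> fin_cases j <;> simp [mu] <;> ring

lemma muInv_add (x y : Matrix (Fin 3) (Fin 3) ℝ) : muInv (x + y) = muInv x + muInv y := by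
  ext i; fin_cases i <;> simp [muInv] <;> ring

lemma muInv_smul (c : ℝ) (x : Matrix (Fin 3) (Fin 3) ℝ) : muInv (c • x) = c • muInv x := by
  ext i; fin_cases i <;> simp [muInv] <;> ring

lemma rho_add (h : Matrix (Fin 3) (Fin 3) ℝ) (x y : Fin 5 → ℝ) :
    rho h (x + y) = rho h x + rho h y := by
  simp [rho, mu_add, muInv_add, Matrix.mul_add, Matrix.add_mul]

lemma rho_smul (h : Matrix (Fin 3) (Fin 3) ℝ) (c : ℝ) (x : Fin 5 → ℝ) :
    rho h (c • x) = c • rho h x := by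
  simp [rho, mu_smul, muInv_smul]

lemma iota_mulVec (h : Matrix (Fin 3) (Fin 3) ℝ) (x : Fin 5 → ℝ) : iota h *ᵥ x = rho h x := by
  have h1 : iota h = LinearMap.toMatrix' (R := ℝ)
      { toFun := rho h, map_add' := rho_add h, map_smul' := rho_smul h } := by
    ext i j; simp [iota, LinearMap.toMatrix'_apply]
  rw [h1, ← Matrix.toLin'_apply, Matrix.toLin'_toMatrix']; rfl

lemma so3_mul_transpose {h : Matrix (Fin 3) (Fin 3) ℝ}
    (hh : h ∈ Matrix.specialOrthogonalGroup (Fin 3) ℝ) :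
    h * hᵀ = 1 := by
  have := (Matrix.mem_specialOrthogonalGroup_iff.1 hh).1
  simpa using (Matrix.mem_orthogonalGroup_iff (Fin 3) ℝ).1 this

lemma so3_transpose_mul {h : Matrix (Fin 3) (Fin 3) ℝ}
    (hh : h ∈ Matrix.specialOrthogonalGroup (Fin 3) ℝ) :
    hᵀ * h = 1 := by
  have := (Matrix.mem_specialOrthogonalGroup_iff.1 hh).1
  simpa using (Matrix.mem_orthogonalGroup_iff' (Fin 3) ℝ).1 this

lemma mu_rho {h : Matrix (Fin 3) (Fin 3) ℝ}
    (hh : h ∈ Matrix.specialOrthogonalGroup (Fin 3) ℝ) (x : Fin 5 → ℝ) : mu (rho h x) = h * mu x * hᵀ := by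
  apply mu_muInv
  · simp [Matrix.transpose_mul, mu_transpose, Matrix.mul_assoc]
  · rw [Matrix.trace_mul_comm, ← Matrix.mul_assoc, so3_transpose_mul hh, one_mul, mu_trace]

lemma rho_dot {h : Matrix (Fin 3) (Fin 3) ℝ}
    (hh : h ∈ Matrix.specialOrthogonalGroup (Fin 3) ℝ) (x y : Fin 5 → ℝ) : ∑ i, rho h x i * rho h y i = ∑ i, x i * y i := by
  rw [sum_mul_eq_trace, sum_mul_eq_trace, mu_rho hh, mu_rho hh]
  congr 1
  calc (h * mu x * hᵀ * (h * mu y * hᵀ)).trace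
      = (h * (mu x * (hᵀ * h) * mu y * hᵀ)).trace := by simp only [Matrix.mul_assoc]
    _ = _ := by
      rw [so3_transpose_mul hh, mul_one, Matrix.trace_mul_comm, Matrix.mul_assoc,
        so3_transpose_mul hh, mul_one]

lemma iota_transpose_mul {h : Matrix (Fin 3) (Fin 3) ℝ}
    (hh : h ∈ Matrix.specialOrthogonalGroup (Fin 3) ℝ) :
    (iota h)ᵀ * iota h = 1 := by
  ext i j
  rw [Matrix.mul_apply]
  have := rho_dot hh (Pi.single i 1) (Pi.single j 1)
  simp only [Matrix.transpose_apply, iota, Matrix.of_apply]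
  rw [this, Matrix.one_apply]
  simp [Pi.single_apply, eq_comm]

lemma upsilonCubic_rho {h : Matrix (Fin 3) (Fin 3) ℝ}
    (hh : h ∈ Matrix.specialOrthogonalGroup (Fin 3) ℝ) (x : Fin 5 → ℝ) : upsilonCubic (rho h x) = upsilonCubic x := by
  rw [upsilonCubic_eq_det, upsilonCubic_eq_det, mu_rho hh, Matrix.det_mul_right_comm,
    so3_mul_transpose hh, one_mul]

lemma upsilon_rho {h : Matrix (Fin 3) (Fin 3) ℝ}
    (hh : h ∈ Matrix.specialOrthogonalGroup (Fin 3) ℝ) (x y z : Fin 5 → ℝ) :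
    upsilon (rho h x) (rho h y) (rho h z) = upsilon x y z := by
  simp only [upsilon, ← rho_add, upsilonCubic_rho hh]

/-- `Υ` written out as a trilinear form. -/
lemma upsilon_eq (x y z : Fin 5 → ℝ) : upsilon x y z =
    x 0 * y 1 * z 1 + x 1 * y 0 * z 1 + x 1 * y 1 * z 0
    + x 0 * y 3 * z 3 + x 3 * y 0 * z 3 + x 3 * y 3 * z 0 - x 0 * y 0 * z 0
    - 1 / 2 * (x 0 * y 2 * z 2 + x 2 * y 0 * z 2 + x 2 * y 2 * z 0)
    - 1 / 2 * (x 0 * y 4 * z 4 + x 4 * y 0 * z 4 + x 4 * y 4 * z 0)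
    + √3 / 2 * (x 3 * y 4 * z 4 + x 4 * y 3 * z 4 + x 4 * y 4 * z 3)
    - √3 / 2 * (x 3 * y 2 * z 2 + x 2 * y 3 * z 2 + x 2 * y 2 * z 3)
    + √3 / 2 * (x 1 * y 2 * z 4 + x 1 * y 4 * z 2 + x 2 * y 1 * z 4 + x 2 * y 4 * z 1
      + x 4 * y 1 * z 2 + x 4 * y 2 * z 1) := by
  simp only [upsilon, upsilonCubic, Pi.add_apply]
  ring

/-- The matrix of `Υ_v`, written out. -/
lemma upsilonEnd_eq (v : Fin 5 → ℝ) : upsilonEnd v =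
    !![-v 0, v 1, -v 2 / 2, v 3, -v 4 / 2;
       v 1, v 0, √3 / 2 * v 4, 0, √3 / 2 * v 2;
       -v 2 / 2, √3 / 2 * v 4, -v 0 / 2 - √3 / 2 * v 3, -√3 / 2 * v 2, √3 / 2 * v 1;
       v 3, 0, -√3 / 2 * v 2, v 0, √3 / 2 * v 4;
       -v 4 / 2, √3 / 2 * v 2, √3 / 2 * v 1, √3 / 2 * v 4, -v 0 / 2 + √3 / 2 * v 3] := by
  ext i j
  fin_cases i <;> fin_cases j <;> simp [upsilonEnd, upsilon_eq] <;> ring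

lemma upsilonEnd_dot (v x y : Fin 5 → ℝ) : y ⬝ᵥ (upsilonEnd v *ᵥ x) = upsilon v x y := by
  rw [upsilonEnd_eq, upsilon_eq]
  simp [dotProduct, Matrix.mulVec, Fin.sum_univ_five]
  ring

lemma upsilonEnd_add (v w : Fin 5 → ℝ) : upsilonEnd (v + w) = upsilonEnd v + upsilonEnd w := by
  ext i j; simp only [upsilonEnd, upsilon_eq, Matrix.of_apply, Matrix.add_apply, Pi.add_apply]; ring

lemma upsilonEnd_smul (c : ℝ) (v : Fin 5 → ℝ) : upsilonEnd (c • v) = c • upsilonEnd v := by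
  ext i j
  simp only [upsilonEnd, upsilon_eq, Matrix.of_apply, Matrix.smul_apply, Pi.smul_apply, smul_eq_mul]
  ring

/-- `v ↦ Υ_v` as a linear map. -/
def upsilonLin : (Fin 5 → ℝ) →ₗ[ℝ] Matrix (Fin 5) (Fin 5) ℝ where
  toFun := upsilonEnd
  map_add' := upsilonEnd_add
  map_smul' := upsilonEnd_smul

set_option maxHeartbeats 4000000 in
/-- The operator `Υ̂`, written out. -/
lemma upsilonHat_eq (W : Matrix (Fin 5) (Fin 5) ℝ) : upsilonHat W =
    !![4 * W 0 0 + 4 * W 1 1 + W 2 2 + 4 * W 3 3 + W 4 4,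
       -4 * W 0 1 + 4 * W 1 0 - √3 * W 2 4 - √3 * W 4 2,
       2 * W 0 2 + 2 * √3 * W 1 4 + W 2 0 + √3 * W 2 3 - 2 * √3 * W 3 2 - √3 * W 4 1,
       -4 * W 0 3 + √3 * W 2 2 + 4 * W 3 0 - √3 * W 4 4,
       2 * W 0 4 + 2 * √3 * W 1 2 - √3 * W 2 1 + 2 * √3 * W 3 4 + W 4 0 - √3 * W 4 3;
       4 * W 0 1 - 4 * W 1 0 - √3 * W 2 4 - √3 * W 4 2,
       4 * W 0 0 + 4 * W 1 1 + 3 * W 2 2 + 3 * W 4 4,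
       2 * √3 * W 0 4 - 2 * W 1 2 + 3 * W 2 1 - √3 * W 4 0 - 3 * W 4 3,
       4 * W 1 3 + 3 * W 2 4 - 3 * W 4 2,
       2 * √3 * W 0 2 - 2 * W 1 4 - √3 * W 2 0 + 3 * W 2 3 + 3 * W 4 1;
       W 0 2 - √3 * W 1 4 + 2 * W 2 0 - 2 * √3 * W 2 3 + √3 * W 3 2 + 2 * √3 * W 4 1,
       -√3 * W 0 4 + 3 * W 1 2 - 2 * W 2 1 - 3 * W 3 4 + 2 * √3 * W 4 0,
       W 0 0 + √3 * W 0 3 + 3 * W 1 1 + 4 * W 2 2 + √3 * W 3 0 + 3 * W 3 3 + 3 * W 4 4,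
       √3 * W 0 2 + 3 * W 1 4 - 2 * √3 * W 2 0 - 2 * W 2 3 + 3 * W 3 2,
       -√3 * W 0 1 - √3 * W 1 0 + 3 * W 1 3 - 2 * W 2 4 - 3 * W 3 1 + 3 * W 4 2;
       4 * W 0 3 + √3 * W 2 2 - 4 * W 3 0 - √3 * W 4 4,
       -3 * W 2 4 + 4 * W 3 1 + 3 * W 4 2,
       -2 * √3 * W 0 2 + √3 * W 2 0 + 3 * W 2 3 - 2 * W 3 2 + 3 * W 4 1,
       4 * W 0 0 + 3 * W 2 2 + 4 * W 3 3 + 3 * W 4 4,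
       2 * √3 * W 0 4 - 3 * W 2 1 - 2 * W 3 4 - √3 * W 4 0 + 3 * W 4 3;
       W 0 4 - √3 * W 1 2 + 2 * √3 * W 2 1 - √3 * W 3 4 + 2 * W 4 0 + 2 * √3 * W 4 3,
       -√3 * W 0 2 + 3 * W 1 4 + 2 * √3 * W 2 0 + 3 * W 3 2 - 2 * W 4 1,
       -√3 * W 0 1 - √3 * W 1 0 - 3 * W 1 3 + 3 * W 2 4 + 3 * W 3 1 - 2 * W 4 2,
       -√3 * W 0 4 - 3 * W 1 2 + 3 * W 3 4 + 2 * √3 * W 4 0 - 2 * W 4 3,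
       W 0 0 - √3 * W 0 3 + 3 * W 1 1 + 3 * W 2 2 - √3 * W 3 0 + 3 * W 3 3 + 4 * W 4 4] := by
  have h2 : √3 * √3 = 3 := Real.mul_self_sqrt (by norm_num)
  have u0 : upsilonEnd (Pi.single 0 1) =
      !![-1, 0, 0, 0, 0; 0, 1, 0, 0, 0; 0, 0, -1 / 2, 0, 0; 0, 0, 0, 1, 0; 0, 0, 0, 0, -1 / 2] := by
    rw [upsilonEnd_eq]; simp
  have u1 : upsilonEnd (Pi.single 1 1) =
      !![0, 1, 0, 0, 0; 1, 0, 0, 0, 0; 0, 0, 0, 0, √3 / 2; 0, 0, 0, 0, 0; 0, 0, √3 / 2, 0, 0] := by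
    rw [upsilonEnd_eq]; simp
  have u2 : upsilonEnd (Pi.single 2 1) =
      !![0, 0, -1 / 2, 0, 0; 0, 0, 0, 0, √3 / 2; -1 / 2, 0, 0, -√3 / 2, 0; 0, 0, -√3 / 2, 0, 0;
         0, √3 / 2, 0, 0, 0] := by
    rw [upsilonEnd_eq]; simp
  have u3 : upsilonEnd (Pi.single 3 1) =
      !![0, 0, 0, 1, 0; 0, 0, 0, 0, 0; 0, 0, -(√3 / 2), 0, 0; 1, 0, 0, 0, 0; 0, 0, 0, 0, √3 / 2] := by
    rw [upsilonEnd_eq]; simp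
  have u4 : upsilonEnd (Pi.single 4 1) =
      !![0, 0, 0, 0, -1 / 2; 0, 0, √3 / 2, 0, 0; 0, √3 / 2, 0, 0, 0; 0, 0, 0, 0, √3 / 2;
         -1 / 2, 0, 0, √3 / 2, 0] := by
    rw [upsilonEnd_eq]; simp
  simp only [upsilonHat, Fin.sum_univ_five, u0, u1, u2, u3, u4]
  simp only [upsilonEnd_eq]
  ext i j
  simp only [Matrix.smul_apply, Matrix.add_apply, Matrix.mul_apply, Fin.sum_univ_five, smul_eq_mul]
  generalize √3 = r at h2
  fin_cases i <;> fin_cases j <;>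
    simp only [Fin.zero_eta, Fin.mk_one, Fin.reduceFinMk, Matrix.of_apply, Matrix.cons_val] <;>
    grind

/-- The elements of the span of `κ₁, κ₂, κ₃`, written out. -/
lemma sum_kappa (y : Fin 3 → ℝ) : ∑ i, y i • kappa i =
    !![0, 0, -(√3 * y 1), 0, -(√3 * y 0);
       0, 0, -y 0, -(2 * y 2), -y 1;
       √3 * y 1, y 0, 0, -y 1, -y 2;
       0, 2 * y 2, y 1, 0, -y 0;
       √3 * y 0, y 1, y 2, y 0, 0] := by
  ext i j
  rw [Fin.sum_univ_three]
  fin_cases i <;> fin_cases j <;> simp [kappa, bivec] <;> ring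

set_option maxHeartbeats 4000000 in
/-- `Λ²₃` is spanned by `κ₁, κ₂, κ₃`. -/
lemma mem_Lambda23_iff (F : Matrix (Fin 5) (Fin 5) ℝ) :
    F ∈ Lambda23 ↔ ∃ y : Fin 3 → ℝ, F = ∑ i, y i • kappa i := by
  have h2 : √3 * √3 = 3 := Real.mul_self_sqrt (by norm_num)
  constructor
  · intro hF
    have h0 : upsilonHat F = (7 : ℝ) • F := hF
    have h : ∀ i j, upsilonHat F i j = 7 * F i j := fun i j => by rw [h0]; rfl
    rw [upsilonHat_eq] at h
    simp [Fin.forall_fin_succ] at h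
    obtain ⟨⟨e00, e01, e02, e03, e04⟩, ⟨e10, e11, e12, e13, e14⟩, ⟨e20, e21, e22, e23, e24⟩, ⟨e30, e31, e32, e33, e34⟩, ⟨e40, e41, e42, e43, e44⟩⟩ := h
    have f00 : F 0 0 = 0 := by
      linear_combination -6/35 * e00 + 1/35 * e11 + 9/70 * e22 + 1/35 * e33 + 9/70 * e44
    have f01 : F 0 1 = 0 := by
      linear_combination -2/15 * e01 + -1/15 * e10 + 1/15 * √3 * e13 + 1/15 * √3 * e24 + -1/15 * √3 * e31 + ((1/15) * F 0 1 + (1/15) * F 1 0) * h2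
    have f02 : F 0 2 = (-1) * √3 * F 4 1 := by
      linear_combination -11/15 * e02 + -4/15 * √3 * e14 + 1/3 * e20 + -1/5 * √3 * e23 + 2/15 * √3 * e32 + ((1) * F 0 2 + (-4/5) * F 2 0) * h2
    have f03 : F 0 3 = 0 := by
      linear_combination -2/15 * e03 + -1/30 * √3 * e22 + -1/15 * e30 + 1/30 * √3 * e44 + ((1/15) * F 0 3 + (1/15) * F 3 0) * h2
    have f04 : F 0 4 = (-1) * √3 * F 2 1 := by
      linear_combination -2/15 * e04 + -1/15 * √3 * e12 + -1/5 * √3 * e21 + 1/15 * √3 * e34 + -4/15 * e40 + ((-1/5) * F 0 4 + (2/5) * F 4 0) * h2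
    have f10 : F 1 0 = 0 := by
      linear_combination -1/15 * e01 + -2/15 * e10 + 1/15 * √3 * e13 + 1/15 * √3 * e24 + -1/15 * √3 * e31 + ((1/15) * F 0 1 + (1/15) * F 1 0) * h2
    have f11 : F 1 1 = 0 := by
      linear_combination 1/35 * e00 + -6/35 * e11 + 13/210 * e22 + 17/105 * e33 + 13/210 * e44
    have f12 : F 1 2 = (-1) * F 2 1 := by
      linear_combination 1/15 * √3 * e04 + -2/15 * e12 + -1/3 * e21 + 1/5 * e34 + -2/15 * √3 * e40 + ((-4/15) * F 1 2 + (1/3) * F 2 1 + (-4/15) * F 3 4 + (1/3) * F 4 3) * h2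
    have f13 : F 1 3 = (-2) * F 4 2 := by
      linear_combination 1/15 * √3 * e01 + 1/15 * √3 * e10 + -4/5 * e13 + -7/15 * e24 + 7/15 * e31 + ((2/15) * F 2 4 + (2/15) * F 4 2) * h2
    have f14 : F 1 4 = (-1) * F 4 1 := by
      linear_combination -4/15 * √3 * e02 + -7/15 * e14 + 1/5 * √3 * e20 + -1/3 * e23 + 2/15 * e32 + ((11/15) * F 1 4 + (2/3) * F 2 3 + (-11/15) * F 3 2 + (-2/3) * F 4 1) * h2
    have f20 : F 2 0 = (1) * √3 * F 4 1 := by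
      linear_combination 1/3 * e02 + 1/5 * √3 * e14 + -8/15 * e20 + 1/5 * √3 * e23 + -1/15 * √3 * e32 + ((-11/15) * F 0 2 + (2/3) * F 2 0) * h2
    have f22 : F 2 2 = 0 := by
      linear_combination 9/70 * e00 + -1/30 * √3 * e03 + 13/210 * e11 + -6/35 * e22 + -1/30 * √3 * e30 + 13/210 * e33 + 13/210 * e44 + ((1/15) * F 2 2 + (-1/15) * F 4 4) * h2
    have f23 : F 2 3 = (-1) * F 4 1 := by
      linear_combination -1/5 * √3 * e02 + -1/3 * e14 + 1/5 * √3 * e20 + -2/5 * e23 + 1/15 * e32 + ((3/5) * F 1 4 + (3/5) * F 2 3 + (-3/5) * F 3 2 + (-3/5) * F 4 1) * h2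
    have f24 : F 2 4 = (-1) * F 4 2 := by
      linear_combination 1/15 * √3 * e01 + 1/15 * √3 * e10 + -7/15 * e13 + -7/15 * e24 + 7/15 * e31 + ((2/15) * F 2 4 + (2/15) * F 4 2) * h2
    have f30 : F 3 0 = 0 := by
      linear_combination -1/15 * e03 + -1/30 * √3 * e22 + -2/15 * e30 + 1/30 * √3 * e44 + ((1/15) * F 0 3 + (1/15) * F 3 0) * h2
    have f31 : F 3 1 = (2) * F 4 2 := by
      linear_combination -1/15 * √3 * e01 + -1/15 * √3 * e10 + 7/15 * e13 + 7/15 * e24 + -4/5 * e31 + ((-2/15) * F 2 4 + (-2/15) * F 4 2) * h2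
    have f32 : F 3 2 = (1) * F 4 1 := by
      linear_combination 2/15 * √3 * e02 + 2/15 * e14 + -1/15 * √3 * e20 + 1/15 * e23 + -1/5 * e32 + ((-1/3) * F 1 4 + (-4/15) * F 2 3 + (1/3) * F 3 2 + (4/15) * F 4 1) * h2
    have f33 : F 3 3 = 0 := by
      linear_combination 1/35 * e00 + 17/105 * e11 + 13/210 * e22 + -6/35 * e33 + 13/210 * e44
    have f34 : F 3 4 = (-1) * F 2 1 := by
      linear_combination -1/15 * √3 * e04 + -1/15 * e12 + -1/15 * e21 + -2/15 * e34 + ((2/15) * F 1 2 + (-1/15) * F 2 1 + (2/15) * F 3 4 + (-1/15) * F 4 3) * h2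
    have f40 : F 4 0 = (1) * √3 * F 2 1 := by
      linear_combination -4/15 * e04 + 1/5 * √3 * e21 + -2/15 * √3 * e34 + 1/15 * e40 + ((7/15) * F 0 4 + (-8/15) * F 4 0) * h2
    have f43 : F 4 3 = (1) * F 2 1 := by
      linear_combination -1/5 * √3 * e04 + -1/15 * e12 + 2/5 * e21 + -1/3 * e34 + 1/5 * √3 * e40 + ((3/5) * F 1 2 + (-3/5) * F 2 1 + (3/5) * F 3 4 + (-3/5) * F 4 3) * h2
    have f44 : F 4 4 = 0 := by
      linear_combination 9/70 * e00 + 1/30 * √3 * e03 + 13/210 * e11 + 13/210 * e22 + 1/30 * √3 * e30 + 13/210 * e33 + -6/35 * e44 + ((-1/15) * F 2 2 + (1/15) * F 4 4) * h2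
    refine ⟨![F 2 1, F 4 1, F 4 2], ?_⟩
    ext i j
    rw [sum_kappa]
    fin_cases i <;> fin_cases j <;>
      simp only [Fin.zero_eta, Fin.mk_one, Fin.reduceFinMk, Matrix.of_apply, Matrix.cons_val] <;>
      linarith
  · rintro ⟨y, rfl⟩
    show _ = _
    rw [upsilonHat_eq, sum_kappa]
    ext i j
    simp only [Matrix.smul_apply, smul_eq_mul]
    generalize √3 = r at h2
    fin_cases i <;> fin_cases j <;>
      simp only [Fin.zero_eta, Fin.mk_one, Fin.reduceFinMk, Matrix.of_apply, Matrix.cons_val] <;>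
      grind


lemma iota_mul_transpose {h : Matrix (Fin 3) (Fin 3) ℝ}
    (hh : h ∈ Matrix.specialOrthogonalGroup (Fin 3) ℝ) :
    iota h * (iota h)ᵀ = 1 :=
  mul_eq_one_comm.1 (iota_transpose_mul hh)

lemma upsilonEnd_conj {h : Matrix (Fin 3) (Fin 3) ℝ}
    (hh : h ∈ Matrix.specialOrthogonalGroup (Fin 3) ℝ) (v : Fin 5 → ℝ) :
    (iota h)ᵀ * upsilonEnd (iota h *ᵥ v) * iota h = upsilonEnd v := by
  refine Matrix.ext_of_mulVec_single fun i => ?_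
  generalize (Pi.single i 1 : Fin 5 → ℝ) = x
  refine dotProduct_eq _ _ fun y => ?_
  rw [dotProduct_comm, dotProduct_comm _ y, upsilonEnd_dot, Matrix.mul_assoc,
    ← Matrix.mulVec_mulVec, Matrix.dotProduct_mulVec, Matrix.vecMul_transpose,
    ← Matrix.mulVec_mulVec, upsilonEnd_dot, iota_mulVec, iota_mulVec, iota_mulVec, upsilon_rho hh]

lemma upsilonHat_conj {h : Matrix (Fin 3) (Fin 3) ℝ}
    (hh : h ∈ Matrix.specialOrthogonalGroup (Fin 3) ℝ) (F : Matrix (Fin 5) (Fin 5) ℝ) :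
    upsilonHat ((iota h)ᵀ * F * iota h) = (iota h)ᵀ * upsilonHat F * iota h := by
  have hR := iota_mul_transpose hh
  have key : ∀ v w, upsilonEnd ((iota h)ᵀ *ᵥ v) * upsilonEnd w =
      (iota h)ᵀ * (upsilonEnd v * upsilonEnd (iota h *ᵥ w)) * iota h := by
    intro v w
    rw [← upsilonEnd_conj hh w, ← upsilonEnd_conj hh ((iota h)ᵀ *ᵥ v), Matrix.mulVec_mulVec, hR,
      Matrix.one_mulVec]
    simp only [Matrix.mul_assoc]
    rw [← Matrix.mul_assoc (iota h) (iota h)ᵀ, hR, one_mul]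
  have hcol : ∀ j, (fun i => ((iota h)ᵀ * F * iota h) i j) =
      (iota h)ᵀ *ᵥ (F *ᵥ (iota h *ᵥ Pi.single j 1)) := by
    intro j
    rw [Matrix.mulVec_mulVec, Matrix.mulVec_mulVec, Matrix.mul_assoc]
    ext i; simp
  have hF : ∀ j, (fun i => F i j) = F *ᵥ Pi.single j 1 := by intro j; ext i; simp
  have hcomb : ∀ j, iota h *ᵥ Pi.single j 1 = ∑ k, iota h k j • (Pi.single k 1 : Fin 5 → ℝ) := by
    intro j
    ext i
    simp [Finset.sum_apply, Pi.single_apply]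
  have hU : ∀ v, upsilonEnd v = upsilonLin v := fun _ => rfl
  unfold upsilonHat
  simp only [hcol, hF, key, Matrix.mul_smul, Matrix.smul_mul, ← Finset.mul_sum, ← Finset.sum_mul]
  congr 3
  simp only [hcomb, Matrix.mulVec_sum, Matrix.mulVec_smul, hU, map_sum, map_smul, Finset.sum_mul,
    Finset.mul_sum, Matrix.smul_mul, Matrix.mul_smul, smul_smul]
  rw [Finset.sum_comm]
  have hd : ∀ k l, ∑ j, iota h k j * iota h l j = if k = l then 1 else 0 := by
    intro k l
    have := congrFun (congrFun hR k) l
    simpa [Matrix.mul_apply, Matrix.one_apply] using this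
  calc _ = ∑ k, ∑ l, (∑ j, iota h k j * iota h l j) •
        (upsilonLin (F *ᵥ Pi.single l 1) * upsilonLin (Pi.single k 1)) := by
        simp only [Finset.sum_smul]
        refine Finset.sum_congr rfl fun k _ => ?_
        rw [Finset.sum_comm]
    _ = _ := by simp [hd]

lemma Lambda23_conj {h : Matrix (Fin 3) (Fin 3) ℝ}
    (hh : h ∈ Matrix.specialOrthogonalGroup (Fin 3) ℝ) {F : Matrix (Fin 5) (Fin 5) ℝ} (hF : F ∈ Lambda23) :
    (iota h)ᵀ * F * iota h ∈ Lambda23 := by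
  change _ = _
  rw [upsilonHat_conj hh, show upsilonHat F = (7 : ℝ) • F from hF]
  simp

lemma bivInner_eq_trace (F G : Matrix (Fin 5) (Fin 5) ℝ) :
    bivInner F G = 1 / 2 * (F * Gᵀ).trace := by
  simp [bivInner, Matrix.trace, Matrix.mul_apply]

lemma bivInner_conj {h : Matrix (Fin 3) (Fin 3) ℝ}
    (hh : h ∈ Matrix.specialOrthogonalGroup (Fin 3) ℝ) (F G : Matrix (Fin 5) (Fin 5) ℝ) :
    bivInner ((iota h)ᵀ * F * iota h) ((iota h)ᵀ * G * iota h) = bivInner F G := by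
  simp only [bivInner_eq_trace, Matrix.transpose_mul, Matrix.transpose_transpose]
  congr 1
  calc _ = ((iota h)ᵀ * (F * (iota h * (iota h)ᵀ) * Gᵀ * iota h)).trace := by
        simp only [Matrix.mul_assoc]
    _ = _ := by
      rw [iota_mul_transpose hh, mul_one, Matrix.trace_mul_comm, Matrix.mul_assoc,
        iota_mul_transpose hh, mul_one]

/-- The coordinates `yᵢ(F) = g(F, κᵢ) / 5` on `Λ²₃`. -/
def kappaCoord (F : Matrix (Fin 5) (Fin 5) ℝ) (i : Fin 3) : ℝ := 1 / 5 * bivInner F (kappa i)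

lemma kappaCoord_sum (y : Fin 3 → ℝ) : kappaCoord (∑ i, y i • kappa i) = y := by
  have h2 : √3 * √3 = 3 := Real.mul_self_sqrt (by norm_num)
  ext i
  rw [sum_kappa]
  fin_cases i <;>
    simp [kappaCoord, bivInner, Fin.sum_univ_five, kappa, bivec] <;> ring_nf <;>
    simp [pow_two, h2] <;> ring

lemma bivInner_sum_kappa (y : Fin 3 → ℝ) :
    bivInner (∑ i, y i • kappa i) (∑ i, y i • kappa i) = 5 * ∑ i, y i ^ 2 := by
  rw [sum_kappa]
  simp [bivInner, Fin.sum_univ_five, Fin.sum_univ_three]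
  ring_nf
  simp
  ring

lemma sum_kappa_mem (y : Fin 3 → ℝ) : ∑ i, y i • kappa i ∈ Lambda23 :=
  (mem_Lambda23_iff _).2 ⟨y, rfl⟩

lemma sum_kappaCoord {F : Matrix (Fin 5) (Fin 5) ℝ} (hF : F ∈ Lambda23) :
    ∑ i, kappaCoord F i • kappa i = F := by
  obtain ⟨y, rfl⟩ := (mem_Lambda23_iff F).1 hF
  rw [kappaCoord_sum]

end IrrSO3


/-- An irreducible `SO(3)`-structure on a `5`-manifold `M`: a reduction of the bundle of tangent
frames to the group `ι(SO(3))`, given by the set of its frames, the adapted frames. -/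
structure IrrSO3Structure (M : Type*) [TopologicalSpace M]
    [ChartedSpace (EuclideanSpace ℝ (Fin 5)) M] [IsManifold (𝓡 5) ∞ M] where
  /-- the adapted frames at a point -/
  adapted (p : M) : Set (Fin 5 → TangentSpace (𝓡 5) p)
  linearIndependent : ∀ p, ∀ a ∈ adapted p, LinearIndependent ℝ a
  /-- `ι(SO(3))` acts simply transitively on the adapted frames at a point -/
  mem_iff : ∀ p, ∀ a ∈ adapted p, ∀ b, b ∈ adapted p ↔
    ∃ h ∈ Matrix.specialOrthogonalGroup (Fin 3) ℝ, b = fun j => ∑ i, IrrSO3.iota h i j • a i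
  /-- there are smooth local sections -/
  exists_local : ∀ p, ∃ U : Set M, IsOpen U ∧ p ∈ U ∧
    ∃ E : Fin 5 → ∀ x : M, TangentSpace (𝓡 5) x,
      (∀ i, ContMDiffOn (𝓡 5) ((𝓡 5).prod 𝓘(ℝ, EuclideanSpace ℝ (Fin 5))) ∞
        (fun x => (⟨x, E i x⟩ : TangentBundle (𝓡 5) M)) U) ∧
      ∀ x ∈ U, (fun i => E i x) ∈ adapted x

namespace IrrSO3Structure

open IrrSO3

variable {M : Type*} [TopologicalSpace M] [ChartedSpace (EuclideanSpace ℝ (Fin 5)) M]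
  [IsManifold (𝓡 5) ∞ M] (S : IrrSO3Structure M)

/-- A smooth adapted frame on an open set. -/
structure LocalFrame where
  U : Set M
  isOpen : IsOpen U
  E : Fin 5 → ∀ x : M, TangentSpace (𝓡 5) x
  smooth : ∀ i, ContMDiffOn (𝓡 5) ((𝓡 5).prod 𝓘(ℝ, EuclideanSpace ℝ (Fin 5))) ∞
    (fun x => (⟨x, E i x⟩ : TangentBundle (𝓡 5) M)) U
  adapted : ∀ x ∈ U, (fun i => E i x) ∈ S.adapted x

lemma exists_localFrame (p : M) : ∃ L : S.LocalFrame, p ∈ L.U := by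
  obtain ⟨U, hU, hp, E, hE, ha⟩ := S.exists_local p
  exact ⟨⟨U, hU, E, hE, ha⟩, hp⟩

/-- A chosen smooth adapted frame near `p`. -/
def frameNear (p : M) : S.LocalFrame := (S.exists_localFrame p).choose

lemma mem_frameNear (p : M) : p ∈ (S.frameNear p).U := (S.exists_localFrame p).choose_spec

/-- A chosen adapted frame at `p`. The notions defined below by means of it do not depend on the
choice, since they are invariant under `ι(SO(3))`. -/
def frame (p : M) : Fin 5 → TangentSpace (𝓡 5) p := fun i => (S.frameNear p).E i p

lemma frame_mem (p : M) : S.frame p ∈ S.adapted p :=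
  (S.frameNear p).adapted p (S.mem_frameNear p)

/-- The basis of a tangent space given by an adapted frame. -/
def basis (p : M) : Module.Basis (Fin 5) ℝ (TangentSpace (𝓡 5) p) :=
  haveI : FiniteDimensional ℝ (TangentSpace (𝓡 5) p) :=
    inferInstanceAs (FiniteDimensional ℝ (EuclideanSpace ℝ (Fin 5)))
  basisOfLinearIndependentOfCardEqFinrank (S.linearIndependent p _ (S.frame_mem p))
    (finrank_euclideanSpace_fin (𝕜 := ℝ) (n := 5)).symm

lemma basis_apply (p : M) (i : Fin 5) : S.basis p i = S.frame p i := by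
  have : FiniteDimensional ℝ (TangentSpace (𝓡 5) p) :=
    inferInstanceAs (FiniteDimensional ℝ (EuclideanSpace ℝ (Fin 5)))
  exact congrFun (coe_basisOfLinearIndependentOfCardEqFinrank _ _) i

/-- The Riemannian metric of the structure: adapted frames are orthonormal. -/
def g (p : M) : TangentSpace (𝓡 5) p →ₗ[ℝ] TangentSpace (𝓡 5) p →ₗ[ℝ] ℝ :=
  ∑ i, (LinearMap.mul ℝ ℝ).compl₁₂ ((S.basis p).coord i) ((S.basis p).coord i)

/-- The matrix, in the frame `a`, of an endomorphism of a tangent space. -/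
def toMat {p : M} (a : Fin 5 → TangentSpace (𝓡 5) p)
    (F : Module.End ℝ (TangentSpace (𝓡 5) p)) : Matrix (Fin 5) (Fin 5) ℝ :=
  Matrix.of fun k j => S.g p (a k) (F (a j))

/-- The endomorphism of a tangent space with a given matrix in the frame `a`. -/
def ofMat {p : M} (a : Fin 5 → TangentSpace (𝓡 5) p) (A : Matrix (Fin 5) (Fin 5) ℝ) :
    Module.End ℝ (TangentSpace (𝓡 5) p) :=
  ∑ k, ∑ j, A k j • (S.g p (a j)).smulRight (a k)

lemma g_frame (p : M) (i j : Fin 5) :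
    S.g p (S.frame p i) (S.frame p j) = if i = j then 1 else 0 := by
  simp [g, ← basis_apply, Finsupp.single_apply]

lemma g_adapted {p : M} {a : Fin 5 → TangentSpace (𝓡 5) p} (ha : a ∈ S.adapted p) (i j : Fin 5) :
    S.g p (a i) (a j) = if i = j then 1 else 0 := by
  obtain ⟨h, hh, rfl⟩ := (S.mem_iff p _ (S.frame_mem p) a).1 ha
  have := congrFun (congrFun (iota_transpose_mul hh) i) j
  simp only [Matrix.mul_apply, Matrix.transpose_apply, Matrix.one_apply] at this
  simp only [map_sum, map_smul, LinearMap.sum_apply, LinearMap.smul_apply, g_frame]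
  simpa [mul_comm] using this

lemma sum_g_frame {p : M} (X : TangentSpace (𝓡 5) p) :
    ∑ i, S.g p (S.frame p i) X • S.frame p i = X := by
  conv_rhs => rw [← (S.basis p).sum_repr X]
  refine Finset.sum_congr rfl fun i _ => ?_
  rw [← basis_apply]
  congr 1
  simp [g, Finsupp.single_apply]

lemma sum_g_adapted {p : M} {a : Fin 5 → TangentSpace (𝓡 5) p} (ha : a ∈ S.adapted p)
    (X : TangentSpace (𝓡 5) p) : ∑ i, S.g p (a i) X • a i = X := by
  obtain ⟨h, hh, rfl⟩ := (S.mem_iff p _ (S.frame_mem p) a).1 ha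
  have hR : ∀ k l, ∑ j, iota h k j * iota h l j = if k = l then 1 else 0 := by
    intro k l
    have := congrFun (congrFun (iota_mul_transpose hh) k) l
    simpa [Matrix.mul_apply, Matrix.one_apply] using this
  conv_rhs => rw [← S.sum_g_frame X]
  simp only [map_sum, map_smul, LinearMap.sum_apply, LinearMap.smul_apply, smul_eq_mul,
    Finset.smul_sum, smul_smul]
  rw [Finset.sum_comm]
  refine Finset.sum_congr rfl fun k _ => ?_
  rw [← Finset.sum_smul]
  congr 1
  simp only [Finset.sum_mul]
  rw [Finset.sum_comm]
  have h1 : ∀ l j, iota h l j * S.g p (S.frame p l) X * iota h k j =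
      iota h k j * iota h l j * S.g p (S.frame p l) X := fun l j => by ring
  simp only [h1, ← Finset.sum_mul, hR]
  simp

lemma toMat_ofMat {p : M} {a : Fin 5 → TangentSpace (𝓡 5) p} (ha : a ∈ S.adapted p)
    (A : Matrix (Fin 5) (Fin 5) ℝ) : S.toMat a (S.ofMat a A) = A := by
  ext k j
  simp [toMat, ofMat, S.g_adapted ha, LinearMap.sum_apply]

lemma ofMat_toMat {p : M} {a : Fin 5 → TangentSpace (𝓡 5) p} (ha : a ∈ S.adapted p)
    (F : Module.End ℝ (TangentSpace (𝓡 5) p)) : S.ofMat a (S.toMat a F) = F := by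
  ext X
  conv_rhs => rw [← S.sum_g_adapted ha X, map_sum]
  simp only [ofMat, toMat, LinearMap.sum_apply, LinearMap.smul_apply, LinearMap.smulRight_apply,
    Matrix.of_apply, map_smul]
  rw [Finset.sum_comm]
  refine Finset.sum_congr rfl fun j _ => ?_
  conv_rhs => rw [← S.sum_g_adapted ha (F (a j)), Finset.smul_sum]
  refine Finset.sum_congr rfl fun k _ => ?_
  rw [smul_smul, smul_smul, mul_comm]

/-- The change of the matrix of an endomorphism under a change of frame. -/
lemma toMat_change {p : M} (a : Fin 5 → TangentSpace (𝓡 5) p) (R : Matrix (Fin 5) (Fin 5) ℝ)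
    (F : Module.End ℝ (TangentSpace (𝓡 5) p)) :
    S.toMat (fun j => ∑ i, R i j • a i) F = Rᵀ * S.toMat a F * R := by
  ext k j
  simp only [toMat, Matrix.of_apply, map_sum, map_smul, LinearMap.sum_apply, LinearMap.smul_apply,
    Matrix.mul_apply, Matrix.transpose_apply, smul_eq_mul, Finset.mul_sum, Finset.sum_mul]
  refine Finset.sum_congr rfl fun i _ => Finset.sum_congr rfl fun l _ => ?_
  ring

/-- The fibre at `p` of the bundle `Λ²₃TM`, as a set of endomorphisms of the tangent space; a
bivector `σ` is viewed as the endomorphism with `g(σ X, Y) = g(σ, X ∧ Y)`. -/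
def Lambda23At (p : M) : Set (Module.End ℝ (TangentSpace (𝓡 5) p)) :=
  {F | S.toMat (S.frame p) F ∈ Lambda23}

/-- The metric on bivectors at `p`, `g(x ∧ y, u ∧ v) = g(x, u) g(y, v) - g(x, v) g(y, u)`. -/
def bivInnerAt (p : M) (F G : Module.End ℝ (TangentSpace (𝓡 5) p)) : ℝ :=
  bivInner (S.toMat (S.frame p) F) (S.toMat (S.frame p) G)

lemma toMat_mem {p : M} {a : Fin 5 → TangentSpace (𝓡 5) p} (ha : a ∈ S.adapted p)
    {b : Fin 5 → TangentSpace (𝓡 5) p} (hb : b ∈ S.adapted p)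
    {F : Module.End ℝ (TangentSpace (𝓡 5) p)} (hF : S.toMat a F ∈ Lambda23) :
    S.toMat b F ∈ Lambda23 := by
  obtain ⟨h, hh, rfl⟩ := (S.mem_iff p _ ha b).1 hb
  rw [toMat_change]
  exact Lambda23_conj hh hF

lemma bivInner_toMat {p : M} {a : Fin 5 → TangentSpace (𝓡 5) p} (ha : a ∈ S.adapted p)
    {b : Fin 5 → TangentSpace (𝓡 5) p} (hb : b ∈ S.adapted p)
    (F G : Module.End ℝ (TangentSpace (𝓡 5) p)) :
    bivInner (S.toMat b F) (S.toMat b G) = bivInner (S.toMat a F) (S.toMat a G) := by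
  obtain ⟨h, hh, rfl⟩ := (S.mem_iff p _ ha b).1 hb
  rw [toMat_change, toMat_change, bivInner_conj hh]

/-- The unit sphere in `ℝ³`. -/
abbrev S2 : Type := Metric.sphere (0 : EuclideanSpace ℝ (Fin 3)) 1

/-- The fibre at `p` of the twistor space: the sphere `|σ|² = 5` in `Λ²₃T_pM`. -/
def TwistorFibre (p : M) : Type _ :=
  {F : Module.End ℝ (TangentSpace (𝓡 5) p) // F ∈ S.Lambda23At p ∧ S.bivInnerAt p F F = 5}

lemma mem_S2_iff (y : EuclideanSpace ℝ (Fin 3)) :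
    y ∈ Metric.sphere (0 : EuclideanSpace ℝ (Fin 3)) 1 ↔ ∑ i, y i ^ 2 = 1 := by
  rw [mem_sphere_zero_iff_norm, ← sq_eq_sq₀ (norm_nonneg _) zero_le_one, EuclideanSpace.norm_sq_eq]
  simp

/-- An adapted frame `a` at `p` identifies the twistor fibre with the unit sphere, `y ∈ S²`
corresponding to `∑ yᵢ κᵢ(a)`. -/
def sphereEquiv {p : M} {a : Fin 5 → TangentSpace (𝓡 5) p} (ha : a ∈ S.adapted p) :
    S.TwistorFibre p ≃ S2 where
  toFun σ := ⟨WithLp.toLp 2 (kappaCoord (S.toMat a σ.1)), by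
    rw [mem_S2_iff]
    have h1 := sum_kappaCoord (S.toMat_mem (S.frame_mem p) ha σ.2.1)
    have h2 := bivInner_sum_kappa (kappaCoord (S.toMat a σ.1))
    rw [h1, S.bivInner_toMat (S.frame_mem p) ha] at h2
    have h3 : bivInner _ _ = 5 := σ.2.2
    dsimp only
    linarith⟩
  invFun y := ⟨S.ofMat a (∑ i, y.1 i • kappa i), by
    constructor
    · refine S.toMat_mem ha (S.frame_mem p) ?_
      rw [S.toMat_ofMat ha]
      exact sum_kappa_mem _
    · unfold bivInnerAt
      rw [S.bivInner_toMat ha (S.frame_mem p), S.toMat_ofMat ha, bivInner_sum_kappa,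
        (mem_S2_iff _).1 y.2, mul_one]⟩
  left_inv σ := by
    apply Subtype.ext
    have h1 := sum_kappaCoord (S.toMat_mem (S.frame_mem p) ha σ.2.1)
    simp only [h1, S.ofMat_toMat ha]
  right_inv y := by
    apply Subtype.ext
    ext i
    simp [S.toMat_ofMat ha, kappaCoord_sum]

/-- The topology of the twistor fibre, as a set of endomorphisms of a finite-dimensional space. -/
instance (p : M) : TopologicalSpace (S.TwistorFibre p) :=
  TopologicalSpace.induced (fun σ => S.toMat (S.frame p) σ.1) inferInstance

end IrrSO3Structure


namespace IrrSO3Structure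

open IrrSO3

variable {M : Type*} [TopologicalSpace M] [ChartedSpace (EuclideanSpace ℝ (Fin 5)) M]
  [IsManifold (𝓡 5) ∞ M] (S : IrrSO3Structure M)

/-- The transition matrix between two smooth adapted frames is smooth. -/
lemma contMDiffAt_transition (L L' : S.LocalFrame) {x₀ : M} (h : x₀ ∈ L.U) (h' : x₀ ∈ L'.U)
    (i j : Fin 5) :
    ContMDiffAt (𝓡 5) 𝓘(ℝ, ℝ) ∞ (fun x => S.g x (L.E i x) (L'.E j x)) x₀ := by
  classical
  let e := trivializationAt (EuclideanSpace ℝ (Fin 5)) (TangentSpace (𝓡 5)) x₀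
  let A (L : S.LocalFrame) (x : M) : Matrix (Fin 5) (Fin 5) ℝ :=
    Matrix.of fun k i => (e ⟨x, L.E i x⟩).2 k
  have hA : ∀ L : S.LocalFrame, x₀ ∈ L.U → ∀ k i,
      ContMDiffAt (𝓡 5) 𝓘(ℝ, ℝ) ∞ (fun x => A L x k i) x₀ := by
    intro L hL k i
    have h1 := (contMDiffAt_section x₀).1 ((L.smooth i).contMDiffAt (L.isOpen.mem_nhds hL))
    exact (EuclideanSpace.proj (𝕜 := ℝ) k).contDiff.contMDiff.contMDiffAt.comp x₀ h1
  have hdet : ∀ B : M → Matrix (Fin 5) (Fin 5) ℝ,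
      (∀ k i, ContMDiffAt (𝓡 5) 𝓘(ℝ, ℝ) ∞ (fun x => B x k i) x₀) →
      ContMDiffAt (𝓡 5) 𝓘(ℝ, ℝ) ∞ (fun x => (B x).det) x₀ := by
    intro B hB
    simp only [Matrix.det_apply']
    refine contMDiffAt_finsetSum fun σ _ => ?_
    exact contMDiffAt_const.mul (contMDiffAt_finsetProd fun k _ => hB _ _)
  have hne : ∀ x ∈ L.U ∩ e.baseSet, (A L x).det ≠ 0 := by
    rintro x ⟨hx, hxe⟩
    rw [← isUnit_iff_ne_zero, ← Matrix.isUnit_iff_isUnit_det,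
      ← Matrix.linearIndependent_cols_iff_isUnit]
    have h1 := S.linearIndependent x _ (L.adapted x hx)
    have h2 := h1.map' ((e.linearEquivAt ℝ x hxe).trans
      (WithLp.linearEquiv 2 ℝ (Fin 5 → ℝ))).toLinearMap (LinearEquiv.ker _)
    exact h2
  have hmul : ∀ x ∈ (L.U ∩ e.baseSet) ∩ L'.U,
      S.g x (L.E i x) (L'.E j x) = (A L x).det⁻¹ *
        ((A L x).updateCol i fun k => A L' x k j).det := by
    rintro x ⟨hx, hx'⟩
    have h1 : (fun k => A L' x k j) = A L x *ᵥ fun i => S.g x (L.E i x) (L'.E j x) := by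
      have h2 := S.sum_g_adapted (L.adapted x hx.1) (L'.E j x)
      have h3 := congrArg (e.linearEquivAt ℝ x hx.2) h2
      rw [map_sum] at h3
      simp only [map_smul] at h3
      ext k
      have h4 := congrArg (fun v => v k) h3
      simp only [WithLp.ofLp_sum, Finset.sum_apply, WithLp.ofLp_smul, Pi.smul_apply] at h4
      change (e ⟨x, L'.E j x⟩).2 k = _
      refine h4.symm.trans ?_
      simp only [Matrix.mulVec, dotProduct]
      refine Finset.sum_congr rfl fun l _ => ?_
      rw [smul_eq_mul, mul_comm]
      rfl
    rw [← Matrix.cramer_apply, h1, Matrix.cramer_eq_adjugate_mulVec, Matrix.mulVec_mulVec,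
      Matrix.adjugate_mul, Matrix.smul_mulVec, Matrix.one_mulVec, Pi.smul_apply, smul_eq_mul,
      inv_mul_cancel_left₀ (hne x hx)]
  have hnhds : (L.U ∩ e.baseSet) ∩ L'.U ∈ nhds x₀ :=
    Filter.inter_mem (Filter.inter_mem (L.isOpen.mem_nhds h)
      (e.open_baseSet.mem_nhds (mem_baseSet_trivializationAt _ _ x₀))) (L'.isOpen.mem_nhds h')
  refine ContMDiffAt.congr_of_eventuallyEq ?_ (Filter.eventually_of_mem hnhds hmul)
  refine ContMDiffAt.mul ?_ ?_
  · exact ((contDiffAt_inv ℝ (hne x₀ ⟨h, mem_baseSet_trivializationAt _ _ x₀⟩)).contMDiffAt).comp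
      x₀ (hdet _ (hA L h))
  · refine hdet _ fun k l => ?_
    by_cases hl : l = i
    · subst hl
      simpa using hA L' h' k j
    · simpa [hl] using hA L h k l

end IrrSO3Structure


namespace IrrSO3Structure

open IrrSO3

variable {M : Type*} [TopologicalSpace M] [ChartedSpace (EuclideanSpace ℝ (Fin 5)) M]
  [IsManifold (𝓡 5) ∞ M] (S : IrrSO3Structure M)

open Classical in
/-- A smooth adapted frame `L` on `U`, extended outside `U` by arbitrary adapted frames. -/
def frameOf (L : S.LocalFrame) (x : M) : Fin 5 → TangentSpace (𝓡 5) x :=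
  if x ∈ L.U then fun i => L.E i x else S.frame x

lemma frameOf_eq (L : S.LocalFrame) {x : M} (hx : x ∈ L.U) :
    S.frameOf L x = fun i => L.E i x := if_pos hx

lemma frameOf_mem (L : S.LocalFrame) (x : M) : S.frameOf L x ∈ S.adapted x := by
  unfold frameOf
  split_ifs with h
  · exact L.adapted x h
  · exact S.frame_mem x

/-- The local trivialization of the twistor space given by a smooth adapted frame. -/
def pretriv (L : S.LocalFrame) : Pretrivialization S2 (π S2 S.TwistorFibre) where
  toFun τ := (τ.1, S.sphereEquiv (S.frameOf_mem L τ.1) τ.2)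
  invFun z := ⟨z.1, (S.sphereEquiv (S.frameOf_mem L z.1)).symm z.2⟩
  source := π S2 S.TwistorFibre ⁻¹' L.U
  target := L.U ×ˢ univ
  map_source' τ h := ⟨h, mem_univ _⟩
  map_target' z h := h.1
  left_inv' τ _ := by simp
  right_inv' z _ := by simp
  open_target := L.isOpen.prod isOpen_univ
  baseSet := L.U
  open_baseSet := L.isOpen
  source_eq := rfl
  target_eq := rfl
  proj_toFun _ _ := rfl

/-- The transition between two local trivializations, in coordinates. -/
def transition (L L' : S.LocalFrame) (z : M × S2) : EuclideanSpace ℝ (Fin 3) :=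
  WithLp.toLp 2 (kappaCoord ((Matrix.of fun i j => S.g z.1 (L'.E i z.1) (L.E j z.1))ᵀ *
    (∑ i, z.2.1 i • kappa i) * Matrix.of fun i j => S.g z.1 (L'.E i z.1) (L.E j z.1)))

lemma coe_sphereEquiv (L L' : S.LocalFrame) (z : M × S2) (h : z.1 ∈ L.U) (h' : z.1 ∈ L'.U) :
    (S.sphereEquiv (S.frameOf_mem L z.1) ((S.sphereEquiv (S.frameOf_mem L' z.1)).symm z.2) :
      EuclideanSpace ℝ (Fin 3)) = S.transition L L' z := by
  have h1 : S.frameOf L z.1 = fun j => ∑ i,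
      (Matrix.of fun i j => S.g z.1 (L'.E i z.1) (L.E j z.1)) i j • S.frameOf L' z.1 i := by
    funext j
    rw [S.frameOf_eq L h, S.frameOf_eq L' h']
    exact (S.sum_g_adapted (L'.adapted _ h') (L.E j z.1)).symm
  change WithLp.toLp 2 (kappaCoord (S.toMat (S.frameOf L z.1)
    (S.ofMat (S.frameOf L' z.1) (∑ i, z.2.1 i • kappa i)))) = _
  rw [h1, toMat_change, S.toMat_ofMat (S.frameOf_mem L' z.1)]
  rfl

instance : Fact (Module.finrank ℝ (EuclideanSpace ℝ (Fin 3)) = 2 + 1) :=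
  ⟨finrank_euclideanSpace_fin⟩

lemma contMDiffOn_transition (L L' : S.LocalFrame) :
    ContMDiffOn ((𝓡 5).prod (𝓡 2)) 𝓘(ℝ, EuclideanSpace ℝ (Fin 3)) ∞ (S.transition L L')
      ((L.U ∩ L'.U) ×ˢ univ) := by
  rintro z ⟨⟨h, h'⟩, -⟩
  have hG : ∀ i j, ContMDiffAt ((𝓡 5).prod (𝓡 2)) 𝓘(ℝ, ℝ) ∞
      (fun z : M × S2 => S.g z.1 (L'.E i z.1) (L.E j z.1)) z := fun i j =>
    ContMDiffAt.comp (g := fun x : M => S.g x (L'.E i x) (L.E j x)) z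
      (S.contMDiffAt_transition L' L h' h i j) contMDiffAt_fst
  have hy : ∀ i, ContMDiffAt ((𝓡 5).prod (𝓡 2)) 𝓘(ℝ, ℝ) ∞ (fun z : M × S2 => z.2.1 i) z := by
    intro i
    have h1 := (EuclideanSpace.proj i : EuclideanSpace ℝ (Fin 3) →L[ℝ] ℝ).contDiff
      (n := ∞) |>.contMDiff
    exact (h1.comp (contMDiff_coe_sphere.comp contMDiff_snd)).contMDiffAt
  refine ContMDiffAt.contMDiffWithinAt ?_
  have hpi : ∀ f : M × S2 → (Fin 3 → ℝ),
      (∀ i, ContMDiffAt ((𝓡 5).prod (𝓡 2)) 𝓘(ℝ, ℝ) ∞ (fun z => f z i) z) →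
      ContMDiffAt ((𝓡 5).prod (𝓡 2)) 𝓘(ℝ, EuclideanSpace ℝ (Fin 3)) ∞
        (fun z => WithLp.toLp 2 (f z)) z := by
    intro f hf
    have h1 : ContMDiffAt ((𝓡 5).prod (𝓡 2)) 𝓘(ℝ, Fin 3 → ℝ) ∞ f z :=
      contMDiffAt_pi_space.2 hf
    exact ((PiLp.continuousLinearEquiv 2 ℝ (fun _ : Fin 3 => ℝ)).symm.contDiff
      (n := ∞)).contMDiff.contMDiffAt.comp z h1
  refine hpi _ fun i => ?_
  simp only [kappaCoord, bivInner, Matrix.mul_apply, Matrix.transpose_apply, Matrix.of_apply,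
    Matrix.sum_apply, Matrix.smul_apply, smul_eq_mul]
  refine contMDiffAt_const.mul (contMDiffAt_const.mul ?_)
  refine contMDiffAt_finsetSum fun a _ => contMDiffAt_finsetSum fun b _ => ?_
  refine ContMDiffAt.mul (contMDiffAt_finsetSum fun c _ => ContMDiffAt.mul ?_ (hG _ _))
    contMDiffAt_const
  refine contMDiffAt_finsetSum fun d _ => (hG _ _).mul ?_
  exact contMDiffAt_finsetSum fun l _ => (hy l).mul contMDiffAt_const

/-- The twistor space as a fibre bundle with fibre `S²`. -/
def prebundle : FiberPrebundle S2 S.TwistorFibre where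
  pretrivializationAtlas := range S.pretriv
  pretrivializationAt p := S.pretriv (S.frameNear p)
  mem_base_pretrivializationAt := S.mem_frameNear
  pretrivialization_mem_atlas _ := mem_range_self _
  continuous_trivChange := by
    rintro _ ⟨L, rfl⟩ _ ⟨L', rfl⟩
    have h : ContinuousOn (fun z : M × S2 => (z.1,
        S.sphereEquiv (S.frameOf_mem L z.1) ((S.sphereEquiv (S.frameOf_mem L' z.1)).symm z.2)))
        ((L.U ∩ L'.U) ×ˢ univ) := by
      refine continuousOn_fst.prodMk (Topology.IsInducing.subtypeVal.continuousOn_iff.2 ?_)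
      exact (S.contMDiffOn_transition L L').continuousOn.congr fun z hz =>
        S.coe_sphereEquiv L L' z hz.1.1 hz.1.2
    exact h.mono fun z hz => ⟨⟨hz.2, hz.1.1⟩, mem_univ _⟩
  totalSpaceMk_isInducing p := by
    have h1 : Topology.IsInducing (S.sphereEquiv (S.frameOf_mem (S.frameNear p) p)) := by
      have hf : S.frameOf (S.frameNear p) p = S.frame p := S.frameOf_eq _ (S.mem_frameNear p)
      have h2 : Topology.IsInducing (fun y : Fin 3 → ℝ => ∑ i, y i • kappa i) := by
        refine (Topology.IsEmbedding.of_leftInverse (f := kappaCoord) kappaCoord_sum ?_ ?_).1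
        · refine continuous_pi fun i => ?_
          simp only [kappaCoord, bivInner]
          fun_prop
        · fun_prop
      have h3 : Topology.IsInducing fun y : S2 => ∑ i, y.1 i • kappa i :=
        h2.comp ((PiLp.homeomorph 2 (fun _ : Fin 3 => ℝ)).isInducing.comp
          Topology.IsInducing.subtypeVal)
      have h4 : Topology.IsInducing fun σ : S.TwistorFibre p => S.toMat (S.frame p) σ.1 := ⟨rfl⟩
      have h5 : (fun σ : S.TwistorFibre p => S.toMat (S.frame p) σ.1) =
          (fun y : S2 => ∑ i, y.1 i • kappa i) ∘
            S.sphereEquiv (S.frameOf_mem (S.frameNear p) p) := by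
        funext σ
        have := sum_kappaCoord (S.toMat_mem (S.frame_mem p)
          (S.frameOf_mem (S.frameNear p) p) σ.2.1)
        change _ = ∑ i, kappaCoord (S.toMat (S.frameOf (S.frameNear p) p) σ.1) i • kappa i
        rw [this, hf]
      rw [h5] at h4
      exact (h3.of_comp_iff).1 h4
    have h6 : Topology.IsInducing (Prod.mk p : S2 → M × S2) := (isEmbedding_prodMkRight p).1
    exact h6.comp h1

/-- The twistor space `𝕋` of `M`: the bundle of the vectors `σ ∈ Λ²₃TM` with `|σ|² = 5`. -/
abbrev Twistor : Type _ := TotalSpace S2 S.TwistorFibre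

instance : TopologicalSpace S.Twistor := S.prebundle.totalSpaceTopology

instance : FiberBundle S2 S.TwistorFibre := S.prebundle.toFiberBundle

/-- The charts of the twistor space come from the local trivializations given by smooth adapted
frames, the charts of `M` and the charts of the sphere. -/
instance : ChartedSpace (ModelProd (EuclideanSpace ℝ (Fin 5)) (EuclideanSpace ℝ (Fin 2)))
    S.Twistor :=
  ChartedSpace.comp _ (M × S2) _

end IrrSO3Structure


namespace IrrSO3Structure

open IrrSO3

lemma contMDiffWithinAt_sphere {H E X : Type*} [NormedAddCommGroup E] [NormedSpace ℝ E]
    [TopologicalSpace H] [TopologicalSpace X] [ChartedSpace H X] {I : ModelWithCorners ℝ E H}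
    {f : X → S2} {s : Set X} {x : X}
    (hf : ContMDiffWithinAt I 𝓘(ℝ, EuclideanSpace ℝ (Fin 3)) ∞ (fun x => (f x).1) s x) :
    ContMDiffWithinAt I (𝓡 2) ∞ f s x := by
  rw [contMDiffWithinAt_iff_target]
  refine ⟨Topology.IsInducing.subtypeVal.continuousWithinAt_iff.2 hf.continuousWithinAt, ?_⟩
  let v : S2 := -(f x)
  let U := (OrthonormalBasis.fromOrthogonalSpanSingleton (𝕜 := ℝ) 2
    (ne_zero_of_mem_unit_sphere v)).repr
  have h0 : (f x).1 ∈ {y | innerSL ℝ v.1 y ≠ (1 : ℝ)} := by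
    have h1 : ‖(f x).1‖ = 1 := norm_eq_of_mem_sphere (f x)
    have h2 : inner ℝ (f x).1 (f x).1 = (1 : ℝ) := by
      rw [real_inner_self_eq_norm_sq, h1]; norm_num
    change innerSL ℝ (-(f x).1) (f x).1 ≠ 1
    rw [map_neg, neg_apply, innerSL_apply_apply, h2]
    norm_num
  have ho : IsOpen {y | innerSL ℝ v.1 y ≠ (1 : ℝ)} :=
    isOpen_ne_fun (innerSL ℝ v.1).continuous continuous_const
  have h1 : ContDiffAt ℝ ∞ (stereoToFun v.1) (f x).1 :=
    contDiffOn_stereoToFun.contDiffAt (ho.mem_nhds h0)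
  have h2 : ContDiffAt ℝ ∞ (U ∘ stereoToFun v.1) (f x).1 :=
    U.contDiff.contDiffAt.comp _ h1
  have h3 := h2.contMDiffAt.comp_contMDiffWithinAt (f := fun x => (f x).1) x hf
  have h4 : (extChartAt (𝓡 2) (f x) : S2 → _) = fun y => (U ∘ stereoToFun v.1) y.1 := by
    funext y
    rfl
  rw [h4]
  exact h3

variable {M : Type*} [TopologicalSpace M] [ChartedSpace (EuclideanSpace ℝ (Fin 5)) M]
  [IsManifold (𝓡 5) ∞ M] (S : IrrSO3Structure M)

/-- Local diffeomorphisms of `M × S²`. -/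
def localDiffeos (M : Type*) [TopologicalSpace M] [ChartedSpace (EuclideanSpace ℝ (Fin 5)) M] :
    Pregroupoid (M × S2) where
  property f s := ContMDiffOn ((𝓡 5).prod (𝓡 2)) ((𝓡 5).prod (𝓡 2)) ∞ f s
  comp hf hg _ _ _ := hg.comp' hf
  id_mem := contMDiffOn_id
  locality _ h x hx := by
    obtain ⟨v, hv, hxv, h1⟩ := h x hx
    exact (h1 x ⟨hx, hxv⟩).mono_of_mem_nhdsWithin
      (Filter.inter_mem self_mem_nhdsWithin (mem_nhdsWithin_of_mem_nhds (hv.mem_nhds hxv)))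
  congr _ h h1 := h1.congr h

instance : HasGroupoid S.Twistor (localDiffeos M).groupoid := by
  refine hasGroupoid_of_pregroupoid _ ?_
  rintro _ _ ⟨_, ⟨_, ⟨L, rfl⟩, rfl⟩, rfl⟩ ⟨_, ⟨_, ⟨L', rfl⟩, rfl⟩, rfl⟩
  change ContMDiffOn _ _ _ (fun z : M × S2 => (z.1,
    S.sphereEquiv (S.frameOf_mem L' z.1) ((S.sphereEquiv (S.frameOf_mem L z.1)).symm z.2))) _
  refine ContMDiffOn.mono (s := (L'.U ∩ L.U) ×ˢ univ) ?_ ?_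
  · refine contMDiffOn_fst.prodMk fun z hz => contMDiffWithinAt_sphere ?_
    exact (S.contMDiffOn_transition L' L z hz).congr
      (fun z hz => S.coe_sphereEquiv L' L z hz.1.1 hz.1.2) (S.coe_sphereEquiv L' L z hz.1.1 hz.1.2)
  · rintro z ⟨h, h'⟩
    exact ⟨⟨h', h.1⟩, mem_univ _⟩

/-- The twistor space is a smooth `7`-manifold. -/
instance : IsManifold ((𝓡 5).prod (𝓡 2)) ∞ S.Twistor := by
  refine { StructureGroupoid.HasGroupoid.comp (localDiffeos M).groupoid ?_ with }
  intro e he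
  rw [isLocalStructomorphOn_contDiffGroupoid_iff]
  exact mem_groupoid_of_pregroupoid.1 he

end IrrSO3Structure


namespace IrrSO3

/-! ### Exterior algebra of `ℝ⁵` in components

A `k`-vector `β` has the components `β i₁ … iₖ` with `β = (1 / k!) ∑ β i₁ … iₖ eᵢ₁ ∧ … ∧ eᵢₖ`. -/

/-- The Levi-Civita symbol. -/
def eps (i j k l m : Fin 5) : ℝ :=
  ∏ a : Fin 5, ∏ b ∈ Finset.Ioi a,
    ((SignType.sign (((![i, j, k, l, m] b : Fin 5) : ℤ) - (![i, j, k, l, m] a : Fin 5)) : ℤ) : ℝ)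

/-- The components of the bivector given by the matrix `F`. -/
def comp2 (F : Matrix (Fin 5) (Fin 5) ℝ) (i j : Fin 5) : ℝ := F j i

/-- The wedge product of two bivectors. -/
def wedge22 (s t : Fin 5 → Fin 5 → ℝ) (i j k l : Fin 5) : ℝ :=
  s i j * t k l - s i k * t j l + s i l * t j k + s j k * t i l - s j l * t i k + s k l * t i j

/-- The wedge product of a vector and a bivector. -/
def wedge12 (v : Fin 5 → ℝ) (t : Fin 5 → Fin 5 → ℝ) (i j k : Fin 5) : ℝ :=
  v i * t j k - v j * t i k + v k * t i j

/-- The Hodge star operator on `4`-vectors. -/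
def star4 (b : Fin 5 → Fin 5 → Fin 5 → Fin 5 → ℝ) (m : Fin 5) : ℝ :=
  1 / 24 * ∑ i, ∑ j, ∑ k, ∑ l, eps i j k l m * b i j k l

/-- The Hodge star operator on `3`-vectors. -/
def star3 (b : Fin 5 → Fin 5 → Fin 5 → ℝ) (l m : Fin 5) : ℝ :=
  1 / 6 * ∑ i, ∑ j, ∑ k, eps i j k l m * b i j k

/-- The vector `¼ ∗(σ ∧ σ)` of a bivector `σ`. -/
def xi (F : Matrix (Fin 5) (Fin 5) ℝ) : Fin 5 → ℝ :=
  (1 / 4 : ℝ) • star4 (wedge22 (comp2 F) (comp2 F))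

/-- The Hodge star operator `τ ↦ ∗(ξ ∧ τ)` on the bivectors of the orthogonal complement of a unit
vector `ξ`, oriented so that `ξ` followed by it gives the orientation of `ℝ⁵`. -/
def starPerp (v : Fin 5 → ℝ) (F : Matrix (Fin 5) (Fin 5) ℝ) : Matrix (Fin 5) (Fin 5) ℝ :=
  Matrix.of fun j i => star3 (wedge12 v (comp2 F)) i j

/-- For `ε = ±1`, the component `σ_±` of `σ`, self-dual or anti-self-dual on the orthogonal
complement of `ξ`. -/
def sdPart (ε : ℝ) (F : Matrix (Fin 5) (Fin 5) ℝ) : Matrix (Fin 5) (Fin 5) ℝ :=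
  (1 / 2 : ℝ) • (F + ε • starPerp (xi F) F)

end IrrSO3

section Contact

variable {E H N : Type*} [NormedAddCommGroup E] [NormedSpace ℝ E] [TopologicalSpace H]
  [TopologicalSpace N] [ChartedSpace H N] (I : ModelWithCorners ℝ E H)

/-- The exterior derivative of a `1`-form `η` on a manifold without boundary,
`dη(A, B) = A(η(B)) - B(η(A)) - η([A, B])`, computed in the chart at `z` with `A` and `B` extended
by constant vector fields. -/
def extDeriv1 (η : ∀ z : N, TangentSpace I z → ℝ) (z : N) (A B : TangentSpace I z) : ℝ :=
  let c := extChartAt I z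
  let D : TangentSpace I z → E := mfderiv I 𝓘(ℝ, E) c z
  let loc : E → E → ℝ := fun v w => η (c.symm w) (mfderiv 𝓘(ℝ, E) I c.symm w v)
  fderiv ℝ (loc (D B)) (c z) (D A) - fderiv ℝ (loc (D A)) (c z) (D B)

/-- The condition `dη = Ω` for an almost contact metric structure `(Φ, χ, h)` to be contact, where
`η = h(·, χ)` and `Ω(A, B) = h(A, Φ B)`. -/
def IsContactMetric (Φ : ∀ z : N, TangentSpace I z → TangentSpace I z)
    (χ : ∀ z : N, TangentSpace I z)
    (h : ∀ z : N, TangentSpace I z → TangentSpace I z → ℝ) : Prop :=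
  ∀ z A B, extDeriv1 I (fun z A => h z A (χ z)) z A B = h z A (Φ z B)

end Contact

namespace IrrSO3Structure

open IrrSO3

variable {M : Type*} [TopologicalSpace M] [ChartedSpace (EuclideanSpace ℝ (Fin 5)) M]
  [IsManifold (𝓡 5) ∞ M] (S : IrrSO3Structure M)

/-- The tangent space of the twistor space. -/
abbrev TangentTwistor (σ : S.Twistor) : Type := TangentSpace ((𝓡 5).prod (𝓡 2)) σ

/-- The point of `Λ²₃TM`, as an endomorphism of the tangent space of `M`. -/
def endo (σ : S.Twistor) : Module.End ℝ (TangentSpace (𝓡 5) σ.proj) := σ.snd.1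

/-- The matrix of `σ` in the chosen frame. -/
def mat (σ : S.Twistor) : Matrix (Fin 5) (Fin 5) ℝ := S.toMat (S.frame σ.proj) (S.endo σ)

/-- The vector `ξ_σ = ¼ ∗(σ ∧ σ)`. -/
def xiAt (σ : S.Twistor) : TangentSpace (𝓡 5) σ.proj :=
  ∑ i, xi (S.mat σ) i • S.frame σ.proj i

/-- For `ε = ±1`, the endomorphism `φ^σ_±`: it is zero at `ξ_σ` and equals `J^σ_±` on the orthogonal
complement of `ξ_σ`, where `g(J^σ_± X, Y) = 2 / (2 ± 1) g(σ_±, X ∧ Y)`. -/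
def phi (ε : ℝ) (σ : S.Twistor) (X : TangentSpace (𝓡 5) σ.proj) : TangentSpace (𝓡 5) σ.proj :=
  (2 / (2 + ε)) • S.ofMat (S.frame σ.proj) (sdPart ε (S.mat σ))
    (X - S.g σ.proj X (S.xiAt σ) • S.xiAt σ)

/-- The vertical space `𝒱_σ`: the orthogonal complement of `σ` in `Λ²₃T_pM`. -/
def Vert (σ : S.Twistor) : Set (Module.End ℝ (TangentSpace (𝓡 5) σ.proj)) :=
  {V | V ∈ S.Lambda23At σ.proj ∧ S.bivInnerAt σ.proj V (S.endo σ) = 0}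

/-- The cross product on `Λ²₃T_pM`, normalized by `κ₁ × κ₂ = κ₃`. -/
def cross {p : M} (V W : Module.End ℝ (TangentSpace (𝓡 5) p)) :
    Module.End ℝ (TangentSpace (𝓡 5) p) :=
  S.ofMat (S.frame p) (∑ i, (kappaCoord (S.toMat (S.frame p) V) ⨯₃
    kappaCoord (S.toMat (S.frame p) W)) i • kappa i)

/-- The differential of the projection `π : 𝕋 → M`. -/
def dproj (σ : S.Twistor) (A : S.TangentTwistor σ) : TangentSpace (𝓡 5) σ.proj :=
  mfderiv ((𝓡 5).prod (𝓡 2)) (𝓡 5) (fun τ : S.Twistor => τ.proj) σ A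

section Connection

variable (nabla : CovariantDerivative (𝓡 5) (EuclideanSpace ℝ (Fin 5))
  (fun x : M => TangentSpace (𝓡 5) x))

/-- `∇` is an `SO(3)`-connection: its connection forms in adapted frames take their values in the
Lie algebra of `ι(SO(3))`. -/
def IsSO3Connection : Prop :=
  ∀ (L : S.LocalFrame), ∀ x ∈ L.U, ∀ X : TangentSpace (𝓡 5) x,
    ∃ A : Matrix (Fin 3) (Fin 3) ℝ, Aᵀ = -A ∧
      ∀ j, nabla (L.E j) x X = ∑ i, iotaLie A i j • L.E i x

/-- The torsion `T(X, Y) = ∇_X Y - ∇_Y X - [X, Y]`. -/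
def torsion (p : M) (X Y : TangentSpace (𝓡 5) p) : TangentSpace (𝓡 5) p :=
  nabla.torsion p X Y

/-- The torsion is totally skew-symmetric. -/
def HasSkewTorsion : Prop :=
  ∀ (p : M) (X Y Z : TangentSpace (𝓡 5) p),
    S.g p (torsion nabla p X Y) Z = -S.g p (torsion nabla p X Z) Y

/-- The covariant derivative `∇_X Ψ` at `x` of a section `Ψ` of the endomorphism bundle,
`(∇_X Ψ)(Z) = ∇_X (Ψ Z) - Ψ (∇_X Z)`, by means of an adapted frame near `x`. -/
def covEnd (Ψ : ∀ y : M, Module.End ℝ (TangentSpace (𝓡 5) y)) (x : M)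
    (X : TangentSpace (𝓡 5) x) : Module.End ℝ (TangentSpace (𝓡 5) x) :=
  ∑ j, (S.g x (S.frame x j)).smulRight
    (nabla (fun y => Ψ y ((S.frameNear x).E j y)) x X - Ψ x (nabla ((S.frameNear x).E j) x X))

/-- The section `κᵢ` of `Λ²₃TM` given by the chosen adapted frame near `p`. -/
def kappaSec (p : M) (i : Fin 3) (y : M) : Module.End ℝ (TangentSpace (𝓡 5) y) :=
  S.ofMat (fun j => (S.frameNear p).E j y) (kappa i)

/-- The fibre coordinates `τ = ∑ yᵢ(τ) κᵢ` given by the chosen adapted frame near `p`. -/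
def coordNear (p : M) (i : Fin 3) (τ : S.Twistor) : ℝ :=
  kappaCoord (S.toMat (fun j => (S.frameNear p).E j τ.proj) (S.endo τ)) i

/-- The differential of the `i`-th fibre coordinate at `σ`. -/
def dcoord (σ : S.Twistor) (i : Fin 3) (A : S.TangentTwistor σ) : ℝ :=
  mfderiv ((𝓡 5).prod (𝓡 2)) 𝓘(ℝ, ℝ) (S.coordNear σ.proj i) σ A

/-- The connection map of `∇` on `Λ²₃TM ⊇ 𝕋`: it maps the velocity of a curve `σ(s)` in `𝕋` to the
covariant derivative `∇σ/ds`. With `σ(s) = ∑ yᵢ(s) κᵢ` this is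
`∑ yᵢ'(s) κᵢ + ∑ yᵢ(s) ∇_{π_*σ'(s)} κᵢ`. The horizontal vectors are those it maps to zero. -/
def connMap (σ : S.Twistor) (A : S.TangentTwistor σ) :
    Module.End ℝ (TangentSpace (𝓡 5) σ.proj) :=
  ∑ i, (S.dcoord σ i A • S.kappaSec σ.proj i σ.proj
    + S.coordNear σ.proj i σ • S.covEnd nabla (S.kappaSec σ.proj i) σ.proj (S.dproj σ A))

/-- The horizontal and vertical components of a tangent vector of `𝕋`. -/
def split (σ : S.Twistor) (A : S.TangentTwistor σ) :
    TangentSpace (𝓡 5) σ.proj × Module.End ℝ (TangentSpace (𝓡 5) σ.proj) :=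
  (S.dproj σ A, S.connMap nabla σ A)

/-- The horizontal lift `X^h_σ`. -/
def horLift (σ : S.Twistor) (X : TangentSpace (𝓡 5) σ.proj) : S.TangentTwistor σ :=
  Function.invFun (S.split nabla σ) (X, 0)

/-- The tangent vector of the fibre of `𝕋` given by `V ∈ 𝒱_σ`. -/
def vertVec (σ : S.Twistor) (V : Module.End ℝ (TangentSpace (𝓡 5) σ.proj)) :
    S.TangentTwistor σ :=
  Function.invFun (S.split nabla σ) (0, V)

/-- The metric `h_t(X^h + V, Y^h + W) = g(X, Y) + t g(V, W)`. -/
def hMetric (t : ℝ) (σ : S.Twistor) (A B : S.TangentTwistor σ) : ℝ :=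
  S.g σ.proj (S.dproj σ A) (S.dproj σ B) +
    t * S.bivInnerAt σ.proj (S.connMap nabla σ A) (S.connMap nabla σ B)

/-- The vector field `χ_σ = (ξ_σ)^h_σ`. -/
def chi (σ : S.Twistor) : S.TangentTwistor σ := S.horLift nabla σ (S.xiAt σ)

/-- For `ε = ±1`, the endomorphism `Φ^{(n)}_±`, `Φ X^h = (φ^σ_± X)^h` and `Φ V = (-1)^(n+1) 𝒥 V` with
the complex structure `𝒥 V = -σ × V` of the fibres. -/
def Phi (ε : ℝ) (n : ℕ) (σ : S.Twistor) (A : S.TangentTwistor σ) : S.TangentTwistor σ :=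
  S.horLift nabla σ (S.phi ε σ (S.dproj σ A)) +
    S.vertVec nabla σ ((-1 : ℝ) ^ (n + 1) • -S.cross (S.endo σ) (S.connMap nabla σ A))

/-- The `1`-form `η_t(A) = h_t(A, χ)`. -/
def eta (t : ℝ) (σ : S.Twistor) (A : S.TangentTwistor σ) : ℝ :=
  S.hMetric nabla t σ A (S.chi nabla σ)

/-- The exterior derivative `dη_t`. -/
def dEta (t : ℝ) (σ : S.Twistor) (A B : S.TangentTwistor σ) : ℝ :=
  extDeriv1 ((𝓡 5).prod (𝓡 2)) (S.eta nabla t) σ A B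

/-- The fundamental form `Ω^{(n)}_{±,t}(A, B) = h_t(A, Φ^{(n)}_± B)`. -/
def Omega (ε : ℝ) (n : ℕ) (t : ℝ) (σ : S.Twistor) (A B : S.TangentTwistor σ) : ℝ :=
  S.hMetric nabla t σ A (S.Phi nabla ε n σ B)

end Connection

end IrrSO3Structure

end

/-!
The form `η_t` depends neither on `t` nor on the connection: since `χ` is horizontal,
`η_t(A) = g(π_* A, ξ)` (`eta_eq`). In a local adapted frame with dual coframe `θ` this is
`η = ∑ ξᵢ(y) θⁱ`, where `y` are the fibre coordinates `σ = ∑ yᵢ κᵢ` and `ξ(y)` is an explicit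
quadratic map `ℝ³ → ℝ⁵` (`xiVec`, `eta_chart`). The same coordinates may be used in every adapted
frame because `ξ` is equivariant (`xi_conj`): `Λ²₃` is the Lie algebra `so(3)`, and under this
identification `ξ` is `√3` times the traceless part of the square of a skew matrix (`xi_iotaLie`).

The structure equation `dθ = θ(T) - ω ∧ θ` (`LocalFrame.extDeriv_chartCoframe`) gives the
derivative of `η` in the chart. The connection forms `ω` take their values in the span of the `κᵢ`,
and the vertical component of a tangent vector differs from the change of its fibre coordinates by
the rotation `y × ω` (`toMat_connMap`). By the infinitesimal equivariance of `ξ` (`xiPolar_cross`)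
all terms with `ω` cancel, and for every `SO(3)`-connection
`dη(X^h + V, Y^h + W) = g(T(X, Y), ξ) + g(dξ(V), Y) - g(dξ(W), X)` (`dEta_eq`).

The formula for skew-symmetric torsion follows since the polar form of `ξ` is related to `φ_±`:
one has `σ(V(ξ)) = dξ(V)` and `∗(ξ ∧ σ)(V(ξ)) = 2 dξ(V)` for `V` vertical at `σ`, which gives
`± g(φ_± X, V(ξ)) = -g(X, dξ(V))` (`sdPart_dot`).

The remaining claims need no assumption on the torsion, which only enters for two horizontal
vectors. For `V` vertical, with fibre coordinates `v`, one has
`dη(V, dξ(V)^h) = |dξ(V)|² = 3 |v|²` (`xiPolar_dot_self`), so `dη ≠ 0` at every point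
(`exists_dEta_ne`), while `Ω(V, Y^h) = 0` as `Φ` preserves the horizontal space (`Omega_eq_zero`).
-/

noncomputable section

namespace IrrSO3

/-! ### The Hodge star in components -/

/-- The sign of `j - i`. -/
def ordSign (i j : Fin 5) : ℝ := if i < j then 1 else if j < i then -1 else 0

lemma sign_sub_eq_ordSign (i j : Fin 5) :
    ((SignType.sign (((j : Fin 5) : ℤ) - (i : Fin 5)) : ℤ) : ℝ) = ordSign i j := by
  unfold ordSign
  split_ifs with h h'
  · rw [sign_pos (by omega)]; simp
  · rw [sign_neg (by omega)]; simp
  · rw [show i = j by omega]; simp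

lemma eps_eq (i j k l m : Fin 5) : eps i j k l m =
    ordSign i j * ordSign i k * ordSign i l * ordSign i m * ordSign j k * ordSign j l *
      ordSign j m * ordSign k l * ordSign k m * ordSign l m := by
  simp only [eps, sign_sub_eq_ordSign, Fin.prod_univ_five,
    show Finset.Ioi (0 : Fin 5) = {1, 2, 3, 4} by decide,
    show Finset.Ioi (1 : Fin 5) = {2, 3, 4} by decide,
    show Finset.Ioi (2 : Fin 5) = {3, 4} by decide,
    show Finset.Ioi (3 : Fin 5) = {4} by decide,
    show Finset.Ioi (4 : Fin 5) = ∅ by decide]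
  simp [mul_assoc]

lemma ordSign_table : ordSign 0 1 = 1 ∧ ordSign 0 2 = 1 ∧ ordSign 0 3 = 1 ∧ ordSign 0 4 = 1 ∧
    ordSign 1 2 = 1 ∧ ordSign 1 3 = 1 ∧ ordSign 1 4 = 1 ∧ ordSign 2 3 = 1 ∧ ordSign 2 4 = 1 ∧
    ordSign 3 4 = 1 ∧ ordSign 1 0 = -1 ∧ ordSign 2 0 = -1 ∧ ordSign 3 0 = -1 ∧ ordSign 4 0 = -1 ∧
    ordSign 2 1 = -1 ∧ ordSign 3 1 = -1 ∧ ordSign 4 1 = -1 ∧ ordSign 3 2 = -1 ∧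
    ordSign 4 2 = -1 ∧ ordSign 4 3 = -1 := by
  simp [ordSign]

lemma ordSign_self (i : Fin 5) : ordSign i i = 0 := by simp [ordSign]

/-- Factoring out the sign functions of each index as early as possible keeps the expanded sum
small. -/
lemma sum_eps_four (b : Fin 5 → Fin 5 → Fin 5 → Fin 5 → ℝ) (m : Fin 5) :
    ∑ i, ∑ j, ∑ k, ∑ l, eps i j k l m * b i j k l =
      ∑ i, ordSign i m * ∑ j, ordSign i j * ordSign j m *
        ∑ k, (ordSign i k * ordSign j k * ordSign k m) *
          ∑ l, (ordSign i l * ordSign j l * ordSign k l * ordSign l m) * b i j k l := by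
  simp only [eps_eq, Finset.mul_sum]
  refine Finset.sum_congr rfl fun i _ => Finset.sum_congr rfl fun j _ =>
    Finset.sum_congr rfl fun k _ => Finset.sum_congr rfl fun l _ => ?_
  ring

set_option maxHeartbeats 4000000 in
lemma star4_wedge22 (s : Fin 5 → Fin 5 → ℝ) (hs : ∀ i j, s i j = -s j i) :
    star4 (wedge22 s s) = (2 : ℝ) • ![s 1 2 * s 3 4 - s 1 3 * s 2 4 + s 1 4 * s 2 3,
      -(s 0 2 * s 3 4 - s 0 3 * s 2 4 + s 0 4 * s 2 3),
      s 0 1 * s 3 4 - s 0 3 * s 1 4 + s 0 4 * s 1 3,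
      -(s 0 1 * s 2 4 - s 0 2 * s 1 4 + s 0 4 * s 1 2),
      s 0 1 * s 2 3 - s 0 2 * s 1 3 + s 0 3 * s 1 2] := by
  ext m
  rw [star4, sum_eps_four]
  have h := ordSign_table
  fin_cases m <;>
    simp only [Fin.sum_univ_five, Fin.zero_eta, Fin.mk_one, Fin.reduceFinMk, ordSign_self, h,
      mul_zero, zero_mul, zero_add, add_zero, one_mul, mul_one, neg_mul, neg_neg]
  all_goals
    simp only [wedge22, hs 1 0, hs 2 0, hs 3 0, hs 4 0, hs 2 1, hs 3 1, hs 4 1, hs 3 2, hs 4 2,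
      hs 4 3, Pi.smul_apply, smul_eq_mul, Matrix.cons_val]
    ring

lemma sum_eps_three (b : Fin 5 → Fin 5 → Fin 5 → ℝ) (l m : Fin 5) :
    ∑ i, ∑ j, ∑ k, eps i j k l m * b i j k = ordSign l m *
      ∑ i, ordSign i l * ordSign i m * ∑ j, ordSign i j * ordSign j l * ordSign j m *
        ∑ k, (ordSign i k * ordSign j k * ordSign k l * ordSign k m) * b i j k := by
  simp only [eps_eq, Finset.mul_sum]
  refine Finset.sum_congr rfl fun i _ => Finset.sum_congr rfl fun j _ =>
    Finset.sum_congr rfl fun k _ => ?_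
  ring

set_option maxHeartbeats 4000000 in
lemma star3_wedge12 (v : Fin 5 → ℝ) (s : Fin 5 → Fin 5 → ℝ) (hs : ∀ i j, s i j = -s j i) :
    (Matrix.of fun i j => star3 (wedge12 v s) j i) =
    let c := fun i j k => v i * s j k - v j * s i k + v k * s i j
    !![0, -c 2 3 4, c 1 3 4, -c 1 2 4, c 1 2 3;
       c 2 3 4, 0, -c 0 3 4, c 0 2 4, -c 0 2 3;
       -c 1 3 4, c 0 3 4, 0, -c 0 1 4, c 0 1 3;
       c 1 2 4, -c 0 2 4, c 0 1 4, 0, -c 0 1 2;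
       -c 1 2 3, c 0 2 3, -c 0 1 3, c 0 1 2, 0] := by
  ext l m
  rw [Matrix.of_apply, star3, sum_eps_three]
  have h := ordSign_table
  fin_cases l <;> fin_cases m <;>
    simp only [Fin.sum_univ_five, Fin.zero_eta, Fin.mk_one, Fin.reduceFinMk, ordSign_self, h,
      mul_zero, zero_mul, zero_add, add_zero, one_mul, mul_one, neg_mul, neg_neg, Matrix.of_apply,
      Matrix.cons_val]
  all_goals
    simp only [wedge12, hs 1 0, hs 2 0, hs 3 0, hs 4 0, hs 2 1, hs 3 1, hs 4 1, hs 3 2, hs 4 2,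
      hs 4 3]
    ring

/-! ### Algebra of `Λ²₃` and of the quadratic map `ξ` -/

/-- The components of the vector `ξ = ¼ ∗(σ ∧ σ)` of the bivector `σ = ∑ yᵢ κᵢ`, as quadratic forms
in the fibre coordinates `y`. -/
def xiVec (y : Fin 3 → ℝ) : Fin 5 → ℝ :=
  ![(y 0 ^ 2 + y 1 ^ 2) / 2 - y 2 ^ 2, -(√3 * (y 0 * y 1)), √3 * (y 0 * y 2),
    √3 / 2 * (y 1 ^ 2 - y 0 ^ 2), -(√3 * (y 1 * y 2))]

lemma sum_kappa_skew (y : Fin 3 → ℝ) : (∑ i, y i • kappa i)ᵀ = -∑ i, y i • kappa i := by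
  rw [sum_kappa]
  ext i j
  fin_cases i <;> fin_cases j <;> simp

lemma sqrt_three_mul_self : √3 * √3 = 3 := Real.mul_self_sqrt (by norm_num)

lemma comp2_skew (y : Fin 3 → ℝ) (i j : Fin 5) :
    comp2 (∑ i, y i • kappa i) i j = -comp2 (∑ i, y i • kappa i) j i :=
  congrFun (congrFun (sum_kappa_skew y) i) j

lemma xi_sum_kappa (y : Fin 3 → ℝ) : xi (∑ i, y i • kappa i) = xiVec y := by
  -- `√3` is generalized to an atom with `r * r = 3`, so that the goals are polynomial identities
  have h := sqrt_three_mul_self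
  rw [xi, star4_wedge22 _ (comp2_skew y), sum_kappa]
  ext m
  fin_cases m <;> simp [comp2, xiVec] <;> generalize √3 = r at h ⊢ <;> grind

/-- The derivative of `xiVec` at `y` in the direction `v`. -/
def xiPolar (y v : Fin 3 → ℝ) : Fin 5 → ℝ :=
  ![y 0 * v 0 + y 1 * v 1 - 2 * (y 2 * v 2), -(√3 * (y 0 * v 1 + y 1 * v 0)),
    √3 * (y 0 * v 2 + y 2 * v 0), √3 * (y 1 * v 1 - y 0 * v 0), -(√3 * (y 1 * v 2 + y 2 * v 1))]

lemma xiVec_dot_xiPolar (y v : Fin 3 → ℝ) :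
    xiVec y ⬝ᵥ xiPolar y v = 2 * (y ⬝ᵥ y) * (y ⬝ᵥ v) := by
  have h := sqrt_three_mul_self
  simp only [xiVec, xiPolar, dotProduct, Fin.sum_univ_five, Fin.sum_univ_three, Matrix.cons_val]
  generalize √3 = r at h ⊢
  grind

/-- In particular the differential of `ξ` multiplies lengths of tangent vectors of the unit sphere
by `√3`; this makes `dη` nondegenerate between vertical and horizontal vectors. -/
lemma xiPolar_dot_self (y v : Fin 3 → ℝ) :
    xiPolar y v ⬝ᵥ xiPolar y v = 3 * ((y ⬝ᵥ y) * (v ⬝ᵥ v)) + (y ⬝ᵥ v) ^ 2 := by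
  have h := sqrt_three_mul_self
  simp only [xiPolar, dotProduct, Fin.sum_univ_five, Fin.sum_univ_three, Matrix.cons_val]
  generalize √3 = r at h ⊢
  grind

/-- For `V` vertical at `σ`, the vector `σ(V(ξ_σ))` is the derivative of `ξ` in the direction
`V`. -/
lemma mulVec_mulVec_xiVec (y v : Fin 3 → ℝ) (hy : y ⬝ᵥ y = 1) (hv : y ⬝ᵥ v = 0) :
    (∑ i, y i • kappa i) *ᵥ ((∑ i, v i • kappa i) *ᵥ xiVec y) = xiPolar y v := by
  have h := sqrt_three_mul_self
  rw [sum_kappa, sum_kappa]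
  simp only [dotProduct, Fin.sum_univ_three] at hy hv
  ext m
  simp only [xiVec, xiPolar, Matrix.mulVec, dotProduct, Fin.sum_univ_five, Matrix.of_apply,
    Matrix.cons_val]
  generalize √3 = r at h ⊢
  fin_cases m <;>
    simp only [Fin.zero_eta, Fin.mk_one, Fin.reduceFinMk, Matrix.cons_val] <;> grind

lemma starPerp_eq (v : Fin 5 → ℝ) (y : Fin 3 → ℝ) :
    starPerp v (∑ i, y i • kappa i) =
    let s := comp2 (∑ i, y i • kappa i)
    let c := fun i j k => v i * s j k - v j * s i k + v k * s i j
    !![0, -c 2 3 4, c 1 3 4, -c 1 2 4, c 1 2 3;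
       c 2 3 4, 0, -c 0 3 4, c 0 2 4, -c 0 2 3;
       -c 1 3 4, c 0 3 4, 0, -c 0 1 4, c 0 1 3;
       c 1 2 4, -c 0 2 4, c 0 1 4, 0, -c 0 1 2;
       -c 1 2 3, c 0 2 3, -c 0 1 3, c 0 1 2, 0] :=
  star3_wedge12 _ _ (comp2_skew y)

lemma starPerp_sum_kappa_skew (v : Fin 5 → ℝ) (y : Fin 3 → ℝ) :
    (starPerp v (∑ i, y i • kappa i))ᵀ = -starPerp v (∑ i, y i • kappa i) := by
  rw [starPerp_eq]
  ext i j
  fin_cases i <;> fin_cases j <;> simp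

set_option maxHeartbeats 4000000 in
/-- For `V` vertical at `σ`, the Hodge dual `∗(ξ_σ ∧ σ)` maps `V(ξ_σ)` to twice the derivative of
`ξ` in the direction `V`. -/
lemma starPerp_mulVec_mulVec_xiVec (y v : Fin 3 → ℝ) (hy : y ⬝ᵥ y = 1) (hv : y ⬝ᵥ v = 0) :
    starPerp (xiVec y) (∑ i, y i • kappa i) *ᵥ ((∑ i, v i • kappa i) *ᵥ xiVec y) =
      (2 : ℝ) • xiPolar y v := by
  have h := sqrt_three_mul_self
  rw [starPerp_eq, sum_kappa, sum_kappa]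
  simp only [dotProduct, Fin.sum_univ_three] at hy hv
  ext m
  simp only [xiVec, xiPolar, Matrix.mulVec, dotProduct, Fin.sum_univ_five, Matrix.of_apply,
    Matrix.cons_val, comp2, Pi.smul_apply, smul_eq_mul]
  generalize √3 = r at h ⊢
  fin_cases m <;>
    simp only [Fin.zero_eta, Fin.mk_one, Fin.reduceFinMk, Matrix.cons_val] <;> grind

/-- The relation `± g(φ_± x, V(ξ)) = -g(x, dξ(V))`. It follows from `σ_±(V(ξ)) = ½ (1 ± 2) dξ(V)`
and from `(1 ± 2) / (2 ± 1) = ± 1`, as `σ_±` is skew. The component of `x` along `ξ` does not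
contribute because `dξ(V)` is orthogonal to `ξ`. -/
lemma sdPart_dot (ε : ℝ) (hε : ε = 1 ∨ ε = -1) (y v : Fin 3 → ℝ) (hy : y ⬝ᵥ y = 1)
    (hv : y ⬝ᵥ v = 0) (x : Fin 5 → ℝ) :
    ε * (((2 / (2 + ε)) • (sdPart ε (∑ i, y i • kappa i) *ᵥ (x - (x ⬝ᵥ xiVec y) • xiVec y))) ⬝ᵥ
      ((∑ i, v i • kappa i) *ᵥ xiVec y)) = -(x ⬝ᵥ xiPolar y v) := by
  have h1 : (sdPart ε (∑ i, y i • kappa i))ᵀ = -sdPart ε (∑ i, y i • kappa i) := by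
    rw [sdPart, Matrix.transpose_smul, Matrix.transpose_add, Matrix.transpose_smul,
      starPerp_sum_kappa_skew, sum_kappa_skew, smul_neg, ← neg_add, smul_neg]
  have h2 : sdPart ε (∑ i, y i • kappa i) *ᵥ ((∑ i, v i • kappa i) *ᵥ xiVec y) =
      ((1 + 2 * ε) / 2) • xiPolar y v := by
    rw [sdPart, Matrix.smul_mulVec, Matrix.add_mulVec, Matrix.smul_mulVec, xi_sum_kappa,
      mulVec_mulVec_xiVec y v hy hv, starPerp_mulVec_mulVec_xiVec y v hy hv]
    module
  have h3 : ∀ a b : Fin 5 → ℝ, (sdPart ε (∑ i, y i • kappa i) *ᵥ a) ⬝ᵥ b =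
      -(a ⬝ᵥ (sdPart ε (∑ i, y i • kappa i) *ᵥ b)) := by
    intro a b
    rw [dotProduct_comm, Matrix.dotProduct_mulVec, ← Matrix.mulVec_transpose, h1,
      Matrix.neg_mulVec, neg_dotProduct, dotProduct_comm]
  rw [smul_dotProduct, h3, h2, dotProduct_smul, sub_dotProduct, smul_dotProduct,
    xiVec_dot_xiPolar, hv]
  rcases hε with rfl | rfl <;> simp <;> ring

/-- With respect to `κ₁, κ₂, κ₃` the commutator is minus the cross product of `ℝ³`. -/
lemma sum_kappa_commutator (b y : Fin 3 → ℝ) :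
    (∑ i, b i • kappa i) * (∑ i, y i • kappa i) - (∑ i, y i • kappa i) * (∑ i, b i • kappa i) =
      ∑ i, (y ⨯₃ b) i • kappa i := by
  have h := sqrt_three_mul_self
  rw [sum_kappa, sum_kappa, sum_kappa, cross_apply]
  ext l m
  simp only [Matrix.sub_apply, Matrix.mul_apply, Fin.sum_univ_five, Matrix.of_apply,
    Matrix.cons_val]
  generalize √3 = r at h ⊢
  fin_cases l <;> fin_cases m <;>
    simp only [Fin.zero_eta, Fin.mk_one, Fin.reduceFinMk, Matrix.cons_val] <;> grind

/-- The infinitesimal form of the equivariance of `ξ` under `ι(SO(3))`: the derivative of `ξ` along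
the rotation field of `B = ∑ bᵢ κᵢ` is `B ξ`. This is what makes the connection forms cancel
in `dη`. -/
lemma xiPolar_cross (b y : Fin 3 → ℝ) :
    xiPolar y (y ⨯₃ b) = (∑ i, b i • kappa i) *ᵥ xiVec y := by
  have h := sqrt_three_mul_self
  rw [sum_kappa, cross_apply]
  ext m
  simp only [xiVec, xiPolar, Matrix.mulVec, dotProduct, Fin.sum_univ_five, Matrix.of_apply,
    Matrix.cons_val]
  generalize √3 = r at h ⊢
  fin_cases m <;>
    simp only [Fin.zero_eta, Fin.mk_one, Fin.reduceFinMk, Matrix.cons_val] <;> grind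

/-- The Lie algebra of `ι(SO(3))` is the span of `κ₁, κ₂, κ₃`. -/
lemma iotaLie_eq_sum_kappa {A : Matrix (Fin 3) (Fin 3) ℝ} (hA : Aᵀ = -A) :
    iotaLie A = ∑ i, ![-A 1 2, -A 0 2, -A 0 1] i • kappa i := by
  have h1 : ∀ i j, A j i = -A i j := fun i j => congrFun (congrFun hA i) j
  have h00 : A 0 0 = 0 := by linarith [h1 0 0]
  have h11 : A 1 1 = 0 := by linarith [h1 1 1]
  have h22 : A 2 2 = 0 := by linarith [h1 2 2]
  have h := sqrt_three_mul_self
  have h' : √3 * (√3)⁻¹ = 1 := mul_inv_cancel₀ (by positivity)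
  rw [sum_kappa]
  ext l m
  simp only [iotaLie, muInv, mu, Matrix.of_apply, Matrix.cons_val, Matrix.sub_apply,
    Matrix.mul_apply, Fin.sum_univ_three, h00, h11, h22, h1 0 1, h1 0 2, h1 1 2, div_eq_mul_inv]
  fin_cases l <;> fin_cases m <;> simp <;> generalize √3 = r at h h' ⊢ <;> grind

/-! ### Equivariance of `ξ` under `ι(SO(3))` -/

lemma iota_transpose {h : Matrix (Fin 3) (Fin 3) ℝ}
    (hh : h ∈ Matrix.specialOrthogonalGroup (Fin 3) ℝ) (x : Fin 5 → ℝ) :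
    (iota h)ᵀ *ᵥ x = rho hᵀ x := by
  have h1 : x = iota h *ᵥ (rho hᵀ x) := by
    rw [iota_mulVec, rho, rho, mu_muInv]
    · rw [Matrix.transpose_transpose, ← Matrix.mul_assoc, ← Matrix.mul_assoc, so3_mul_transpose hh,
        one_mul, Matrix.mul_assoc, so3_mul_transpose hh, mul_one, muInv_mu]
    · simp [Matrix.transpose_mul, mu_transpose, Matrix.mul_assoc]
    · rw [Matrix.transpose_transpose, Matrix.trace_mul_comm, ← Matrix.mul_assoc,
        so3_mul_transpose hh, one_mul, mu_trace]
  conv_lhs => rw [h1, Matrix.mulVec_mulVec, iota_transpose_mul hh, Matrix.one_mulVec]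

lemma iotaLie_mulVec (A : Matrix (Fin 3) (Fin 3) ℝ) (x : Fin 5 → ℝ) :
    iotaLie A *ᵥ x = muInv (A * mu x - mu x * A) := by
  have h1 : iotaLie A = LinearMap.toMatrix' (R := ℝ)
      { toFun := fun x => muInv (A * mu x - mu x * A)
        map_add' := fun x y => by rw [mu_add, ← muInv_add]; congr 1; noncomm_ring
        map_smul' := fun c x => by
          rw [mu_smul, ← muInv_smul, Matrix.mul_smul, Matrix.smul_mul, smul_sub]; rfl } := by
    ext i j; simp [iotaLie, LinearMap.toMatrix'_apply]
  rw [h1, ← Matrix.toLin'_apply, Matrix.toLin'_toMatrix']; rfl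

lemma iotaLie_conj {h : Matrix (Fin 3) (Fin 3) ℝ}
    (hh : h ∈ Matrix.specialOrthogonalGroup (Fin 3) ℝ) {A : Matrix (Fin 3) (Fin 3) ℝ}
    (hA : Aᵀ = -A) :
    (iota h)ᵀ * iotaLie A * iota h = iotaLie (hᵀ * A * h) := by
  refine Matrix.ext_of_mulVec_single fun i => ?_
  generalize (Pi.single i 1 : Fin 5 → ℝ) = x
  have hs := so3_transpose_mul hh
  rw [← Matrix.mulVec_mulVec, ← Matrix.mulVec_mulVec, iota_mulVec, iotaLie_mulVec, mu_rho hh,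
    iota_transpose hh, iotaLie_mulVec, rho, mu_muInv]
  · congr 1
    rw [Matrix.transpose_transpose]
    calc hᵀ * (A * (h * mu x * hᵀ) - h * mu x * hᵀ * A) * h
        = hᵀ * A * h * mu x * (hᵀ * h) - (hᵀ * h) * mu x * (hᵀ * A * h) := by noncomm_ring
      _ = _ := by rw [hs, one_mul, mul_one]
  · simp only [Matrix.transpose_sub, Matrix.transpose_mul, hA, Matrix.transpose_transpose,
      mu_transpose]
    noncomm_ring
  · rw [Matrix.trace_sub, Matrix.trace_mul_comm, sub_self]

/-- The element of `so(3)` that acts on `ℝ⁵` by `∑ yᵢ κᵢ`, see `iotaLie_skewOf`. -/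
def skewOf (y : Fin 3 → ℝ) : Matrix (Fin 3) (Fin 3) ℝ :=
  !![0, -y 2, -y 1; y 2, 0, -y 0; y 1, y 0, 0]

lemma skewOf_transpose (y : Fin 3 → ℝ) : (skewOf y)ᵀ = -skewOf y := by
  ext i j; fin_cases i <;> fin_cases j <;> simp [skewOf]

lemma iotaLie_skewOf (y : Fin 3 → ℝ) : iotaLie (skewOf y) = ∑ i, y i • kappa i := by
  rw [iotaLie_eq_sum_kappa (skewOf_transpose y)]
  simp [Fin.sum_univ_three, skewOf]

/-- On the image of `A ∈ so(3)` the map `ξ` is, up to a factor, the traceless part of `A²`; in this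
form its equivariance is evident. -/
lemma xi_iotaLie {A : Matrix (Fin 3) (Fin 3) ℝ} (hA : Aᵀ = -A) :
    xi (iotaLie A) = √3 • muInv (A * A - ((A * A).trace / 3) • 1) := by
  have h1 : ∀ i j, A j i = -A i j := fun i j => congrFun (congrFun hA i) j
  have h00 : A 0 0 = 0 := by linarith [h1 0 0]
  have h11 : A 1 1 = 0 := by linarith [h1 1 1]
  have h22 : A 2 2 = 0 := by linarith [h1 2 2]
  have h := sqrt_three_mul_self
  rw [iotaLie_eq_sum_kappa hA, xi_sum_kappa]
  ext m
  fin_cases m <;> simp [xiVec, muInv, Matrix.mul_apply, Matrix.trace_fin_three, Fin.sum_univ_three,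
    h00, h11, h22, h1 0 1, h1 0 2, h1 1 2] <;> generalize √3 = r at h ⊢ <;> grind

lemma xi_conj {h : Matrix (Fin 3) (Fin 3) ℝ}
    (hh : h ∈ Matrix.specialOrthogonalGroup (Fin 3) ℝ) {F : Matrix (Fin 5) (Fin 5) ℝ}
    (hF : F ∈ Lambda23) : xi ((iota h)ᵀ * F * iota h) = (iota h)ᵀ *ᵥ xi F := by
  obtain ⟨y, rfl⟩ := (mem_Lambda23_iff F).1 hF
  have hA := skewOf_transpose y
  rw [← iotaLie_skewOf]
  generalize skewOf y = A at hA
  have hA' : (hᵀ * A * h)ᵀ = -(hᵀ * A * h) := by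
    simp only [Matrix.transpose_mul, hA, Matrix.transpose_transpose]
    noncomm_ring
  have h1 : hᵀ * A * h * (hᵀ * A * h) = hᵀ * (A * A) * h := by
    calc _ = hᵀ * A * (h * hᵀ) * A * h := by noncomm_ring
      _ = _ := by rw [so3_mul_transpose hh]; noncomm_ring
  have h2 : (hᵀ * (A * A) * h).trace = (A * A).trace := by
    rw [Matrix.trace_mul_comm, ← Matrix.mul_assoc, so3_mul_transpose hh, one_mul]
  rw [iotaLie_conj hh hA, xi_iotaLie hA', xi_iotaLie hA, Matrix.mulVec_smul, iota_transpose hh, rho,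
    mu_muInv, h1, h2]
  · congr 2
    rw [Matrix.transpose_transpose, mul_sub, sub_mul, Matrix.mul_smul, Matrix.smul_mul, mul_one,
      so3_transpose_mul hh]
  · simp [Matrix.transpose_mul, hA]
  · simp [Matrix.trace_sub]

end IrrSO3

/-! ### Calculus of coframes -/

section Coframe

variable {F ι : Type*} [NormedAddCommGroup F] [NormedSpace ℝ F] [CompleteSpace F] [Fintype ι]
  [DecidableEq ι]
  {e : ι → F → F} {θ : ι → F → F →L[ℝ] ℝ} {u₀ : F}

/-- The coframe dual to a differentiable frame is differentiable. -/
lemma differentiableAt_coframe (he : ∀ j, DifferentiableAt ℝ (e j) u₀)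
    (h1 : ∀ᶠ u in nhds u₀, ∀ v, ∑ j, θ j u v • e j u = v)
    (h2 : ∀ᶠ u in nhds u₀, ∀ i j, θ i u (e j u) = if i = j then 1 else 0) (i : ι) :
    DifferentiableAt ℝ (θ i) u₀ := by
  -- With the dual basis `θ u₀` frozen, `P u` is the change of frame from `u₀` to `u`; `Q u` is its
  -- inverse, and `θ u` is recovered from it.
  let P : F → F →L[ℝ] F := fun u => ∑ j, (θ j u₀).smulRight (e j u)
  let Q : F → F →L[ℝ] F := fun u => ∑ j, (θ j u).smulRight (e j u₀)
  have hP : DifferentiableAt ℝ P u₀ := by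
    refine DifferentiableAt.fun_sum fun j _ => ?_
    exact ((ContinuousLinearMap.smulRightL ℝ F F (θ j u₀)).differentiableAt).comp u₀ (he j)
  have h1' := h1.self_of_nhds
  have h2' := h2.self_of_nhds
  have hQ : ∀ᶠ u in nhds u₀, IsUnit (P u) ∧ Ring.inverse (P u) = Q u := by
    filter_upwards [h1, h2] with u hu1 hu2
    have hPQ : P u * Q u = 1 := by
      ext v
      simp [P, Q, h2', hu1]
    have hQP : Q u * P u = 1 := by
      ext v
      simp [P, Q, hu2, h1']
    exact ⟨⟨⟨P u, Q u, hPQ, hQP⟩, rfl⟩, Ring.inverse_unit ⟨P u, Q u, hPQ, hQP⟩⟩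
  have hQd : DifferentiableAt ℝ Q u₀ :=
    (hP.inverse hQ.self_of_nhds.1).congr_of_eventuallyEq (hQ.mono fun u hu => hu.2.symm)
  have hθ : ∀ u, θ i u = (θ i u₀).comp (Q u) := by
    intro u
    ext v
    simp [Q, h2']
  rw [show θ i = fun u => (θ i u₀).comp (Q u) from funext hθ]
  exact (differentiableAt_const _).clm_comp hQd

/-- The structure equation `dθ(a, b) = -∑ θ_j(a) θ_k(b) θ([e_j, e_k])` for a dual coframe. -/
lemma extDeriv_coframe (he : ∀ j, DifferentiableAt ℝ (e j) u₀)
    (h1 : ∀ᶠ u in nhds u₀, ∀ v, ∑ j, θ j u v • e j u = v)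
    (h2 : ∀ᶠ u in nhds u₀, ∀ i j, θ i u (e j u) = if i = j then 1 else 0) (i : ι) (a b : F) :
    fderiv ℝ (θ i) u₀ a b - fderiv ℝ (θ i) u₀ b a =
      -∑ j, ∑ k, θ j u₀ a * θ k u₀ b * θ i u₀ (VectorField.lieBracket ℝ (e j) (e k) u₀) := by
  have hd := differentiableAt_coframe he h1 h2
  have key : ∀ a k, fderiv ℝ (θ i) u₀ a (e k u₀) = -θ i u₀ (fderiv ℝ (e k) u₀ a) := by
    intro a k
    have h3 := ((hd i).hasFDerivAt.clm_apply (he k).hasFDerivAt)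
    have h4 : HasFDerivAt (fun u => θ i u (e k u)) (0 : F →L[ℝ] ℝ) u₀ :=
      (hasFDerivAt_const (if i = k then (1 : ℝ) else 0) u₀).congr_of_eventuallyEq
        (h2.mono fun u hu => hu i k)
    have h5 := congrArg (fun f => f a) (h3.unique h4)
    simp at h5
    linarith
  have key2 : ∀ a b, fderiv ℝ (θ i) u₀ a b =
      -∑ j, ∑ k, θ j u₀ a * θ k u₀ b * θ i u₀ (fderiv ℝ (e k) u₀ (e j u₀)) := by
    intro a b
    conv_lhs => rw [← h1.self_of_nhds b]
    simp only [map_sum, map_smul, key]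
    rw [Finset.sum_comm, ← Finset.sum_neg_distrib]
    refine Finset.sum_congr rfl fun k _ => ?_
    conv_lhs => rw [← h1.self_of_nhds a]
    simp only [map_sum, map_smul, smul_eq_mul, mul_neg, Finset.mul_sum]
    congr 1
    refine Finset.sum_congr rfl fun j _ => by ring
  rw [key2, key2, Finset.sum_comm (f := fun j k => θ j u₀ b * θ k u₀ a * _)]
  simp only [VectorField.lieBracket, map_sub, mul_sub, Finset.sum_sub_distrib]
  rw [neg_sub_neg, neg_sub]
  congr 1
  refine Finset.sum_congr rfl fun j _ => Finset.sum_congr rfl fun k _ => by ring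

end Coframe

namespace IrrSO3Structure

open IrrSO3

variable {M : Type*} [TopologicalSpace M] [ChartedSpace (EuclideanSpace ℝ (Fin 5)) M]
  [IsManifold (𝓡 5) ∞ M] (S : IrrSO3Structure M)

/-! ### Adapted frames -/

lemma g_eq_sum {p : M} {a : Fin 5 → TangentSpace (𝓡 5) p} (ha : a ∈ S.adapted p)
    (X Y : TangentSpace (𝓡 5) p) : S.g p X Y = ∑ i, S.g p (a i) X * S.g p (a i) Y := by
  conv_lhs => rw [← S.sum_g_adapted ha X]
  simp [LinearMap.sum_apply]

lemma g_comm {p : M} (X Y : TangentSpace (𝓡 5) p) : S.g p X Y = S.g p Y X := by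
  rw [S.g_eq_sum (S.frame_mem p), S.g_eq_sum (S.frame_mem p) Y]
  simp only [mul_comm]

lemma g_sum_smul {p : M} {a : Fin 5 → TangentSpace (𝓡 5) p} (ha : a ∈ S.adapted p)
    (x : Fin 5 → ℝ) (i : Fin 5) : S.g p (a i) (∑ j, x j • a j) = x i := by
  simp [S.g_adapted ha]

lemma g_ofMat {p : M} {a : Fin 5 → TangentSpace (𝓡 5) p} (ha : a ∈ S.adapted p)
    (A : Matrix (Fin 5) (Fin 5) ℝ) (X : TangentSpace (𝓡 5) p) (i : Fin 5) :
    S.g p (a i) (S.ofMat a A X) = (A *ᵥ fun j => S.g p (a j) X) i := by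
  simp [ofMat, LinearMap.sum_apply, S.g_adapted ha, Matrix.mulVec, dotProduct]

/-- `ξ_σ` may be computed in any adapted frame. -/
lemma xiAt_eq (τ : S.Twistor) {a : Fin 5 → TangentSpace (𝓡 5) τ.proj}
    (ha : a ∈ S.adapted τ.proj) : S.xiAt τ = ∑ i, xi (S.toMat a (S.endo τ)) i • a i := by
  obtain ⟨h, hh, rfl⟩ := (S.mem_iff _ _ (S.frame_mem τ.proj) a).1 ha
  have hF : S.toMat (S.frame τ.proj) (S.endo τ) ∈ Lambda23 := τ.2.2.1
  rw [toMat_change, xi_conj hh hF]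
  have h1 := iota_mul_transpose hh
  simp only [Finset.smul_sum, smul_smul]
  rw [Finset.sum_comm, xiAt]
  refine Finset.sum_congr rfl fun i _ => ?_
  rw [← Finset.sum_smul]
  congr 1
  have h2 := congrFun (Matrix.one_mulVec (xi (S.mat τ))) i
  rw [← h1, ← Matrix.mulVec_mulVec] at h2
  rw [← h2]
  simp only [Matrix.mulVec, dotProduct, mul_comm]
  rfl

end IrrSO3Structure

namespace IrrSO3Structure

open IrrSO3

variable {M : Type*} [TopologicalSpace M] [ChartedSpace (EuclideanSpace ℝ (Fin 5)) M]
  [IsManifold (𝓡 5) ∞ M] {S : IrrSO3Structure M}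

/-! ### The structure equation of an adapted frame -/

/-- The differential at `u` of the inverse of the chart at `p`. -/
def chartSymmDeriv (p : M) (u : EuclideanSpace ℝ (Fin 5)) :
    EuclideanSpace ℝ (Fin 5) →L[ℝ] TangentSpace (𝓡 5) ((extChartAt (𝓡 5) p).symm u) :=
  mfderiv 𝓘(ℝ, EuclideanSpace ℝ (Fin 5)) (𝓡 5) (extChartAt (𝓡 5) p).symm u

lemma isInvertible_chartSymmDeriv (p : M) {u : EuclideanSpace ℝ (Fin 5)}
    (hu : u ∈ (extChartAt (𝓡 5) p).target) : (chartSymmDeriv p u).IsInvertible := by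
  have := isInvertible_mfderivWithin_extChartAt_symm (I := 𝓡 5) hu
  rwa [ModelWithCorners.range_eq_univ, mfderivWithin_univ] at this

/-- The tangent vector at `p` with a given coordinate vector in the chart at `p`; the base points
`p` and `(extChartAt (𝓡 5) p).symm (extChartAt (𝓡 5) p p)` are identified. -/
def tangentOfChart (p : M) : EuclideanSpace ℝ (Fin 5) →L[ℝ] TangentSpace (𝓡 5) p :=
  chartSymmDeriv p (extChartAt (𝓡 5) p p)

lemma tangentOfChart_surjective (p : M) : Function.Surjective (tangentOfChart p) :=
  (isInvertible_chartSymmDeriv p (mem_extChartAt_target (I := 𝓡 5) p)).surjective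

/-- At the base point the differential of the chart is inverse to `tangentOfChart`. -/
lemma tangentOfChart_eq_inverse (p : M) (w : EuclideanSpace ℝ (Fin 5)) :
    tangentOfChart p w =
      (mfderiv (𝓡 5) 𝓘(ℝ, EuclideanSpace ℝ (Fin 5)) (extChartAt (𝓡 5) p) p).inverse w := by
  have h := mfderivWithin_extChartAt_symm_comp_mfderiv_extChartAt' (I := 𝓡 5)
    (mem_extChartAt_source (I := 𝓡 5) p)
  have hi := isInvertible_mfderiv_extChartAt (I := 𝓡 5) (mem_extChartAt_source (I := 𝓡 5) p)
  rw [ModelWithCorners.range_eq_univ, mfderivWithin_univ] at h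
  have h2 := DFunLike.congr_fun h
    ((mfderiv (𝓡 5) 𝓘(ℝ, EuclideanSpace ℝ (Fin 5)) (extChartAt (𝓡 5) p) p).inverse w)
  refine Eq.trans ?_ h2
  refine congrArg (chartSymmDeriv p (extChartAt (𝓡 5) p p)) ?_
  exact (hi.self_apply_inverse w).symm

/-- The vector fields of a local frame in the chart at `p`. -/
def LocalFrame.chartField (L : S.LocalFrame) (p : M) (j : Fin 5)
    (u : EuclideanSpace ℝ (Fin 5)) : EuclideanSpace ℝ (Fin 5) :=
  (chartSymmDeriv p u).inverse (L.E j ((extChartAt (𝓡 5) p).symm u))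

lemma LocalFrame.chartField_eq_mpullbackWithin (L : S.LocalFrame) (p : M) (j : Fin 5) :
    VectorField.mpullbackWithin 𝓘(ℝ, EuclideanSpace ℝ (Fin 5)) (𝓡 5)
      (extChartAt (𝓡 5) p).symm (L.E j) univ = L.chartField p j := by
  funext u
  rw [VectorField.mpullbackWithin_apply, mfderivWithin_univ]
  rfl

/-- The coframe dual to a local frame, in the chart at `p`. -/
def LocalFrame.chartCoframe (L : S.LocalFrame) (p : M) (i : Fin 5)
    (u : EuclideanSpace ℝ (Fin 5)) : EuclideanSpace ℝ (Fin 5) →L[ℝ] ℝ :=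
  LinearMap.toContinuousLinearMap
    ((S.g ((extChartAt (𝓡 5) p).symm u) (L.E i _)).comp (chartSymmDeriv p u).toLinearMap)

lemma LocalFrame.chartCoframe_apply (L : S.LocalFrame) (p : M) (i : Fin 5)
    (u v : EuclideanSpace ℝ (Fin 5)) : L.chartCoframe p i u v =
      S.g ((extChartAt (𝓡 5) p).symm u) (L.E i _) (chartSymmDeriv p u v) := rfl

lemma LocalFrame.chartSymmDeriv_chartField (L : S.LocalFrame) (p : M) (j : Fin 5)
    {u : EuclideanSpace ℝ (Fin 5)} (hu : u ∈ (extChartAt (𝓡 5) p).target) :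
    chartSymmDeriv p u (L.chartField p j u) = L.E j ((extChartAt (𝓡 5) p).symm u) :=
  (isInvertible_chartSymmDeriv p hu).self_apply_inverse _

lemma LocalFrame.eventually_mem (L : S.LocalFrame) {p : M} (hp : p ∈ L.U) :
    ∀ᶠ u in nhds (extChartAt (𝓡 5) p p),
      u ∈ (extChartAt (𝓡 5) p).target ∧ (extChartAt (𝓡 5) p).symm u ∈ L.U := by
  have h := continuousAt_extChartAt_symm (I := 𝓡 5) p
  have h2 : L.U ∈ nhds ((extChartAt (𝓡 5) p).symm (extChartAt (𝓡 5) p p)) := by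
    rw [extChartAt_to_inv]
    exact L.isOpen.mem_nhds hp
  exact Filter.Eventually.and (extChartAt_target_mem_nhds (I := 𝓡 5) p) (h.eventually h2)

lemma LocalFrame.chartCoframe_chartField (L : S.LocalFrame) {p : M} (hp : p ∈ L.U) :
    ∀ᶠ u in nhds (extChartAt (𝓡 5) p p), ∀ i j,
      L.chartCoframe p i u (L.chartField p j u) = if i = j then 1 else 0 := by
  filter_upwards [L.eventually_mem hp] with u hu i j
  rw [chartCoframe_apply, L.chartSymmDeriv_chartField p j hu.1, S.g_adapted (L.adapted _ hu.2)]

lemma LocalFrame.sum_chartCoframe_smul (L : S.LocalFrame) {p : M} (hp : p ∈ L.U) :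
    ∀ᶠ u in nhds (extChartAt (𝓡 5) p p), ∀ v,
      ∑ j, L.chartCoframe p j u v • L.chartField p j u = v := by
  filter_upwards [L.eventually_mem hp] with u hu v
  refine (isInvertible_chartSymmDeriv p hu.1).injective ?_
  rw [map_sum]
  refine Eq.trans (Finset.sum_congr rfl fun j _ => ?_) (S.sum_g_adapted (L.adapted _ hu.2) _)
  rw [map_smul, L.chartSymmDeriv_chartField p j hu.1]
  rfl

lemma LocalFrame.mdifferentiableAt (L : S.LocalFrame) {p : M} (hp : p ∈ L.U) (j : Fin 5) :
    MDifferentiableAt (𝓡 5) ((𝓡 5).prod 𝓘(ℝ, EuclideanSpace ℝ (Fin 5)))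
      (fun x => (⟨x, L.E j x⟩ : TangentBundle (𝓡 5) M)) p :=
  ((L.smooth j).contMDiffAt (L.isOpen.mem_nhds hp)).mdifferentiableAt (by simp)

lemma LocalFrame.differentiableAt_chartField (L : S.LocalFrame) {p : M} (hp : p ∈ L.U)
    (j : Fin 5) : DifferentiableAt ℝ (L.chartField p j) (extChartAt (𝓡 5) p p) := by
  have h := (L.mdifferentiableAt hp j).mdifferentiableWithinAt (s := univ)
  have h2 := h.differentiableWithinAt_mpullbackWithin_vectorField
  rw [ModelWithCorners.range_eq_univ, preimage_univ, inter_univ,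
    L.chartField_eq_mpullbackWithin] at h2
  exact differentiableWithinAt_univ.1 h2

lemma LocalFrame.differentiableAt_chartCoframe (L : S.LocalFrame) {p : M} (hp : p ∈ L.U)
    (i : Fin 5) : DifferentiableAt ℝ (L.chartCoframe p i) (extChartAt (𝓡 5) p p) :=
  differentiableAt_coframe (L.differentiableAt_chartField hp) (L.sum_chartCoframe_smul hp)
    (L.chartCoframe_chartField hp) i

lemma LocalFrame.chartCoframe_self_apply (L : S.LocalFrame) (p : M) (i : Fin 5)
    (v : EuclideanSpace ℝ (Fin 5)) : L.chartCoframe p i (extChartAt (𝓡 5) p p) v =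
      S.g p (L.E i p) (tangentOfChart p v) := by
  have h : ∀ q, q = p → ∀ w : EuclideanSpace ℝ (Fin 5), S.g q (L.E i q) w = S.g p (L.E i p) w := by
    rintro q rfl w; rfl
  exact h _ (extChartAt_to_inv (I := 𝓡 5) p) _

lemma LocalFrame.chartCoframe_lieBracket (L : S.LocalFrame) (p : M) (i j k : Fin 5) :
    L.chartCoframe p i (extChartAt (𝓡 5) p p)
      (VectorField.lieBracket ℝ (L.chartField p j) (L.chartField p k) (extChartAt (𝓡 5) p p)) =
    S.g p (L.E i p) (VectorField.mlieBracket (𝓡 5) (L.E j) (L.E k) p) := by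
  rw [chartCoframe_self_apply, tangentOfChart_eq_inverse, VectorField.mlieBracket,
    VectorField.mlieBracketWithin_apply, preimage_univ,
    ModelWithCorners.range_eq_univ, inter_univ]
  rw [L.chartField_eq_mpullbackWithin, L.chartField_eq_mpullbackWithin]
  rw [← VectorField.lieBracketWithin_univ]

/-- The first structure equation `dθ(X, Y) = θ(T(X, Y)) - θ(ω(X) Y) + θ(ω(Y) X)` of an
adapted frame. -/
lemma LocalFrame.extDeriv_chartCoframe (L : S.LocalFrame) {p : M} (hp : p ∈ L.U)
    (nabla : CovariantDerivative (𝓡 5) (EuclideanSpace ℝ (Fin 5))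
      (fun x : M => TangentSpace (𝓡 5) x))
    (Γ : TangentSpace (𝓡 5) p → Matrix (Fin 5) (Fin 5) ℝ)
    (hΓ : ∀ X j, nabla (L.E j) p X = ∑ i, Γ X i j • L.E i p)
    (i : Fin 5) (a b : EuclideanSpace ℝ (Fin 5)) (X Y : TangentSpace (𝓡 5) p)
    (hX : X = tangentOfChart p a)
    (hY : Y = tangentOfChart p b) :
    fderiv ℝ (L.chartCoframe p i) (extChartAt (𝓡 5) p p) a b -
      fderiv ℝ (L.chartCoframe p i) (extChartAt (𝓡 5) p p) b a =
    S.g p (L.E i p) (torsion nabla p X Y) - (Γ X *ᵥ fun j => S.g p (L.E j p) Y) i +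
      (Γ Y *ᵥ fun j => S.g p (L.E j p) X) i := by
  rw [extDeriv_coframe (L.differentiableAt_chartField hp) (L.sum_chartCoframe_smul hp)
    (L.chartCoframe_chartField hp)]
  have hXi : ∀ j, L.chartCoframe p j (extChartAt (𝓡 5) p p) a = S.g p (L.E j p) X := by
    intro j; rw [chartCoframe_self_apply, hX]
  have hYi : ∀ j, L.chartCoframe p j (extChartAt (𝓡 5) p p) b = S.g p (L.E j p) Y := by
    intro j; rw [chartCoframe_self_apply, hY]
  have hT : ∀ j k, VectorField.mlieBracket (𝓡 5) (L.E j) (L.E k) p =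
      nabla (L.E k) p (L.E j p) - nabla (L.E j) p (L.E k p) -
        torsion nabla p (L.E j p) (L.E k p) := by
    intro j k
    have h : torsion nabla p (L.E j p) (L.E k p) = _ :=
      nabla.torsion_apply (L.mdifferentiableAt hp j) (L.mdifferentiableAt hp k)
    rw [h]; abel
  simp only [chartCoframe_lieBracket, hT, hXi, hYi]
  obtain ⟨x, hx⟩ : ∃ x : Fin 5 → ℝ, ∀ j, S.g p (L.E j p) X = x j := ⟨_, fun j => rfl⟩
  obtain ⟨y, hy⟩ : ∃ y : Fin 5 → ℝ, ∀ j, S.g p (L.E j p) Y = y j := ⟨_, fun j => rfl⟩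
  have hXs : X = ∑ j, x j • L.E j p := by
    simp only [← hx]
    exact (S.sum_g_adapted (L.adapted p hp) X).symm
  have hYs : Y = ∑ j, y j • L.E j p := by
    simp only [← hy]
    exact (S.sum_g_adapted (L.adapted p hp) Y).symm
  have hn : ∀ X j, S.g p (L.E i p) (nabla (L.E j) p X) = Γ X i j := by
    intro X j
    rw [hΓ, S.g_sum_smul (L.adapted p hp)]
  have e1 : S.g p (L.E i p) (torsion nabla p X Y) =
      ∑ j, ∑ k, x j * y k * S.g p (L.E i p) (torsion nabla p (L.E j p) (L.E k p)) := by
    rw [hXs, hYs]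
    simp only [torsion, map_sum, map_smul, sum_apply, smul_apply, smul_eq_mul, Finset.mul_sum,
      mul_assoc]
    rw [Finset.sum_comm]
    exact Finset.sum_congr rfl fun k _ => Finset.sum_congr rfl fun j _ => by ring
  have e2 : (Γ X *ᵥ y) i = ∑ j, ∑ k, x j * y k * S.g p (L.E i p) (nabla (L.E k) p (L.E j p)) := by
    simp only [Matrix.mulVec, dotProduct, ← hn]
    rw [Finset.sum_comm, hXs]
    simp only [map_sum, map_smul, smul_eq_mul, Finset.sum_mul]
    exact Finset.sum_congr rfl fun k _ => Finset.sum_congr rfl fun j _ => by ring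
  have e3 : (Γ Y *ᵥ x) i = ∑ j, ∑ k, x j * y k * S.g p (L.E i p) (nabla (L.E j) p (L.E k p)) := by
    simp only [Matrix.mulVec, dotProduct, ← hn]
    rw [hYs]
    simp only [map_sum, map_smul, smul_eq_mul, Finset.sum_mul]
    exact Finset.sum_congr rfl fun k _ => Finset.sum_congr rfl fun j _ => by ring
  simp only [hx, hy]
  rw [e1, e2, e3]
  simp only [map_sub, mul_sub, Finset.sum_sub_distrib]
  ring

end IrrSO3Structure

namespace IrrSO3Structure

open IrrSO3

variable {M : Type*} [TopologicalSpace M] [ChartedSpace (EuclideanSpace ℝ (Fin 5)) M]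
  [IsManifold (𝓡 5) ∞ M] (S : IrrSO3Structure M)

/-! ### Charts of the twistor space -/

/-- The point of the sphere corresponding to `σ` in the chosen adapted frame near `π(σ)`. -/
def spherePoint (σ : S.Twistor) : S2 :=
  S.sphereEquiv (S.frameOf_mem (S.frameNear σ.proj) σ.proj) σ.2

lemma extChartAt_symm_apply (σ : S.Twistor)
    (w : EuclideanSpace ℝ (Fin 5) × EuclideanSpace ℝ (Fin 2)) :
    (extChartAt ((𝓡 5).prod (𝓡 2)) σ).symm w =
      ⟨(extChartAt (𝓡 5) σ.proj).symm w.1,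
        (S.sphereEquiv (S.frameOf_mem (S.frameNear σ.proj) _)).symm
          ((extChartAt (𝓡 2) (S.spherePoint σ)).symm w.2)⟩ := rfl

/-- The inclusion of the sphere into `ℝ³`, in the chart of the sphere that is part of the chart of
the twistor space at `σ`. -/
def sphereCoe (σ : S.Twistor) (w : EuclideanSpace ℝ (Fin 2)) : EuclideanSpace ℝ (Fin 3) :=
  ((extChartAt (𝓡 2) (S.spherePoint σ)).symm w).1

/-- The coordinates of the base point in the chart at `σ`. -/
def baseCoord (σ : S.Twistor) : EuclideanSpace ℝ (Fin 5) := extChartAt (𝓡 5) σ.proj σ.proj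

/-- The coordinates of the fibre point in the chart at `σ`. -/
def fibreCoord (σ : S.Twistor) : EuclideanSpace ℝ (Fin 2) :=
  extChartAt (𝓡 2) (S.spherePoint σ) (S.spherePoint σ)

lemma sphereCoe_fibreCoord (σ : S.Twistor) :
    S.sphereCoe σ (S.fibreCoord σ) = (S.spherePoint σ).1 := by
  rw [sphereCoe, fibreCoord, extChartAt_to_inv]

lemma mdifferentiableAt_sphere_chart_symm (σ : S.Twistor) :
    MDifferentiableAt 𝓘(ℝ, EuclideanSpace ℝ (Fin 2)) (𝓡 2)
      (extChartAt (𝓡 2) (S.spherePoint σ)).symm (S.fibreCoord σ) := by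
  have := mdifferentiableWithinAt_extChartAt_symm (I := 𝓡 2)
    (mem_extChartAt_target (I := 𝓡 2) (S.spherePoint σ))
  rwa [ModelWithCorners.range_eq_univ, mdifferentiableWithinAt_univ] at this

lemma differentiableAt_sphereCoe (σ : S.Twistor) :
    DifferentiableAt ℝ (S.sphereCoe σ) (S.fibreCoord σ) := by
  have h1 := S.mdifferentiableAt_sphere_chart_symm σ
  have h2 : MDifferentiableAt (𝓡 2) 𝓘(ℝ, EuclideanSpace ℝ (Fin 3)) (fun y : S2 => y.1)
      ((extChartAt (𝓡 2) (S.spherePoint σ)).symm (S.fibreCoord σ)) :=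
    (contMDiff_coe_sphere (m := 1)).contMDiffAt.mdifferentiableAt (by simp)
  exact (h2.comp _ h1).differentiableAt

/-- The differential of `sphereCoe` maps onto the tangent plane of the sphere. -/
lemma exists_fderiv_sphereCoe (σ : S.Twistor) (v : EuclideanSpace ℝ (Fin 3))
    (hv : inner ℝ (S.spherePoint σ).1 v = (0 : ℝ)) :
    ∃ w, fderiv ℝ (S.sphereCoe σ) (S.fibreCoord σ) w = v := by
  have h1 := S.mdifferentiableAt_sphere_chart_symm σ
  have hinv := isInvertible_mfderivWithin_extChartAt_symm (I := 𝓡 2)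
    (mem_extChartAt_target (I := 𝓡 2) (S.spherePoint σ))
  rw [ModelWithCorners.range_eq_univ, mfderivWithin_univ] at hinv
  have h2 : ∀ y : S2, MDifferentiableAt (𝓡 2) 𝓘(ℝ, EuclideanSpace ℝ (Fin 3))
      (fun y : S2 => y.1) y := fun y =>
    (contMDiff_coe_sphere (m := 1)).contMDiffAt.mdifferentiableAt (by simp)
  have hs : (extChartAt (𝓡 2) (S.spherePoint σ)).symm (S.fibreCoord σ) = S.spherePoint σ :=
    extChartAt_to_inv _
  have hr := range_mvfderiv_subtypeVal (n := 2)
    ((extChartAt (𝓡 2) (S.spherePoint σ)).symm (S.fibreCoord σ))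
  have hm : v ∈ (ℝ ∙ (((extChartAt (𝓡 2) (S.spherePoint σ)).symm (S.fibreCoord σ) : S2) :
      EuclideanSpace ℝ (Fin 3)))ᗮ := by
    rw [hs, Submodule.mem_orthogonal_singleton_iff_inner_right]
    exact hv
  rw [← hr] at hm
  obtain ⟨z, hz⟩ := hm
  obtain ⟨w, hw⟩ := hinv.surjective z
  refine ⟨w, ?_⟩
  have h3 := mfderiv_comp_apply (S.fibreCoord σ) (h2 _) h1 w
  rw [← mfderiv_eq_fderiv]
  refine Eq.trans h3 ?_
  refine Eq.trans ?_ hz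
  exact congrArg _ hw

/-- The coordinate vector of a tangent vector in the chart at its base point. -/
def chartVec (σ : S.Twistor) :
    S.TangentTwistor σ →L[ℝ] EuclideanSpace ℝ (Fin 5) × EuclideanSpace ℝ (Fin 2) :=
  mfderiv ((𝓡 5).prod (𝓡 2)) 𝓘(ℝ, EuclideanSpace ℝ (Fin 5) × EuclideanSpace ℝ (Fin 2))
    (extChartAt ((𝓡 5).prod (𝓡 2)) σ) σ

lemma chartVec_surjective (σ : S.Twistor) : Function.Surjective (S.chartVec σ) :=
  (isInvertible_mfderiv_extChartAt (I := (𝓡 5).prod (𝓡 2))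
    (mem_extChartAt_source (I := (𝓡 5).prod (𝓡 2)) σ)).surjective

lemma mdifferentiableAt_extChartAt_self (σ : S.Twistor) :
    MDifferentiableAt ((𝓡 5).prod (𝓡 2))
      𝓘(ℝ, EuclideanSpace ℝ (Fin 5) × EuclideanSpace ℝ (Fin 2))
      (extChartAt ((𝓡 5).prod (𝓡 2)) σ) σ :=
  mdifferentiableAt_extChartAt (mem_chart_source _ σ)

lemma mdifferentiableAt_chart_symm (p : M) {u : EuclideanSpace ℝ (Fin 5)}
    (hu : u ∈ (extChartAt (𝓡 5) p).target) :
    MDifferentiableAt 𝓘(ℝ, EuclideanSpace ℝ (Fin 5)) (𝓡 5) (extChartAt (𝓡 5) p).symm u := by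
  have := mdifferentiableWithinAt_extChartAt_symm (I := 𝓡 5) hu
  rwa [ModelWithCorners.range_eq_univ, mdifferentiableWithinAt_univ] at this

lemma proj_eventuallyEq (σ : S.Twistor) : (fun τ : S.Twistor => τ.proj) =ᶠ[nhds σ]
    fun τ => (extChartAt (𝓡 5) σ.proj).symm (extChartAt ((𝓡 5).prod (𝓡 2)) σ τ).1 := by
  filter_upwards [extChartAt_source_mem_nhds (I := (𝓡 5).prod (𝓡 2)) σ] with τ hτ
  have h := (extChartAt ((𝓡 5).prod (𝓡 2)) σ).left_inv hτ
  rw [extChartAt_symm_apply] at h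
  exact (congrArg TotalSpace.proj h).symm

lemma hasMFDerivAt_chart_symm_fst (p : M)
    {w : EuclideanSpace ℝ (Fin 5) × EuclideanSpace ℝ (Fin 2)}
    (hu : w.1 ∈ (extChartAt (𝓡 5) p).target) :
    HasMFDerivAt 𝓘(ℝ, EuclideanSpace ℝ (Fin 5) × EuclideanSpace ℝ (Fin 2)) (𝓡 5)
      (fun w : EuclideanSpace ℝ (Fin 5) × EuclideanSpace ℝ (Fin 2) =>
        (extChartAt (𝓡 5) p).symm w.1) w
      ((chartSymmDeriv p w.1).comp
        (ContinuousLinearMap.fst ℝ (EuclideanSpace ℝ (Fin 5)) (EuclideanSpace ℝ (Fin 2)))) := by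
  have h1 := (mdifferentiableAt_chart_symm p hu).hasMFDerivAt
  have h2 : HasMFDerivAt 𝓘(ℝ, EuclideanSpace ℝ (Fin 5) × EuclideanSpace ℝ (Fin 2))
      𝓘(ℝ, EuclideanSpace ℝ (Fin 5)) Prod.fst w
        (ContinuousLinearMap.fst ℝ (EuclideanSpace ℝ (Fin 5)) (EuclideanSpace ℝ (Fin 2))) :=
    hasFDerivAt_fst.hasMFDerivAt
  exact h1.comp w h2

lemma hasMFDerivAt_proj (σ : S.Twistor) :
    HasMFDerivAt ((𝓡 5).prod (𝓡 2)) (𝓡 5) (fun τ : S.Twistor => τ.proj) σ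
      ((tangentOfChart σ.proj).comp
        ((ContinuousLinearMap.fst ℝ (EuclideanSpace ℝ (Fin 5)) (EuclideanSpace ℝ (Fin 2))).comp
          (S.chartVec σ))) := by
  have h1 := hasMFDerivAt_chart_symm_fst σ.proj
    (w := extChartAt ((𝓡 5).prod (𝓡 2)) σ σ) (mem_extChartAt_target (I := 𝓡 5) σ.proj)
  have h2 := (S.mdifferentiableAt_extChartAt_self σ).hasMFDerivAt
  exact (h1.comp σ h2).congr_of_eventuallyEq (S.proj_eventuallyEq σ)

lemma dproj_eq (σ : S.Twistor) (A : S.TangentTwistor σ) :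
    S.dproj σ A = tangentOfChart σ.proj (S.chartVec σ A).1 := by
  have h := (S.hasMFDerivAt_proj σ).mfderiv
  exact congrArg (fun f => f A) h

lemma dproj_mfderiv_symm (σ : S.Twistor)
    {w : EuclideanSpace ℝ (Fin 5) × EuclideanSpace ℝ (Fin 2)}
    (hw : w ∈ (extChartAt ((𝓡 5).prod (𝓡 2)) σ).target)
    (hw' : w.1 ∈ (extChartAt (𝓡 5) σ.proj).target)
    (v : EuclideanSpace ℝ (Fin 5) × EuclideanSpace ℝ (Fin 2)) :
    S.dproj ((extChartAt ((𝓡 5).prod (𝓡 2)) σ).symm w)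
      (mfderiv 𝓘(ℝ, EuclideanSpace ℝ (Fin 5) × EuclideanSpace ℝ (Fin 2)) ((𝓡 5).prod (𝓡 2))
        (extChartAt ((𝓡 5).prod (𝓡 2)) σ).symm w v) = chartSymmDeriv σ.proj w.1 v.1 := by
  have h1 := mdifferentiableWithinAt_extChartAt_symm (I := (𝓡 5).prod (𝓡 2)) hw
  rw [ModelWithCorners.range_eq_univ, mdifferentiableWithinAt_univ] at h1
  have h2 := (S.hasMFDerivAt_proj
    ((extChartAt ((𝓡 5).prod (𝓡 2)) σ).symm w)).mdifferentiableAt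
  have h3 := mfderiv_comp_apply w h2 h1 v
  have h4 := (hasMFDerivAt_chart_symm_fst σ.proj hw').mfderiv
  refine Eq.trans h3.symm ?_
  exact congrArg (fun f => f v) h4

end IrrSO3Structure

/-! ### Fibre coordinates -/

namespace IrrSO3

lemma bivInner_sum_kappa_sum_kappa (v y : Fin 3 → ℝ) :
    bivInner (∑ i, v i • kappa i) (∑ i, y i • kappa i) = 5 * (v ⬝ᵥ y) := by
  have h := sqrt_three_mul_self
  rw [sum_kappa, sum_kappa]
  simp [bivInner, Fin.sum_univ_five, dotProduct, Fin.sum_univ_three]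
  generalize √3 = r at h ⊢
  grind

lemma xiPolar_sub (y v w : Fin 3 → ℝ) : xiPolar y (v - w) = xiPolar y v - xiPolar y w := by
  ext i
  fin_cases i <;> simp [xiPolar] <;> ring

lemma sum_kappa_injective {u v : Fin 3 → ℝ}
    (h : ∑ i, u i • kappa i = ∑ i, v i • kappa i) : u = v := by
  rw [← kappaCoord_sum u, h, kappaCoord_sum]

/-- The chain rule for the components of `xiVec`, whose derivative is `xiPolar`. -/
lemma hasFDerivAt_xiVec {F : Type*} [NormedAddCommGroup F] [NormedSpace ℝ F]
    {s : F → EuclideanSpace ℝ (Fin 3)} {s' : F →L[ℝ] EuclideanSpace ℝ (Fin 3)} {w : F}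
    (hs : HasFDerivAt s s' w) (i : Fin 5) :
    ∃ D : F →L[ℝ] ℝ, HasFDerivAt (fun w => xiVec (s w) i) D w ∧
      ∀ a, D a = xiPolar (s w) (s' a) i := by
  have h : ∀ j, HasFDerivAt (fun w => s w j) ((EuclideanSpace.proj j).comp s') w := fun j =>
    (EuclideanSpace.proj (𝕜 := ℝ) j).hasFDerivAt.comp w hs
  fin_cases i
  · refine ⟨_, (((((h 0).mul (h 0)).add ((h 1).mul (h 1))).const_mul (1 / 2)).sub
      ((h 2).mul (h 2))).congr_of_eventuallyEq (.of_forall fun w => ?_), fun a => ?_⟩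
    · simp [xiVec]; ring
    · simp [xiPolar]; ring
  · refine ⟨_, (((h 0).mul (h 1)).const_mul (-√3)).congr_of_eventuallyEq
      (.of_forall fun w => ?_), fun a => ?_⟩
    · simp [xiVec]
    · simp [xiPolar]; ring
  · refine ⟨_, (((h 0).mul (h 2)).const_mul (√3)).congr_of_eventuallyEq
      (.of_forall fun w => ?_), fun a => ?_⟩
    · simp [xiVec]
    · simp [xiPolar]; ring
  · refine ⟨_, ((((h 1).mul (h 1)).sub ((h 0).mul (h 0))).const_mul (√3 / 2)).congr_of_eventuallyEq
      (.of_forall fun w => ?_), fun a => ?_⟩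
    · simp [xiVec]; ring
    · simp [xiPolar]; ring
  · refine ⟨_, (((h 1).mul (h 2)).const_mul (-√3)).congr_of_eventuallyEq
      (.of_forall fun w => ?_), fun a => ?_⟩
    · simp [xiVec]
    · simp [xiPolar]; ring

end IrrSO3

namespace IrrSO3Structure

open IrrSO3

variable {M : Type*} [TopologicalSpace M] [ChartedSpace (EuclideanSpace ℝ (Fin 5)) M]
  [IsManifold (𝓡 5) ∞ M] (S : IrrSO3Structure M)

/-- The coordinates of `σ` with respect to `κ₁, κ₂, κ₃` in the chosen adapted frame. -/
def fibreVec (σ : S.Twistor) : Fin 3 → ℝ := (S.spherePoint σ).1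

lemma fibreVec_dot_self (σ : S.Twistor) : S.fibreVec σ ⬝ᵥ S.fibreVec σ = 1 := by
  have h := (mem_S2_iff _).1 (S.spherePoint σ).2
  simpa [dotProduct, pow_two, fibreVec] using h

/-- In the local frame near `π(σ)`, the inverse of the chart at `σ` is `(u, w) ↦ ∑ yᵢ(w) κᵢ` over
the point with coordinates `u`. -/
lemma toMat_endo_symm (σ : S.Twistor) {w : EuclideanSpace ℝ (Fin 5) × EuclideanSpace ℝ (Fin 2)}
    (hw : (extChartAt (𝓡 5) σ.proj).symm w.1 ∈ (S.frameNear σ.proj).U) :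
    S.toMat (fun j => (S.frameNear σ.proj).E j ((extChartAt (𝓡 5) σ.proj).symm w.1))
      (S.endo ((extChartAt ((𝓡 5).prod (𝓡 2)) σ).symm w)) =
        ∑ i, S.sphereCoe σ w.2 i • kappa i := by
  have h := S.toMat_ofMat (S.frameOf_mem (S.frameNear σ.proj)
    ((extChartAt (𝓡 5) σ.proj).symm w.1)) (∑ i, S.sphereCoe σ w.2 i • kappa i)
  rw [← S.frameOf_eq _ hw]
  exact h

/-- The frame of the chosen local frame at its centre is the chosen frame there, so both give the
same matrix of `σ`. -/
lemma mat_eq (σ : S.Twistor) : S.mat σ = ∑ i, S.fibreVec σ i • kappa i := by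
  have h := sum_kappaCoord (F := S.mat σ) σ.2.2.1
  rw [← h]
  have h2 : S.frameOf (S.frameNear σ.proj) σ.proj = S.frame σ.proj :=
    S.frameOf_eq _ (S.mem_frameNear _)
  have h3 : S.fibreVec σ = kappaCoord (S.toMat (S.frameOf (S.frameNear σ.proj) σ.proj) σ.2.1) := rfl
  rw [h3, h2]
  rfl

lemma coordNear_self (σ : S.Twistor) (i : Fin 3) :
    S.coordNear σ.proj i σ = S.fibreVec σ i := by
  have h : S.coordNear σ.proj i σ = kappaCoord (S.mat σ) i := rfl
  rw [h, mat_eq, kappaCoord_sum]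

lemma coordNear_eventuallyEq (σ : S.Twistor) (i : Fin 3) :
    S.coordNear σ.proj i =ᶠ[nhds σ]
      fun τ => S.sphereCoe σ (extChartAt ((𝓡 5).prod (𝓡 2)) σ τ).2 i := by
  have hU : ∀ᶠ τ : S.Twistor in nhds σ, τ.proj ∈ (S.frameNear σ.proj).U :=
    (FiberBundle.continuous_proj S2 S.TwistorFibre).continuousAt.eventually
      ((S.frameNear σ.proj).isOpen.mem_nhds (S.mem_frameNear σ.proj))
  filter_upwards [extChartAt_source_mem_nhds (I := (𝓡 5).prod (𝓡 2)) σ, hU] with τ hτ hτU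
  obtain ⟨w, hw⟩ : ∃ w, w = extChartAt ((𝓡 5).prod (𝓡 2)) σ τ := ⟨_, rfl⟩
  have h : (extChartAt ((𝓡 5).prod (𝓡 2)) σ).symm w = τ := by
    rw [hw]; exact (extChartAt ((𝓡 5).prod (𝓡 2)) σ).left_inv hτ
  rw [← hw]
  subst h
  have h2 := S.toMat_endo_symm σ (w := w) hτU
  exact (congrFun (congrArg kappaCoord h2) i).trans (congrFun (kappaCoord_sum _) i)

lemma dcoord_eq (σ : S.Twistor) (i : Fin 3) (A : S.TangentTwistor σ) :
    S.dcoord σ i A = fderiv ℝ (S.sphereCoe σ) (S.fibreCoord σ) (S.chartVec σ A).2 i := by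
  have h1 : HasFDerivAt (fun w : EuclideanSpace ℝ (Fin 5) × EuclideanSpace ℝ (Fin 2) =>
      S.sphereCoe σ w.2 i) (((EuclideanSpace.proj i).comp (fderiv ℝ (S.sphereCoe σ)
        (S.fibreCoord σ))).comp (ContinuousLinearMap.snd ℝ (EuclideanSpace ℝ (Fin 5))
          (EuclideanSpace ℝ (Fin 2)))) (S.baseCoord σ, S.fibreCoord σ) := by
    have h2 := (EuclideanSpace.proj (𝕜 := ℝ) i).hasFDerivAt.comp (S.fibreCoord σ)
      (S.differentiableAt_sphereCoe σ).hasFDerivAt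
    exact HasFDerivAt.comp (f := Prod.snd) (S.baseCoord σ, S.fibreCoord σ) h2 hasFDerivAt_snd
  have h3 := HasMFDerivAt.comp (f := extChartAt ((𝓡 5).prod (𝓡 2)) σ) σ h1.hasMFDerivAt
    (S.mdifferentiableAt_extChartAt_self σ).hasMFDerivAt
  have h4 := (h3.congr_of_eventuallyEq (S.coordNear_eventuallyEq σ i)).mfderiv
  exact congrArg (fun f => f A) h4

/-- The differentials of the projection and of the fibre coordinates are jointly onto the pairs of
`X ∈ T_pM` and `u` tangent to the sphere. -/
lemma exists_dproj_dcoord (σ : S.Twistor) (X : TangentSpace (𝓡 5) σ.proj) (u : Fin 3 → ℝ)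
    (hu : S.fibreVec σ ⬝ᵥ u = 0) :
    ∃ A : S.TangentTwistor σ, S.dproj σ A = X ∧ ∀ i, S.dcoord σ i A = u i := by
  obtain ⟨v, hv⟩ := tangentOfChart_surjective σ.proj X
  obtain ⟨w, hw⟩ := S.exists_fderiv_sphereCoe σ (WithLp.toLp 2 u) (by
    rw [PiLp.inner_apply, ← hu]
    simp [dotProduct, fibreVec, mul_comm])
  obtain ⟨A, hA⟩ := S.chartVec_surjective σ (v, w)
  refine ⟨A, ?_, fun i => ?_⟩
  · rw [dproj_eq, hA, hv]
  · rw [dcoord_eq, hA, hw]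

end IrrSO3Structure

namespace IrrSO3Structure

open IrrSO3

variable {M : Type*} [TopologicalSpace M] [ChartedSpace (EuclideanSpace ℝ (Fin 5)) M]
  [IsManifold (𝓡 5) ∞ M] (S : IrrSO3Structure M)
  (nabla : CovariantDerivative (𝓡 5) (EuclideanSpace ℝ (Fin 5))
    (fun x : M => TangentSpace (𝓡 5) x))

/-! ### Horizontal and vertical vectors -/

variable {S} in
lemma LocalFrame.mdifferentiableAt_sum (L : S.LocalFrame) {p : M} (hp : p ∈ L.U)
    (s : Finset (Fin 5)) (c : Fin 5 → ℝ) :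
    MDifferentiableAt (𝓡 5) ((𝓡 5).prod 𝓘(ℝ, EuclideanSpace ℝ (Fin 5)))
      (fun x => (⟨x, ∑ k ∈ s, c k • L.E k x⟩ : TangentBundle (𝓡 5) M)) p :=
  MDifferentiableAt.sum_section (t := fun k x => c k • L.E k x) fun k _ =>
    MDifferentiableAt.smul_section (f := fun _ => c k) mdifferentiableAt_const
      (L.mdifferentiableAt hp k)

variable {S} in
/-- A connection is linear on combinations of frame fields with constant coefficients. -/
lemma LocalFrame.nabla_sum (L : S.LocalFrame) {p : M} (hp : p ∈ L.U)
    (s : Finset (Fin 5)) (c : Fin 5 → ℝ) :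
    nabla (fun x => ∑ k ∈ s, c k • L.E k x) p = ∑ k ∈ s, c k • nabla (L.E k) p := by
  classical
  induction s using Finset.induction_on with
  | empty =>
    simp only [Finset.sum_empty]
    exact congrFun nabla.zero p
  | insert k s hk ih =>
    rw [Finset.sum_insert hk, ← ih]
    have h1 := nabla.isCovariantDerivativeOnUniv.add (σ := c k • L.E k)
      (σ' := fun x => ∑ k ∈ s, c k • L.E k x) (x := p)
      (MDifferentiableAt.smul_section (f := fun _ => c k) mdifferentiableAt_const
        (L.mdifferentiableAt hp k)) (L.mdifferentiableAt_sum hp s c)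
    have h2 := nabla.isCovariantDerivativeOnUniv.smul_const (c k) (L.mdifferentiableAt hp k)
    rw [← h2, ← h1]
    congr 1
    funext x
    simp [Finset.sum_insert hk]

/-- The matrix of `∇_X κᵢ` is the commutator of the connection matrix with `κᵢ`. -/
lemma toMat_covEnd_kappaSec (p : M) (X : TangentSpace (𝓡 5) p) (i : Fin 3)
    (Γ : Matrix (Fin 5) (Fin 5) ℝ)
    (hΓ : ∀ j, nabla ((S.frameNear p).E j) p X = ∑ k, Γ k j • S.frame p k) :
    S.toMat (S.frame p) (S.covEnd nabla (S.kappaSec p i) p X) = Γ * kappa i - kappa i * Γ := by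
  have hp := S.mem_frameNear p
  have hcol : ∀ y ∈ (S.frameNear p).U, ∀ j, S.kappaSec p i y ((S.frameNear p).E j y) =
      ∑ k, kappa i k j • (S.frameNear p).E k y := by
    intro y hy j
    have ha := (S.frameNear p).adapted y hy
    simp [kappaSec, ofMat, LinearMap.sum_apply, S.g_adapted ha]
  have hnab : ∀ j, nabla (fun y => S.kappaSec p i y ((S.frameNear p).E j y)) p X =
      ∑ k, kappa i k j • ∑ l, Γ l k • S.frame p l := by
    intro j
    have hev : ∀ᶠ y in nhds p, ∑ k, kappa i k j • (S.frameNear p).E k y =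
        S.kappaSec p i y ((S.frameNear p).E j y) := by
      filter_upwards [(S.frameNear p).isOpen.mem_nhds hp] with y hy
      exact (hcol y hy j).symm
    have hd := (S.frameNear p).mdifferentiableAt_sum hp Finset.univ fun k => kappa i k j
    have hd' : MDifferentiableAt (𝓡 5) ((𝓡 5).prod 𝓘(ℝ, EuclideanSpace ℝ (Fin 5)))
        (fun y => (⟨y, S.kappaSec p i y ((S.frameNear p).E j y)⟩ : TangentBundle (𝓡 5) M)) p :=
      hd.congr_of_eventuallyEq (hev.mono fun y hy => congrArg (TotalSpace.mk y) hy.symm)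
    rw [← nabla.isCovariantDerivativeOnUniv.congr_of_eventuallyEq hd hd' Filter.univ_mem hev,
      (S.frameNear p).nabla_sum nabla hp]
    simp [hΓ, sum_apply]
  have hF := S.frame_mem p
  ext m l
  have h1 : S.covEnd nabla (S.kappaSec p i) p X (S.frame p l) =
      (∑ k, kappa i k l • ∑ r, Γ r k • S.frame p r) -
        S.ofMat (S.frame p) (kappa i) (∑ r, Γ r l • S.frame p r) := by
    simp only [covEnd, hnab, hΓ]
    simp only [LinearMap.sum_apply, LinearMap.smulRight_apply, S.g_frame]
    simp
    rfl
  rw [toMat, Matrix.of_apply, h1, map_sub, S.g_ofMat hF]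
  simp [S.g_frame, Matrix.mul_apply, Matrix.mulVec, dotProduct, mul_comm]

/-- With connection matrix `∑ bᵢ κᵢ` along `π_* A`, the connection map is `A ↦ dy(A) + y × b` in the
fibre coordinates `y`. -/
lemma toMat_connMap (σ : S.Twistor) (A : S.TangentTwistor σ) (b : Fin 3 → ℝ)
    (hb : ∀ j, nabla ((S.frameNear σ.proj).E j) σ.proj (S.dproj σ A) =
      ∑ k, (∑ i, b i • kappa i) k j • S.frame σ.proj k) :
    S.toMat (S.frame σ.proj) (S.connMap nabla σ A) =
      ∑ i, ((fun i => S.dcoord σ i A) + S.fibreVec σ ⨯₃ b) i • kappa i := by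
  have hk : ∀ i, S.kappaSec σ.proj i σ.proj = S.ofMat (S.frame σ.proj) (kappa i) := fun i => rfl
  have hadd : ∀ F G : Module.End ℝ (TangentSpace (𝓡 5) σ.proj),
      S.toMat (S.frame σ.proj) (F + G) = S.toMat (S.frame σ.proj) F +
        S.toMat (S.frame σ.proj) G := by
    intro F G; ext m l; simp [toMat]
  have hsmul : ∀ (c : ℝ) (F : Module.End ℝ (TangentSpace (𝓡 5) σ.proj)),
      S.toMat (S.frame σ.proj) (c • F) = c • S.toMat (S.frame σ.proj) F := by
    intro c F; ext m l; simp [toMat]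
  have hcomm := sum_kappa_commutator b (S.fibreVec σ)
  rw [connMap, Fin.sum_univ_three]
  simp only [hadd, hsmul, hk, S.toMat_ofMat (S.frame_mem σ.proj), coordNear_self,
    S.toMat_covEnd_kappaSec nabla σ.proj (S.dproj σ A) _ _ hb]
  simp only [Pi.add_apply, add_smul, Finset.sum_add_distrib, ← hcomm]
  generalize ∑ i, b i • kappa i = B
  simp only [Fin.sum_univ_three, mul_add, add_mul, Matrix.mul_smul, Matrix.smul_mul, smul_sub]
  abel

end IrrSO3Structure

namespace IrrSO3Structure

open IrrSO3

variable {M : Type*} [TopologicalSpace M] [ChartedSpace (EuclideanSpace ℝ (Fin 5)) M]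
  [IsManifold (𝓡 5) ∞ M] (S : IrrSO3Structure M)
  {nabla : CovariantDerivative (𝓡 5) (EuclideanSpace ℝ (Fin 5))
    (fun x : M => TangentSpace (𝓡 5) x)}

/-- The connection form of an `SO(3)`-connection in the chosen local frame near `p`, at `p`, with
values in the span of `κ₁, κ₂, κ₃`. -/
lemma IsSO3Connection.exists_connectionForm (h : S.IsSO3Connection nabla) (p : M) :
    ∃ b : TangentSpace (𝓡 5) p → Fin 3 → ℝ, ∀ X j, nabla ((S.frameNear p).E j) p X =
      ∑ k, (∑ i, b X i • kappa i) k j • S.frame p k := by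
  choose A hA hA' using h (S.frameNear p) p (S.mem_frameNear p)
  refine ⟨fun X => ![-A X 1 2, -A X 0 2, -A X 0 1], fun X j => ?_⟩
  rw [← iotaLie_eq_sum_kappa (hA X), hA' X j]
  rfl

/-- In the fibre coordinates the vertical vectors at `σ` are the tangent vectors of the unit
sphere. -/
lemma exists_of_mem_Vert {σ : S.Twistor} {V : Module.End ℝ (TangentSpace (𝓡 5) σ.proj)}
    (hV : V ∈ S.Vert σ) : ∃ v : Fin 3 → ℝ, S.fibreVec σ ⬝ᵥ v = 0 ∧
      S.toMat (S.frame σ.proj) V = ∑ i, v i • kappa i := by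
  obtain ⟨v, hv⟩ := (mem_Lambda23_iff _).1 hV.1
  refine ⟨v, ?_, hv⟩
  have h : bivInner (S.toMat (S.frame σ.proj) V) (S.mat σ) = 0 := hV.2
  rw [hv, mat_eq, bivInner_sum_kappa_sum_kappa, dotProduct_comm] at h
  linarith

lemma ofMat_mem_Vert {σ : S.Twistor} {v : Fin 3 → ℝ} (hv : S.fibreVec σ ⬝ᵥ v = 0) :
    S.ofMat (S.frame σ.proj) (∑ i, v i • kappa i) ∈ S.Vert σ := by
  have h := S.toMat_ofMat (S.frame_mem σ.proj) (∑ i, v i • kappa i)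
  refine ⟨?_, ?_⟩
  · change S.toMat _ _ ∈ Lambda23
    rw [h]
    exact sum_kappa_mem v
  · change bivInner _ (S.mat σ) = 0
    rw [h, mat_eq, bivInner_sum_kappa_sum_kappa, dotProduct_comm, hv, mul_zero]

lemma zero_mem_Vert (σ : S.Twistor) : 0 ∈ S.Vert σ := by
  have h := S.ofMat_mem_Vert (σ := σ) (v := 0) (by simp)
  simpa [ofMat] using h

/-- Every pair of a tangent vector of `M` and a vertical vector comes from `𝕋`. -/
lemma exists_split_eq (hn : S.IsSO3Connection nabla) (σ : S.Twistor)
    (X : TangentSpace (𝓡 5) σ.proj) {V : Module.End ℝ (TangentSpace (𝓡 5) σ.proj)}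
    (hV : V ∈ S.Vert σ) : ∃ A, S.split nabla σ A = (X, V) := by
  obtain ⟨b, hb⟩ := hn.exists_connectionForm S σ.proj
  obtain ⟨v, hv, hv'⟩ := S.exists_of_mem_Vert hV
  obtain ⟨A, hA, hA'⟩ := S.exists_dproj_dcoord σ X (v - S.fibreVec σ ⨯₃ b X) (by
    rw [dotProduct_sub, hv, dot_self_cross, sub_zero])
  refine ⟨A, Prod.ext hA ?_⟩
  change S.connMap nabla σ A = V
  rw [← S.ofMat_toMat (S.frame_mem σ.proj) V, hv',
    ← S.ofMat_toMat (S.frame_mem σ.proj) (S.connMap nabla σ A),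
    S.toMat_connMap nabla σ A (b X) (fun j => by rw [hA]; exact hb X j)]
  simp only [hA', Pi.add_apply, Pi.sub_apply, sub_add_cancel]

lemma split_horLift (hn : S.IsSO3Connection nabla) (σ : S.Twistor)
    (X : TangentSpace (𝓡 5) σ.proj) : S.split nabla σ (S.horLift nabla σ X) = (X, 0) :=
  Function.invFun_eq (S.exists_split_eq hn σ X (S.zero_mem_Vert σ))

lemma split_vertVec (hn : S.IsSO3Connection nabla) (σ : S.Twistor)
    {V : Module.End ℝ (TangentSpace (𝓡 5) σ.proj)} (hV : V ∈ S.Vert σ) :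
    S.split nabla σ (S.vertVec nabla σ V) = (0, V) :=
  Function.invFun_eq (S.exists_split_eq hn σ 0 hV)

/-! ### The exterior derivative of `η` -/

lemma bivInnerAt_zero_right (p : M) (F : Module.End ℝ (TangentSpace (𝓡 5) p)) :
    S.bivInnerAt p F 0 = 0 := by
  simp [bivInnerAt, bivInner, toMat]

/-- The form `η_t` depends neither on the connection nor on `t`: as `χ` is the horizontal lift of
`ξ`, it is `A ↦ g(π_* A, ξ)`. -/
lemma eta_eq (hn : S.IsSO3Connection nabla) (t : ℝ) (σ : S.Twistor) (A : S.TangentTwistor σ) :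
    S.eta nabla t σ A = S.g σ.proj (S.dproj σ A) (S.xiAt σ) := by
  have h := S.split_horLift hn σ (S.xiAt σ)
  have h1 : S.dproj σ (S.horLift nabla σ (S.xiAt σ)) = S.xiAt σ := congrArg Prod.fst h
  have h2 : S.connMap nabla σ (S.horLift nabla σ (S.xiAt σ)) = 0 := congrArg Prod.snd h
  rw [eta, hMetric, chi, h1, h2, bivInnerAt_zero_right, mul_zero, add_zero]

lemma g_xiAt (τ : S.Twistor) {a : Fin 5 → TangentSpace (𝓡 5) τ.proj} (ha : a ∈ S.adapted τ.proj)
    (X : TangentSpace (𝓡 5) τ.proj) :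
    S.g τ.proj X (S.xiAt τ) = ∑ i, xi (S.toMat a (S.endo τ)) i * S.g τ.proj (a i) X := by
  rw [S.xiAt_eq τ ha, map_sum]
  refine Finset.sum_congr rfl fun i _ => ?_
  rw [map_smul, smul_eq_mul, S.g_comm]

lemma g_xiAt_frame (τ : S.Twistor) (X : TangentSpace (𝓡 5) τ.proj) :
    S.g τ.proj X (S.xiAt τ) =
      xiVec (S.fibreVec τ) ⬝ᵥ fun i => S.g τ.proj (S.frame τ.proj i) X := by
  rw [S.g_xiAt τ (S.frame_mem _)]
  change ∑ i, xi (S.mat τ) i * _ = _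
  rw [mat_eq, xi_sum_kappa]
  rfl

/-- In the chart at `σ` one has `η = ∑ ξᵢ(y) θⁱ` with the dual coframe `θ` of the local frame. -/
lemma eta_chart (hn : S.IsSO3Connection nabla) (t : ℝ) (σ : S.Twistor) :
    ∀ᶠ w in nhds (S.baseCoord σ, S.fibreCoord σ), ∀ v,
      S.eta nabla t ((extChartAt ((𝓡 5).prod (𝓡 2)) σ).symm w)
        (mfderiv 𝓘(ℝ, EuclideanSpace ℝ (Fin 5) × EuclideanSpace ℝ (Fin 2)) ((𝓡 5).prod (𝓡 2))
          (extChartAt ((𝓡 5).prod (𝓡 2)) σ).symm w v) =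
      ∑ i, xiVec (S.sphereCoe σ w.2) i * (S.frameNear σ.proj).chartCoframe σ.proj i w.1 v.1 := by
  have h1 : ∀ᶠ w in nhds (S.baseCoord σ, S.fibreCoord σ),
      w ∈ (extChartAt ((𝓡 5).prod (𝓡 2)) σ).target :=
    extChartAt_target_mem_nhds (I := (𝓡 5).prod (𝓡 2)) σ
  have h2 := (continuous_fst.tendsto (S.baseCoord σ, S.fibreCoord σ)).eventually
    ((S.frameNear σ.proj).eventually_mem (S.mem_frameNear σ.proj))
  filter_upwards [h1, h2] with w hw hw' v
  have ha := (S.frameNear σ.proj).adapted _ hw'.2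
  rw [S.eta_eq hn]
  have h3 := S.toMat_endo_symm σ hw'.2
  have h4 := S.dproj_mfderiv_symm σ hw hw'.1 v
  refine (S.g_xiAt ((extChartAt ((𝓡 5).prod (𝓡 2)) σ).symm w) ha _).trans
    (Finset.sum_congr rfl fun i _ => ?_)
  congr 1
  · exact congrFun ((congrArg xi h3).trans (xi_sum_kappa _)) i
  · exact congrArg (S.g ((extChartAt (𝓡 5) σ.proj).symm w.1)
      ((S.frameNear σ.proj).E i ((extChartAt (𝓡 5) σ.proj).symm w.1))) h4

/-- The exterior derivative of `η` for an arbitrary `SO(3)`-connection: with `X = π_* A`,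
`Y = π_* B` and the vertical components `V`, `W` of `A`, `B`, which have the fibre coordinates
`v`, `w`, one has `dη(A, B) = g(T(X, Y), ξ) + g(dξ(V), Y) - g(dξ(W), X)`. -/
lemma dEta_eq (hn : S.IsSO3Connection nabla) (t : ℝ) (σ : S.Twistor) (A B : S.TangentTwistor σ)
    (v w : Fin 3 → ℝ)
    (hv : S.toMat (S.frame σ.proj) (S.connMap nabla σ A) = ∑ i, v i • kappa i)
    (hw : S.toMat (S.frame σ.proj) (S.connMap nabla σ B) = ∑ i, w i • kappa i) :
    S.dEta nabla t σ A B =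
      S.g σ.proj (torsion nabla σ.proj (S.dproj σ A) (S.dproj σ B)) (S.xiAt σ) +
      xiPolar (S.fibreVec σ) v ⬝ᵥ (fun i => S.g σ.proj (S.frame σ.proj i) (S.dproj σ B)) -
      xiPolar (S.fibreVec σ) w ⬝ᵥ (fun i => S.g σ.proj (S.frame σ.proj i) (S.dproj σ A)) := by
  obtain ⟨b, hb⟩ := hn.exists_connectionForm S σ.proj
  set L := S.frameNear σ.proj with hL
  have hp : σ.proj ∈ L.U := S.mem_frameNear σ.proj
  set y := S.fibreVec σ with hy
  set X := S.dproj σ A with hX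
  set Y := S.dproj σ B with hY
  -- the product rule for the components `∑ ξᵢ(y) θⁱ(c)` of `η` in the chart
  have hloc : ∀ a c : EuclideanSpace ℝ (Fin 5) × EuclideanSpace ℝ (Fin 2),
      fderiv ℝ (fun w => S.eta nabla t ((extChartAt ((𝓡 5).prod (𝓡 2)) σ).symm w)
        (mfderiv 𝓘(ℝ, EuclideanSpace ℝ (Fin 5) × EuclideanSpace ℝ (Fin 2)) ((𝓡 5).prod (𝓡 2))
          (extChartAt ((𝓡 5).prod (𝓡 2)) σ).symm w c)) (S.baseCoord σ, S.fibreCoord σ) a =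
      ∑ i, (xiPolar y (fderiv ℝ (S.sphereCoe σ) (S.fibreCoord σ) a.2) i *
        L.chartCoframe σ.proj i (S.baseCoord σ) c.1 +
        xiVec y i * fderiv ℝ (L.chartCoframe σ.proj i) (S.baseCoord σ) a.1 c.1) := by
    intro a c
    refine (DFunLike.congr_fun (Filter.EventuallyEq.fderiv_eq
      ((S.eta_chart hn t σ).mono fun w h => h c)) a).trans ?_
    have hs := (S.differentiableAt_sphereCoe σ).hasFDerivAt.comp (f := Prod.snd)
      (S.baseCoord σ, S.fibreCoord σ) hasFDerivAt_snd
    choose D hD hD' using fun i => hasFDerivAt_xiVec hs i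
    have hdc : ∀ i, DifferentiableAt ℝ (L.chartCoframe σ.proj i) (S.baseCoord σ) :=
      L.differentiableAt_chartCoframe hp
    have hθ : ∀ i, HasFDerivAt
        (fun w : EuclideanSpace ℝ (Fin 5) × EuclideanSpace ℝ (Fin 2) =>
          L.chartCoframe σ.proj i w.1 c.1) _ (S.baseCoord σ, S.fibreCoord σ) := fun i =>
      ((hdc i).hasFDerivAt.comp (f := Prod.fst)
        (S.baseCoord σ, S.fibreCoord σ) hasFDerivAt_fst).clm_apply (hasFDerivAt_const c.1 _)
    have hsum := HasFDerivAt.fun_sum fun i (_ : i ∈ Finset.univ) => (hD i).mul (hθ i)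
    refine (DFunLike.congr_fun hsum.fderiv a).trans ?_
    rw [sum_apply]
    refine Finset.sum_congr rfl fun i _ => ?_
    have hys : (S.sphereCoe σ (S.fibreCoord σ) : Fin 3 → ℝ) = y := by
      rw [sphereCoe_fibreCoord]; rfl
    have h5 := hD' i a
    simp only [Function.comp_apply, hys] at h5
    simp [hys, h5]
    ring
  have hdη : S.dEta nabla t σ A B = _ - _ :=
    congrArg₂ (· - ·) (hloc (S.chartVec σ A) (S.chartVec σ B))
      (hloc (S.chartVec σ B) (S.chartVec σ A))
  have hcoA : ∀ i, L.chartCoframe σ.proj i (S.baseCoord σ) (S.chartVec σ A).1 =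
      S.g σ.proj (S.frame σ.proj i) X := by
    intro i
    rw [hX, dproj_eq]
    exact L.chartCoframe_self_apply σ.proj i _
  have hcoB : ∀ i, L.chartCoframe σ.proj i (S.baseCoord σ) (S.chartVec σ B).1 =
      S.g σ.proj (S.frame σ.proj i) Y := by
    intro i
    rw [hY, dproj_eq]
    exact L.chartCoframe_self_apply σ.proj i _
  have hst := fun i => L.extDeriv_chartCoframe hp nabla (fun X => ∑ i, b X i • kappa i) hb i
    (S.chartVec σ A).1 (S.chartVec σ B).1 X Y (S.dproj_eq σ A) (S.dproj_eq σ B)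
  -- the fibre coordinates move by the vertical component minus the rotation by the connection form
  have hvA : (fderiv ℝ (S.sphereCoe σ) (S.fibreCoord σ) (S.chartVec σ A).2 : Fin 3 → ℝ) =
      v - y ⨯₃ b X := by
    have h1 := sum_kappa_injective ((S.toMat_connMap nabla σ A (b X) (hb X)).symm.trans hv)
    rw [← h1, add_sub_cancel_right]
    funext i
    exact (S.dcoord_eq σ i A).symm
  have hvB : (fderiv ℝ (S.sphereCoe σ) (S.fibreCoord σ) (S.chartVec σ B).2 : Fin 3 → ℝ) =
      w - y ⨯₃ b Y := by
    have h1 := sum_kappa_injective ((S.toMat_connMap nabla σ B (b Y) (hb Y)).symm.trans hw)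
    rw [← h1, add_sub_cancel_right]
    funext i
    exact (S.dcoord_eq σ i B).symm
  -- the rotation terms cancel against those of the structure equation: `xiPolar_cross` and skewness
  have hskew : ∀ (c : Fin 3 → ℝ) (z : Fin 5 → ℝ), xiVec y ⬝ᵥ ((∑ i, c i • kappa i) *ᵥ z) =
      -(((∑ i, c i • kappa i) *ᵥ xiVec y) ⬝ᵥ z) := by
    intro c z
    rw [Matrix.dotProduct_mulVec, ← Matrix.mulVec_transpose, sum_kappa_skew, Matrix.neg_mulVec,
      neg_dotProduct]
  have hsA := hskew (b X) fun i => S.g σ.proj (S.frame σ.proj i) Y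
  have hsB := hskew (b Y) fun i => S.g σ.proj (S.frame σ.proj i) X
  have hT := S.g_xiAt_frame σ (torsion nabla σ.proj X Y)
  have hstr : ∀ i, fderiv ℝ (L.chartCoframe σ.proj i) (S.baseCoord σ) (S.chartVec σ A).1
        (S.chartVec σ B).1 = fderiv ℝ (L.chartCoframe σ.proj i) (S.baseCoord σ) (S.chartVec σ B).1
        (S.chartVec σ A).1 + (S.g σ.proj (S.frame σ.proj i) (torsion nabla σ.proj X Y) -
      ((∑ i, b X i • kappa i) *ᵥ fun j => S.g σ.proj (S.frame σ.proj j) Y) i +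
      ((∑ i, b Y i • kappa i) *ᵥ fun j => S.g σ.proj (S.frame σ.proj j) X) i) := fun i =>
    sub_eq_iff_eq_add'.1 (hst i)
  rw [hdη, hT]
  simp only [hcoA, hcoB, hstr, hvA, hvB, xiPolar_sub, xiPolar_cross]
  simp only [dotProduct] at hsA hsB ⊢
  simp only [Pi.sub_apply, mul_add, mul_sub, sub_mul, Finset.sum_add_distrib,
    Finset.sum_sub_distrib, hsA, hsB]
  ring

end IrrSO3Structure

namespace IrrSO3

lemma exists_dotProduct_eq_zero (y : Fin 3 → ℝ) : ∃ v : Fin 3 → ℝ, y ⬝ᵥ v = 0 ∧ v ⬝ᵥ v ≠ 0 := by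
  by_cases h : y 0 = 0
  · exact ⟨![1, 0, 0], by simp [dotProduct, Fin.sum_univ_three, h],
      by simp [dotProduct, Fin.sum_univ_three]⟩
  · refine ⟨![-y 1, y 0, 0], by simp [dotProduct, Fin.sum_univ_three]; ring, ?_⟩
    simp only [dotProduct, Fin.sum_univ_three, Matrix.cons_val]
    have : 0 < y 0 * y 0 := mul_self_pos.2 h
    nlinarith [mul_self_nonneg (y 1)]

end IrrSO3

namespace IrrSO3Structure

open IrrSO3

variable {M : Type*} [TopologicalSpace M] [ChartedSpace (EuclideanSpace ℝ (Fin 5)) M]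
  [IsManifold (𝓡 5) ∞ M] (S : IrrSO3Structure M)
  {nabla : CovariantDerivative (𝓡 5) (EuclideanSpace ℝ (Fin 5))
    (fun x : M => TangentSpace (𝓡 5) x)}

/-! ### Consequences for the contact condition -/

lemma dproj_add (σ : S.Twistor) (A B : S.TangentTwistor σ) :
    S.dproj σ (A + B) = S.dproj σ A + S.dproj σ B :=
  map_add (mfderiv ((𝓡 5).prod (𝓡 2)) (𝓡 5) (fun τ : S.Twistor => τ.proj) σ) A B

lemma dcoord_add (σ : S.Twistor) (i : Fin 3) (A B : S.TangentTwistor σ) :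
    S.dcoord σ i (A + B) = S.dcoord σ i A + S.dcoord σ i B :=
  map_add (mfderiv ((𝓡 5).prod (𝓡 2)) 𝓘(ℝ, ℝ) (S.coordNear σ.proj i) σ) A B

lemma connMap_add (σ : S.Twistor) (A B : S.TangentTwistor σ) :
    S.connMap nabla σ (A + B) = S.connMap nabla σ A + S.connMap nabla σ B := by
  have h : ∀ (Ψ : ∀ y : M, Module.End ℝ (TangentSpace (𝓡 5) y)) (X Y : TangentSpace (𝓡 5) σ.proj),
      S.covEnd nabla Ψ σ.proj (X + Y) =
        S.covEnd nabla Ψ σ.proj X + S.covEnd nabla Ψ σ.proj Y := by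
    intro Ψ X Y
    simp only [covEnd, map_add, ← Finset.sum_add_distrib]
    refine Finset.sum_congr rfl fun j _ => ?_
    ext Z
    simp only [LinearMap.add_apply, LinearMap.smulRight_apply]
    module
  simp only [connMap, dproj_add, dcoord_add, h, ← Finset.sum_add_distrib]
  refine Finset.sum_congr rfl fun j _ => ?_
  module

lemma dproj_horLift (hn : S.IsSO3Connection nabla) (σ : S.Twistor)
    (X : TangentSpace (𝓡 5) σ.proj) : S.dproj σ (S.horLift nabla σ X) = X :=
  congrArg Prod.fst (S.split_horLift hn σ X)

lemma connMap_horLift (hn : S.IsSO3Connection nabla) (σ : S.Twistor)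
    (X : TangentSpace (𝓡 5) σ.proj) : S.connMap nabla σ (S.horLift nabla σ X) = 0 :=
  congrArg Prod.snd (S.split_horLift hn σ X)

lemma dproj_vertVec (hn : S.IsSO3Connection nabla) (σ : S.Twistor)
    {V : Module.End ℝ (TangentSpace (𝓡 5) σ.proj)} (hV : V ∈ S.Vert σ) :
    S.dproj σ (S.vertVec nabla σ V) = 0 :=
  congrArg Prod.fst (S.split_vertVec hn σ hV)

lemma connMap_vertVec (hn : S.IsSO3Connection nabla) (σ : S.Twistor)
    {V : Module.End ℝ (TangentSpace (𝓡 5) σ.proj)} (hV : V ∈ S.Vert σ) :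
    S.connMap nabla σ (S.vertVec nabla σ V) = V :=
  congrArg Prod.snd (S.split_vertVec hn σ hV)

lemma g_frame_xiAt (σ : S.Twistor) (i : Fin 5) :
    S.g σ.proj (S.frame σ.proj i) (S.xiAt σ) = xiVec (S.fibreVec σ) i := by
  rw [g_xiAt_frame]
  simp [g_frame, dotProduct]

lemma g_frame_phi (ε : ℝ) (σ : S.Twistor) (X : TangentSpace (𝓡 5) σ.proj) :
    (fun i => S.g σ.proj (S.frame σ.proj i) (S.phi ε σ X)) =
      (2 / (2 + ε)) • (sdPart ε (∑ i, S.fibreVec σ i • kappa i) *ᵥ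
        ((fun i => S.g σ.proj (S.frame σ.proj i) X) -
          ((fun i => S.g σ.proj (S.frame σ.proj i) X) ⬝ᵥ xiVec (S.fibreVec σ)) •
            xiVec (S.fibreVec σ))) := by
  ext i
  rw [phi, map_smul, S.g_ofMat (S.frame_mem _), mat_eq, Pi.smul_apply]
  congr 3
  ext j
  rw [map_sub, map_smul, g_xiAt_frame, g_frame_xiAt, dotProduct_comm]
  rfl

/-- The relation `± g(φ_± X, W(ξ)) = -g(X, dξ(W))` for `W` vertical, with fibre coordinates `w`. -/
lemma g_phi_apply_xiAt {ε : ℝ} (hε : ε = 1 ∨ ε = -1) (σ : S.Twistor)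
    (X : TangentSpace (𝓡 5) σ.proj) {W : Module.End ℝ (TangentSpace (𝓡 5) σ.proj)}
    {w : Fin 3 → ℝ} (hyw : S.fibreVec σ ⬝ᵥ w = 0)
    (hw : S.toMat (S.frame σ.proj) W = ∑ i, w i • kappa i) :
    ε * S.g σ.proj (S.phi ε σ X) (W (S.xiAt σ)) =
      -(xiPolar (S.fibreVec σ) w ⬝ᵥ fun i => S.g σ.proj (S.frame σ.proj i) X) := by
  have h1 : (fun i => S.g σ.proj (S.frame σ.proj i) (W (S.xiAt σ))) =
      (∑ i, w i • kappa i) *ᵥ xiVec (S.fibreVec σ) := by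
    ext i
    rw [← S.ofMat_toMat (S.frame_mem _) W, S.g_ofMat (S.frame_mem _), hw]
    simp only [g_frame_xiAt]
  have h2 : S.g σ.proj (S.phi ε σ X) (W (S.xiAt σ)) =
      (fun i => S.g σ.proj (S.frame σ.proj i) (S.phi ε σ X)) ⬝ᵥ
        fun i => S.g σ.proj (S.frame σ.proj i) (W (S.xiAt σ)) :=
    S.g_eq_sum (S.frame_mem _) _ _
  rw [h2, h1, g_frame_phi, sdPart_dot ε hε _ w (S.fibreVec_dot_self σ) hyw, dotProduct_comm]

/-- The form `dη` is nonzero on a vertical and a horizontal vector: for `V` vertical and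
`B = (dξ(V))^h` it equals `|dξ(V)|²`, which is three times the square length of the fibre
coordinates of `V`. -/
lemma exists_dEta_ne (hn : S.IsSO3Connection nabla) (t : ℝ) (σ : S.Twistor) :
    ∃ A B, S.dEta nabla t σ A B ≠ 0 ∧ S.dproj σ A = 0 ∧ S.connMap nabla σ B = 0 := by
  obtain ⟨v, hv, hv0⟩ := exists_dotProduct_eq_zero (S.fibreVec σ)
  have hV := S.ofMat_mem_Vert hv
  refine ⟨S.vertVec nabla σ (S.ofMat (S.frame σ.proj) (∑ i, v i • kappa i)),
    S.horLift nabla σ (∑ i, xiPolar (S.fibreVec σ) v i • S.frame σ.proj i), ?_,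
    S.dproj_vertVec hn σ hV, S.connMap_horLift hn σ _⟩
  rw [S.dEta_eq hn t σ _ _ v 0 ?_ ?_, S.dproj_vertVec hn σ hV, S.dproj_horLift hn]
  · have h1 : (fun i => S.g σ.proj (S.frame σ.proj i)
        (∑ i, xiPolar (S.fibreVec σ) v i • S.frame σ.proj i)) = xiPolar (S.fibreVec σ) v :=
      funext fun i => S.g_sum_smul (S.frame_mem _) _ i
    have h2 : (fun i => S.g σ.proj (S.frame σ.proj i) 0) = 0 := by ext i; simp
    have h3 : ∀ Y, torsion nabla σ.proj 0 Y = 0 := by intro Y; simp [torsion]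
    rw [h1, h2, h3, xiPolar_dot_self, hv, S.fibreVec_dot_self]
    simpa using hv0
  · rw [S.connMap_vertVec hn σ hV, S.toMat_ofMat (S.frame_mem _)]
  · rw [S.connMap_horLift hn]
    simp [toMat]
    rfl

lemma cross_zero_right {p : M} (V : Module.End ℝ (TangentSpace (𝓡 5) p)) : S.cross V 0 = 0 := by
  have h1 : kappaCoord (S.toMat (S.frame p) (0 : Module.End ℝ (TangentSpace (𝓡 5) p))) = 0 := by
    ext i; simp [kappaCoord, bivInner, toMat]
  rw [cross, h1]
  simp [ofMat]

/-- The fundamental form vanishes on a vertical and a horizontal vector, since `Φ` preserves the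
horizontal space, which is orthogonal to the vertical one. -/
lemma Omega_eq_zero (hn : S.IsSO3Connection nabla) (ε : ℝ) (n : ℕ) (t : ℝ) (σ : S.Twistor)
    {A B : S.TangentTwistor σ} (hA : S.dproj σ A = 0) (hB : S.connMap nabla σ B = 0) :
    S.Omega nabla ε n t σ A B = 0 := by
  have h : S.connMap nabla σ (S.Phi nabla ε n σ B) = 0 := by
    rw [Phi, connMap_add, S.connMap_horLift hn, hB, cross_zero_right, neg_zero, smul_zero,
      S.connMap_vertVec hn σ (S.zero_mem_Vert σ), add_zero]
  rw [Omega, hMetric, hA, h, bivInnerAt_zero_right]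
  simp

lemma nonempty_twistor [h : Nonempty M] : Nonempty S.Twistor := by
  obtain ⟨p⟩ := h
  exact ⟨⟨p, (S.sphereEquiv (S.frame_mem p)).symm
    ⟨EuclideanSpace.single 0 1, by simp⟩⟩⟩

end IrrSO3Structure

end

/-- The exterior derivative of the contact forms of the twistor space of a `5`-manifold with an
irreducible `SO(3)`-structure. -/
theorem mainTheorem6 {M : Type*} [TopologicalSpace M]
    [ChartedSpace (EuclideanSpace ℝ (Fin 5)) M] [IsManifold (𝓡 5) ∞ M]
    (S : IrrSO3Structure M)
    (nabla : CovariantDerivative (𝓡 5) (EuclideanSpace ℝ (Fin 5))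
      (fun x : M => TangentSpace (𝓡 5) x))
    (hnabla : S.IsSO3Connection nabla) (t : ℝ) (ht : 0 < t) :
    (S.HasSkewTorsion nabla →
      ∀ ε : ℝ, ε = 1 ∨ ε = -1 → ∀ σ : S.Twistor, ∀ X Y : TangentSpace (𝓡 5) σ.proj,
        ∀ V ∈ S.Vert σ, ∀ W ∈ S.Vert σ,
          S.dEta nabla t σ (S.horLift nabla σ X + S.vertVec nabla σ V)
              (S.horLift nabla σ Y + S.vertVec nabla σ W) =
            -(1 / 2) * (S.g σ.proj (IrrSO3Structure.torsion nabla σ.proj X (S.xiAt σ)) Y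
                - S.g σ.proj (IrrSO3Structure.torsion nabla σ.proj Y (S.xiAt σ)) X)
              + ε * (S.g σ.proj (S.phi ε σ X) (W (S.xiAt σ))
                - S.g σ.proj (S.phi ε σ Y) (V (S.xiAt σ)))) ∧
    (∀ σ : S.Twistor, ∃ A B, S.dEta nabla t σ A B ≠ 0) ∧
    (∀ ε : ℝ, ε = 1 ∨ ε = -1 → ∀ n : ℕ, n = 1 ∨ n = 2 →
      (∀ σ : S.Twistor, ∃ A B, S.dEta nabla t σ A B ≠ S.Omega nabla ε n t σ A B) ∧
      (Nonempty M → ¬ IsContactMetric ((𝓡 5).prod (𝓡 2)) (S.Phi nabla ε n) (S.chi nabla)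
        (S.hMetric nabla t))) := by
  have hne : ∀ (ε : ℝ) (n : ℕ) (σ : S.Twistor),
      ∃ A B, S.dEta nabla t σ A B ≠ S.Omega nabla ε n t σ A B := by
    intro ε n σ
    obtain ⟨A, B, h, hA, hB⟩ := S.exists_dEta_ne hnabla t σ
    exact ⟨A, B, by rwa [S.Omega_eq_zero hnabla ε n t σ hA hB]⟩
  refine ⟨?_, fun σ => ?_, fun ε _ n _ => ⟨hne ε n, fun hM hc => ?_⟩⟩
  · intro hskew ε hε σ X Y V hV W hW
    obtain ⟨v, hyv, hv⟩ := S.exists_of_mem_Vert hV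
    obtain ⟨w, hyw, hw⟩ := S.exists_of_mem_Vert hW
    -- `X` and `V` are the components of `X^h + V`
    have hc : ∀ (X : TangentSpace (𝓡 5) σ.proj), ∀ V ∈ S.Vert σ,
        S.dproj σ (S.horLift nabla σ X + S.vertVec nabla σ V) = X ∧
        S.connMap nabla σ (S.horLift nabla σ X + S.vertVec nabla σ V) = V := by
      intro X V hV
      rw [S.dproj_add, S.connMap_add, S.dproj_horLift hnabla, S.connMap_horLift hnabla,
        S.dproj_vertVec hnabla σ hV, S.connMap_vertVec hnabla σ hV, add_zero, zero_add]
      exact ⟨rfl, rfl⟩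
    rw [S.dEta_eq hnabla t σ _ _ v w (by rw [(hc X V hV).2, hv]) (by rw [(hc Y W hW).2, hw]),
      (hc X V hV).1, (hc Y W hW).1]
    have h4 := S.g_phi_apply_xiAt hε σ X hyw hw
    have h5 := S.g_phi_apply_xiAt hε σ Y hyv hv
    rw [mul_sub ε, h4, h5]
    -- skewness gives `g(T(X, Y), ξ) = -g(T(X, ξ), Y)`, whose average with the same for `(Y, X)`
    -- is the torsion term
    have h1 := hskew σ.proj X Y (S.xiAt σ)
    have h2 := hskew σ.proj Y X (S.xiAt σ)
    have h3 : IrrSO3Structure.torsion nabla σ.proj X Y =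
        -IrrSO3Structure.torsion nabla σ.proj Y X := nabla.torsion_antisymm X Y
    rw [h3, map_neg, LinearMap.neg_apply] at h1 ⊢
    linarith
  · obtain ⟨A, B, h, -, -⟩ := S.exists_dEta_ne hnabla t σ
    exact ⟨A, B, h⟩
  · obtain ⟨σ⟩ := S.nonempty_twistor
    obtain ⟨A, B, h⟩ := hne ε n σ
    exact h (hc σ A B)
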